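/- Let $l\in\mathbb N$, $\Gamma\in\mathbb R^{l\times l}$, and write $\mathbf 1=(1,\dots,1)\in\mathbb R^l$. Let $C=C([0,1];\mathbb R^l)$ with canonical process $X$ and $\sigma$-algebra $\sigma(X_t:t\in[0,1])$. For probability measures $\mathbb Q,\mathbb P$ on $C$ put $$h_l(\mathbb Q|\mathbb P):=\liminf_{n\to\infty}2^{-n}\,H\big(\mathbb Q|_{\mathcal F^{2^n}}\,\big|\,\mathbb P|_{\mathcal F^{2^n}}\big),\qquad \mathcal F^{n}:=\sigma(X_{k/n}:k=0,\dots,n),$$ where $H(\mu|\nu)=\int\log\frac{d\mu}{d\nu}\,d\mu$ if $\mu\ll\nu$ and $H(\mu|\nu)=+\infty$ otherwise. Let $M^\Gamma$ be the martingale Black–Scholes model with parameter $\Gamma$ started at $\mathbf 1$, i.e. the continuous adapted solution on $[0,1]$ of $$dM_t=\mathrm{diag}(M_t)\,\Gamma\,dB_t,\qquad M_0=\mathbf 1,$$ with $B$ a standard $\mathbb R^l$-valued Brownian motion, and let $\mathbb B^l$ be the law of standard $\mathbb R^l$-valued Brownian motion started at $\mathbf 1$. Then, with the convention $\log 0=-\infty$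 (so that the value is $+\infty$ if $\Gamma$ is singular), $$h_l(\mathcal L(M^\Gamma)\,|\,\mathbb B^l)=\frac12\Big(\sum_{i=1}^l\big(e^{\sum_{k=1}^l\Gamma_{ik}^2}-1\big)-l+\tfrac12\,\mathrm{tr}(\Gamma\Gamma^T)-\log\det(\Gamma\Gamma^T)\Big).$$ Moreover, Gantert's inequality is an equality in this case: the quadratic covariation of $M=M^\Gamma$ (the limit in probability of the sums of products of increments along partitions of mesh tending to $0$) is absolutely continuous with density $\sigma_t\sigma_t^T$, $\sigma_t=\mathrm{diag}(M_t)\Gamma$, and for every jointly measurable version $G_t$ of the density $d\langle M\rangle_t/dt$, $$h_l(\mathcal L(M^\Gamma)\,|\,\mathbb B^l)=\mathbb E\Big[\int_0^1F_l(G_t)\,dt\Big],\qquad F_l(A):=\tfrac12\big(\mathrm{tr}(A)-l-\log\det A\big).$$ -/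

import Mathlib

open MeasureTheory ProbabilityTheory Filter Topology
open scoped ENNReal NNReal unitInterval

noncomputable section

/-! ### Path space and the specific relative entropy -/

/-- Continuous `ℝ^l`-valued paths on the time interval `[0, 1]`. -/
abbrev PathSpace (l : ℕ) : Type := C(I, Fin l → ℝ)

/-- The σ-algebra on path space generated by the canonical process `X_t(ω) = ω(t)`. -/
instance PathSpace.measurableSpace (l : ℕ) : MeasurableSpace (PathSpace l) :=
  ⨆ t : I, MeasurableSpace.comap (fun ω : PathSpace l => ω t) inferInstance

/-- The time `k / n`, for `k = 0, …, n`. -/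
def gridTime (n : ℕ) (k : Fin (n + 1)) : I :=
  ⟨(k : ℝ) / (n : ℝ), by positivity,
    div_le_one_of_le₀ (by exact_mod_cast Nat.lt_succ_iff.mp k.isLt) (by positivity)⟩

/-- The map `ω ↦ (ω(k / n))_{k = 0, …, n}`. -/
def gridSample {l : ℕ} (n : ℕ) (ω : PathSpace l) : Fin (n + 1) → Fin l → ℝ :=
  fun k => ω (gridTime n k)

/-- The relative entropy of `Q` with respect to `P` on the σ-algebra generated by
`X_{k/n}`, `k = 0, …, n`, i.e. the relative entropy between the laws of
`(X_{k/n})_{k = 0, …, n}` under `Q` and `P`. For probability measures Mathlib's `klDiv` is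
`∫ log (dμ/dν) dμ` if `μ ≪ ν` (it is `∞` when this integral is `∞`), and `∞` otherwise. -/
def gridEntropy {l : ℕ} (n : ℕ) (Q P : Measure (PathSpace l)) : ℝ≥0∞ :=
  InformationTheory.klDiv (Q.map (gridSample n)) (P.map (gridSample n))

/-- The specific relative entropy `h_l(Q | P) = liminf_n 2^{-n} H(Q | P)|_{F^{2^n}}`. -/
def specificEntropy {l : ℕ} (Q P : Measure (PathSpace l)) : ℝ≥0∞ :=
  liminf (fun n : ℕ => gridEntropy (2 ^ n) Q P / (2 : ℝ≥0∞) ^ n) atTop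

/-! ### Brownian motion -/

/-- `B` is an `l`-dimensional standard Brownian motion on `[0, 1]`, started at `x`, with respect
to the filtration `𝓕`: it is continuous (being path-valued) and adapted, `B_0 = x` a.s., and for
`s ≤ t` the increment `B_t - B_s` is independent of `𝓕_s` with law `N(0, (t - s) Id)`. -/
structure IsStandardBM {Ω : Type*} {mΩ : MeasurableSpace Ω} {l : ℕ}
    (𝓕 : Filtration I mΩ) (P : Measure Ω) (x : Fin l → ℝ) (B : Ω → PathSpace l) : Prop where
  adapted : ∀ t : I, Measurable[𝓕 t] (fun ω => B ω t)
  start : ∀ᵐ ω ∂P, B ω 0 = x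
  law_increment : ∀ s t : I, s ≤ t →
    P.map (fun ω => B ω t - B ω s)
      = Measure.pi (fun _ : Fin l => gaussianReal 0 (Real.toNNReal ((t : ℝ) - (s : ℝ))))
  indep_increment : ∀ s t : I, s ≤ t →
    Indep (MeasurableSpace.comap (fun ω => B ω t - B ω s) inferInstance) (𝓕 s) P

/-! ### Partitions, Itô integrals and quadratic covariations -/

/-- A finite partition `0 = t_0 ≤ t_1 ≤ … ≤ t_n = t` of `[0, t]`
(values of `pt` beyond the index `n` are irrelevant). -/
structure TimePartition (t : I) where
  n : ℕ
  pt : ℕ → I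
  mono : Monotone pt
  pt_zero : pt 0 = 0
  pt_last : pt n = t

/-- The mesh `max_k (t_{k+1} - t_k)` of a partition. -/
def TimePartition.mesh {t : I} (p : TimePartition t) : ℝ≥0 :=
  (Finset.range p.n).sup (fun k => nndist (p.pt k) (p.pt (k + 1)))

/-- The filter of partitions of `[0, t]` whose mesh tends to `0`. -/
def meshToZero (t : I) : Filter (TimePartition t) :=
  comap TimePartition.mesh (𝓝 0)

/-- `Z = ∫_0^t H dB` a.s. in the sense of Itô, for a continuous adapted integrand `H` and a
real Brownian motion `B` (with respect to the same filtration): `Z` is the limit in probability,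
as the mesh of the partition tends to `0`, of the sums `∑_k H_{t_k} (B_{t_{k+1}} - B_{t_k})`. -/
def IsItoIntegral {Ω : Type*} {mΩ : MeasurableSpace Ω} (P : Measure Ω)
    (H B : I → Ω → ℝ) (t : I) (Z : Ω → ℝ) : Prop :=
  TendstoInMeasure P
    (fun (p : TimePartition t) ω =>
      ∑ k ∈ Finset.range p.n, H (p.pt k) ω * (B (p.pt (k + 1)) ω - B (p.pt k) ω))
    (meshToZero t) Z

/-- `Z = ⟨X, Y⟩_t` a.s.: the limit in probability, as the mesh of the partition tends to `0`, of
`∑_k (X_{t_{k+1}} - X_{t_k}) (Y_{t_{k+1}} - Y_{t_k})`. -/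
def IsQuadraticCovariation {Ω : Type*} {mΩ : MeasurableSpace Ω} (P : Measure Ω)
    (X Y : I → Ω → ℝ) (t : I) (Z : Ω → ℝ) : Prop :=
  TendstoInMeasure P
    (fun (p : TimePartition t) ω =>
      ∑ k ∈ Finset.range p.n,
        (X (p.pt (k + 1)) ω - X (p.pt k) ω) * (Y (p.pt (k + 1)) ω - Y (p.pt k) ω))
    (meshToZero t) Z

/-- `d⟨M⟩_t / dt = G_t`: the matrix-valued quadratic covariation of `M` is absolutely continuous
with density `G`. -/
structure IsQuadraticCovariationDensity {Ω : Type*} {mΩ : MeasurableSpace Ω} {l : ℕ}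
    (P : Measure Ω) (M : Ω → PathSpace l) (G : I → Ω → Matrix (Fin l) (Fin l) ℝ) : Prop where
  measurable : ∀ i j, Measurable (fun p : I × Ω => G p.1 p.2 i j)
  integrable : ∀ᵐ ω ∂P, ∀ i j, Integrable (fun s : I => G s ω i j) volume
  covariation : ∀ (t : I) (i j : Fin l),
    IsQuadraticCovariation P (fun s ω => M ω s i) (fun s ω => M ω s j) t
      (fun ω => ∫ s in Set.Iic t, G s ω i j)

/-! ### The Black–Scholes model -/

/-- `M` is a (continuous, adapted) solution of the driftless Itô equation `dM_t = c(M_t) dB_t`,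
`M_0 = x`, on `[0, 1]`, where `c` is a continuous matrix-valued coefficient: a.s.
`M_t^i = x_i + ∑_k ∫_0^t c_{ik}(M_s) dB_s^k` for all `i` and `t`. -/
structure IsDriftlessSDESolution {Ω : Type*} {mΩ : MeasurableSpace Ω} {l : ℕ}
    (𝓕 : Filtration I mΩ) (P : Measure Ω) (B : Ω → PathSpace l)
    (c : (Fin l → ℝ) → Matrix (Fin l) (Fin l) ℝ) (x : Fin l → ℝ) (M : Ω → PathSpace l) :
    Prop where
  adapted : ∀ t : I, Measurable[𝓕 t] (fun ω => M ω t)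
  start : ∀ᵐ ω ∂P, M ω 0 = x
  integral_eq : ∀ (t : I) (i : Fin l), ∃ J : Fin l → Ω → ℝ,
    (∀ k, IsItoIntegral P (fun s ω => c (M ω s) i k) (fun s ω => B ω s k) t (J k)) ∧
      ∀ᵐ ω ∂P, M ω t i = x i + ∑ k, J k ω

/-- The coefficient `x ↦ diag(x) Γ` of the martingale Black–Scholes model. -/
def blackScholesCoeff {l : ℕ} (Γ : Matrix (Fin l) (Fin l) ℝ) (x : Fin l → ℝ) :
    Matrix (Fin l) (Fin l) ℝ :=
  Matrix.diagonal x * Γ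

/-- `M` is a martingale Black–Scholes model with parameter `Γ` started at `x`, driven by `B`:
`dM_t = diag(M_t) Γ dB_t`, `M_0 = x`. -/
def IsBlackScholesModel {Ω : Type*} {mΩ : MeasurableSpace Ω} {l : ℕ}
    (𝓕 : Filtration I mΩ) (P : Measure Ω) (B : Ω → PathSpace l)
    (Γ : Matrix (Fin l) (Fin l) ℝ) (x : Fin l → ℝ) (M : Ω → PathSpace l) : Prop :=
  IsDriftlessSDESolution 𝓕 P B (blackScholesCoeff Γ) x M

/-! ### The lower bound in Gantert's inequality -/

/-- `log (det A)` for a matrix with nonnegative determinant, with the convention `log 0 = -∞`. -/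
def logDet {l : ℕ} (A : Matrix (Fin l) (Fin l) ℝ) : EReal :=
  ENNReal.log (ENNReal.ofReal A.det)

/-- `F_l(A) = (tr A - l - log det A) / 2` for positive semidefinite `A`; it is `+∞` if `A` is
singular. It is nonnegative on positive semidefinite matrices. -/
def gantertF {l : ℕ} (A : Matrix (Fin l) (Fin l) ℝ) : EReal :=
  ((1 / 2 : ℝ) : EReal) * (((A.trace - (l : ℝ) : ℝ) : EReal) - logDet A)

/-- The expectation `E[∫_0^1 F_l(G_t) dt]` (an integral of a nonnegative function when `G` is
positive semidefinite). -/
def gantertBound {Ω : Type*} {mΩ : MeasurableSpace Ω} {l : ℕ}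
    (P : Measure Ω) (G : I → Ω → Matrix (Fin l) (Fin l) ℝ) : ℝ≥0∞ :=
  ∫⁻ ω, (∫⁻ t : I, (gantertF (G t ω)).toENNReal) ∂P

end

/-!
**The model is explicit.** A solution of `dM = diag(M) Γ dB`, `M_0 = 1`, has the components
`M_t^i = exp (⟨Γ_i, B_t - B_0⟩ - |Γ_i|² t / 2)`, where `Γ_i` is the `i`-th row of `Γ`
(`IsBlackScholesModel.ae_eq_stochExp`). Since the Itô integral is only given as a limit in probability
of sums over partitions, uniqueness is proved at the level of these sums. Along a fine partition, the
Itô sums for `M^i` minus the stochastic exponential form a process whose increments are conditionally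
centred; frozen when it, or one of the paths, becomes large, it is controlled in `L²` by the discrete
Itô isometry and Grönwall's inequality (`integral_frozen_sq_le`). This needs the Itô sums to be close
to the integrals uniformly over the partition points (`exists_mesh_forall_le_measure_le`), and it
yields `ae_eq_stochExp`.

**The quadratic covariation.** The sum of products of increments of two stochastic exponentials is a
Riemann sum plus a sum of centred noises that vanishes in `L²`. Hence the covariation has the density
`σ σᵀ` (`IsBlackScholesModel.isQuadraticCovariationDensity`), and any other density agrees with it
almost everywhere (`IsQuadraticCovariationDensity.ae_eq`).

**The entropy on a grid.** On the grid of mesh `1 / n`, the increments of `B` and of `W` form the same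
Gaussian vector `b` with `n l` coordinates, and the increments of `M` are `θ(b)` for an explicit smooth
map `θ`: summation and multiplication by `Γ`, a coordinatewise exponential, and taking differences.
The determinant of its differential is `(det Γ)ⁿ` times the product of the values of `M` on the grid
at positive times. If `Γ` is singular, the range of `θ` is a null set by Sard's lemma, and the relative
entropy is infinite. Otherwise `θ` is injective, and by the change of variables formula
(`klDiv_map_eq_integral_log`) the relative entropy is the expectation of
`n / 2 (|θ(b)|² - |b|²) - log |det θ'(b)|`. The expectations of the squared increments
telescope, and `gridEntropy_eq_ofReal` is exact for each `n`; after division by `n = 2ᵐ` it converges.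

**Gantert's bound.** For invertible `Γ`, `F_l(σ_t σ_tᵀ)` is a combination of `(M_t^i)²` and
`log M_t^i`, with expectations `exp (|Γ_i|² t)` and `- |Γ_i|² t / 2`. Its nonnegativity allows the
integrals over the sample space and over time to be exchanged, and the integral over `[0, 1]` is the
same closed form (`gantertBound_eq_ofReal`). For singular `Γ` both sides are infinite.
-/

/-! ### Gaussian moments -/

/-- A linear combination of independent centred Gaussians is a centred Gaussian. -/
lemma map_dotProduct_pi_gaussianReal {ι : Type*} [Fintype ι] (v : ℝ≥0) (γ : ι → ℝ) :
    (Measure.pi fun _ : ι => gaussianReal 0 v).map (fun y => ∑ i, γ i * y i)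
      = gaussianReal 0 (Real.toNNReal (∑ i, γ i ^ 2) * v) := by
  have hm : Measurable (fun y : ι → ℝ => ∑ i, γ i * y i) := by fun_prop
  have : IsProbabilityMeasure
      ((Measure.pi fun _ : ι => gaussianReal 0 v).map (fun y => ∑ i, γ i * y i)) :=
    Measure.isProbabilityMeasure_map hm.aemeasurable
  refine Measure.ext_of_charFun ?_
  ext t
  -- the characteristic function factorises over the coordinates
  rw [charFun_apply_real, integral_map hm.aemeasurable (by fun_prop), charFun_gaussianReal]
  have h1 : ∀ y : ι → ℝ, Complex.exp ((t : ℂ) * ((∑ i, γ i * y i : ℝ) : ℂ) * Complex.I)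
      = ∏ i, Complex.exp (((t * γ i : ℝ) : ℂ) * (y i : ℂ) * Complex.I) := by
    intro y
    rw [← Complex.exp_sum]
    congr 1
    push_cast
    rw [Finset.mul_sum, Finset.sum_mul]
    exact Finset.sum_congr rfl fun i _ => by ring
  simp_rw [h1]
  rw [integral_fintype_prod_eq_prod
    (f := fun (i : ι) (x : ℝ) => Complex.exp (((t * γ i : ℝ) : ℂ) * (x : ℂ) * Complex.I))]
  simp_rw [← charFun_apply_real, charFun_gaussianReal]
  rw [← Complex.exp_sum]
  congr 1
  have hs : ((Real.toNNReal (∑ i, γ i ^ 2) * v : ℝ≥0) : ℝ) = (∑ i, γ i ^ 2) * v := by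
    rw [NNReal.coe_mul, Real.coe_toNNReal _ (Finset.sum_nonneg fun i _ => sq_nonneg _)]
  have hs' : (((Real.toNNReal (∑ i, γ i ^ 2) * v : ℝ≥0) : ℝ) : ℂ)
      = (∑ i, (γ i : ℂ) ^ 2) * (v : ℝ) := by
    rw [hs]; push_cast; ring
  rw [hs', Finset.sum_mul, Finset.sum_mul, Finset.sum_div]
  simp only [Complex.ofReal_zero, mul_zero, zero_mul, zero_sub]
  rw [← Finset.sum_neg_distrib]
  exact Finset.sum_congr rfl fun i _ => by push_cast; ring

section GaussianMoments

variable {Ω : Type*} {mΩ : MeasurableSpace Ω} {P : Measure Ω} {X : Ω → ℝ} {v : ℝ≥0}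

lemma integral_exp_mul_of_map_gaussianReal (hX : P.map X = gaussianReal 0 v) (θ : ℝ) :
    ∫ ω, Real.exp (θ * X ω) ∂P = Real.exp (v * θ ^ 2 / 2) := by
  have := mgf_gaussianReal hX θ
  simpa [mgf] using this

lemma integrable_exp_mul_of_map_gaussianReal (hm : AEMeasurable X P)
    (hX : P.map X = gaussianReal 0 v) (θ : ℝ) :
    Integrable (fun ω => Real.exp (θ * X ω)) P := by
  have h := integrable_exp_mul_gaussianReal (μ := 0) (v := v) θ
  rw [← hX] at h
  exact h.comp_aemeasurable hm

lemma memLp_two_exp_mul_of_map_gaussianReal (hm : AEMeasurable X P)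
    (hX : P.map X = gaussianReal 0 v) (θ : ℝ) :
    MemLp (fun ω => Real.exp (θ * X ω)) 2 P := by
  have h := integrable_exp_mul_of_map_gaussianReal hm hX (2 * θ)
  rw [memLp_two_iff_integrable_sq]
  · refine h.congr (ae_of_all _ fun ω => ?_)
    simp only
    rw [← Real.exp_nat_mul]
    congr 1
    push_cast; ring
  · exact (integrable_exp_mul_of_map_gaussianReal hm hX θ).aestronglyMeasurable

lemma memLp_two_of_map_gaussianReal (hm : AEMeasurable X P) (hX : P.map X = gaussianReal 0 v) :
    MemLp X 2 P := by
  have h := memLp_id_gaussianReal' (μ := 0) (v := v) 2 (by norm_num)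
  rw [← hX] at h
  exact (memLp_map_measure_iff (by fun_prop) hm).1 h

lemma integral_of_map_gaussianReal (hm : AEMeasurable X P) (hX : P.map X = gaussianReal 0 v) :
    ∫ ω, X ω ∂P = 0 := by
  have h := integral_id_gaussianReal (μ := 0) (v := v)
  rw [← hX, integral_map hm (by fun_prop)] at h
  exact h

lemma integral_sq_of_map_gaussianReal (hm : AEMeasurable X P) (hX : P.map X = gaussianReal 0 v) :
    ∫ ω, X ω ^ 2 ∂P = v := by
  have h := variance_fun_id_gaussianReal (μ := 0) (v := v)
  rw [variance_of_integral_eq_zero (by fun_prop) (by simp), ← hX, integral_map hm (by fun_prop)] at h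
  exact h

/-- `E[X exp X]`, obtained by differentiating the moment generating function at `1`. -/
lemma integral_mul_exp_of_map_gaussianReal (hm : AEMeasurable X P)
    (hX : P.map X = gaussianReal 0 v) :
    ∫ ω, X ω * Real.exp (X ω) ∂P = v * Real.exp (v / 2) := by
  have hset : (1 : ℝ) ∈ interior (integrableExpSet X P) := by
    have : integrableExpSet X P = Set.univ := by
      ext θ
      simpa [integrableExpSet] using integrable_exp_mul_of_map_gaussianReal hm hX θ
    simp [this]
  have h1 := deriv_mgf hset
  have h2 : HasDerivAt (fun t : ℝ => Real.exp (v * t ^ 2 / 2)) (v * Real.exp (v / 2)) 1 := by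
    have h3 : HasDerivAt (fun t : ℝ => (v : ℝ) * t ^ 2 / 2) (v : ℝ) 1 := by
      have := ((hasDerivAt_pow 2 (1 : ℝ)).const_mul (v : ℝ)).div_const 2
      simpa using this
    have := h3.exp
    simpa [mul_comm] using this
  have h4 : mgf X P = fun t : ℝ => Real.exp (v * t ^ 2 / 2) := by
    ext t
    rw [mgf_gaussianReal hX]; simp
  rw [h4, h2.deriv] at h1
  simpa using h1.symm

/-- For a centred Gaussian `X` of variance `v`, the relative increment `exp (X - v / 2) - 1` differs
from `X` by `O(v)` in `L²`. -/
lemma integral_sq_sub_exp_of_map_gaussianReal [IsProbabilityMeasure P] (hm : AEMeasurable X P)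
    (hX : P.map X = gaussianReal 0 v) :
    ∫ ω, (X ω - (Real.exp (X ω - v / 2) - 1)) ^ 2 ∂P = Real.exp v - 1 - v := by
  have e1 := integrable_exp_mul_of_map_gaussianReal hm hX 1
  have e2 := integrable_exp_mul_of_map_gaussianReal hm hX 2
  have i1 := (memLp_two_of_map_gaussianReal hm hX).integrable (by norm_num)
  have i2 := (memLp_two_of_map_gaussianReal hm hX).integrable_sq
  have i3 : Integrable (fun ω => X ω * Real.exp (1 * X ω)) P :=
    (memLp_two_of_map_gaussianReal hm hX).integrable_mul
      (memLp_two_exp_mul_of_map_gaussianReal hm hX 1)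
  have hpt : ∀ ω, (X ω - (Real.exp (X ω - v / 2) - 1)) ^ 2
      = X ω ^ 2 + (2 * X ω + (-(2 * Real.exp (-v / 2)) * (X ω * Real.exp (1 * X ω))
        + (Real.exp (-v) * Real.exp (2 * X ω)
        + (-(2 * Real.exp (-v / 2)) * Real.exp (1 * X ω) + 1)))) := by
    intro ω
    have h1 : Real.exp (X ω - v / 2) = Real.exp (-v / 2) * Real.exp (1 * X ω) := by
      rw [← Real.exp_add]; congr 1; ring
    have h2 : Real.exp (-v) * Real.exp (2 * X ω)
        = (Real.exp (-v / 2) * Real.exp (1 * X ω)) ^ 2 := by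
      rw [← Real.exp_add, ← Real.exp_add, ← Real.exp_nat_mul]; congr 1; push_cast; ring
    rw [h2, h1]; ring
  simp_rw [hpt]
  rw [integral_add i2 (by fun_prop), integral_add (by fun_prop) (by fun_prop),
    integral_add (by fun_prop) (by fun_prop), integral_add (by fun_prop) (by fun_prop),
    integral_add (by fun_prop) (by fun_prop)]
  simp only [integral_const_mul]
  rw [integral_sq_of_map_gaussianReal hm hX, integral_of_map_gaussianReal hm hX,
    integral_exp_mul_of_map_gaussianReal hX, integral_exp_mul_of_map_gaussianReal hX]
  simp only [one_mul]
  rw [integral_mul_exp_of_map_gaussianReal hm hX]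
  have h1 : Real.exp (-v / 2) * Real.exp (v / 2) = 1 := by
    rw [← Real.exp_add]; simp; ring_nf
  have h2 : Real.exp (-v) * Real.exp (v * 2 ^ 2 / 2) = Real.exp v := by
    rw [← Real.exp_add]; congr 1; ring
  have h3 : Real.exp ((v : ℝ) * 1 ^ 2 / 2) = Real.exp (v / 2) := by norm_num
  rw [h2, h3]
  simp
  linear_combination (-2 * (v : ℝ) - 2) * h1

end GaussianMoments

/-! ### Centred noise and the discrete Itô isometry -/

/-- `η` is a square-integrable centred random variable, known at time `t` and independent of the
past up to time `s`. -/
structure IsCentredNoise {Ω : Type*} {mΩ : MeasurableSpace Ω} (𝓕 : Filtration I mΩ)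
    (P : Measure Ω) (s t : I) (η : Ω → ℝ) : Prop where
  measurable : Measurable[𝓕 t] η
  indep : Indep (MeasurableSpace.comap η inferInstance) (𝓕 s) P
  memLp : MemLp η 2 P
  integral_eq_zero : ∫ ω, η ω ∂P = 0

section Isometry

variable {Ω : Type*} {mΩ : MeasurableSpace Ω} {P : Measure Ω} {𝓕 : Filtration I mΩ}

lemma indepFun_of_indep_comap {s : I} {a η : Ω → ℝ} (ha : Measurable[𝓕 s] a)
    (h : Indep (MeasurableSpace.comap η inferInstance) (𝓕 s) P) : IndepFun a η P := by
  rw [IndepFun_iff_Indep]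
  exact (indep_of_indep_of_le_right h ha.comap_le).symm

/-- The product of independent square-integrable variables is square-integrable. -/
lemma memLp_two_mul_of_indepFun {a η : Ω → ℝ} (h : IndepFun a η P) (ha : MemLp a 2 P)
    (hη : MemLp η 2 P) : MemLp (fun ω => a ω * η ω) 2 P := by
  refine (memLp_two_iff_integrable_sq (ha.1.mul hη.1)).2 ?_
  have h2 : IndepFun (fun ω => a ω ^ 2) (fun ω => η ω ^ 2) P :=
    h.comp (φ := fun x : ℝ => x ^ 2) (ψ := fun x : ℝ => x ^ 2) (by fun_prop) (by fun_prop)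
  have := h2.integrable_mul ha.integrable_sq hη.integrable_sq
  refine this.congr (ae_of_all _ fun ω => ?_)
  simp [mul_pow]

lemma integral_mul_sq_of_indepFun {a η : Ω → ℝ} (h : IndepFun a η P) (ha : MemLp a 2 P)
    (hη : MemLp η 2 P) :
    ∫ ω, (a ω * η ω) ^ 2 ∂P = (∫ ω, a ω ^ 2 ∂P) * ∫ ω, η ω ^ 2 ∂P := by
  have h2 : IndepFun (fun ω => a ω ^ 2) (fun ω => η ω ^ 2) P :=
    h.comp (φ := fun x : ℝ => x ^ 2) (ψ := fun x : ℝ => x ^ 2) (by fun_prop) (by fun_prop)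
  simp_rw [mul_pow]
  exact h2.integral_fun_mul_eq_mul_integral ha.integrable_sq.1 hη.integrable_sq.1

variable {s : ℕ → I} {a η : ℕ → Ω → ℝ}

lemma measurable_sum_mul_noise (hs : Monotone s)
    (hη : ∀ j, IsCentredNoise 𝓕 P (s j) (s (j + 1)) (η j))
    (ha : ∀ j, Measurable[𝓕 (s j)] (a j)) (n : ℕ) :
    Measurable[𝓕 (s n)] (fun ω => ∑ j ∈ Finset.range n, a j ω * η j ω) := by
  refine Finset.measurable_sum _ fun j hj => ?_
  have hj' : j + 1 ≤ n := Finset.mem_range.1 hj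
  exact ((ha j).mono (𝓕.mono (hs (by omega))) le_rfl).mul
    ((hη j).measurable.mono (𝓕.mono (hs hj')) le_rfl)

lemma memLp_sum_mul_noise (hη : ∀ j, IsCentredNoise 𝓕 P (s j) (s (j + 1)) (η j))
    (ha : ∀ j, Measurable[𝓕 (s j)] (a j)) (ha2 : ∀ j, MemLp (a j) 2 P) (n : ℕ) :
    MemLp (fun ω => ∑ j ∈ Finset.range n, a j ω * η j ω) 2 P :=
  memLp_finsetSum _ fun j _ =>
    memLp_two_mul_of_indepFun (indepFun_of_indep_comap (ha j) (hη j).indep) (ha2 j) (hη j).memLp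

/-- The discrete Itô isometry: for adapted square-integrable coefficients the terms `a j * η j` are
orthogonal. -/
lemma integral_sum_mul_noise_sq (hs : Monotone s)
    (hη : ∀ j, IsCentredNoise 𝓕 P (s j) (s (j + 1)) (η j))
    (ha : ∀ j, Measurable[𝓕 (s j)] (a j)) (ha2 : ∀ j, MemLp (a j) 2 P) (n : ℕ) :
    ∫ ω, (∑ j ∈ Finset.range n, a j ω * η j ω) ^ 2 ∂P
      = ∑ j ∈ Finset.range n, (∫ ω, a j ω ^ 2 ∂P) * ∫ ω, η j ω ^ 2 ∂P := by
  induction n with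
  | zero => simp
  | succ n ih =>
    have hS := memLp_sum_mul_noise hη ha ha2 n
    have hSm := measurable_sum_mul_noise hs hη ha n
    set S : Ω → ℝ := fun ω => ∑ j ∈ Finset.range n, a j ω * η j ω with hSdef
    have hind := indepFun_of_indep_comap (ha n) (hη n).indep
    have hX := memLp_two_mul_of_indepFun hind (ha2 n) (hη n).memLp
    have hcross : ∫ ω, (S ω * a n ω) * η n ω ∂P = 0 := by
      have h1 : IndepFun (fun ω => S ω * a n ω) (η n) P :=
        indepFun_of_indep_comap (hSm.mul (ha n)) (hη n).indep
      rw [h1.integral_fun_mul_eq_mul_integral (hS.1.mul (ha2 n).1) (hη n).memLp.1,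
        (hη n).integral_eq_zero, mul_zero]
    have hcross_int : Integrable (fun ω => S ω * (a n ω * η n ω)) P := hS.integrable_mul hX
    have hpt : ∀ ω, (∑ j ∈ Finset.range (n + 1), a j ω * η j ω) ^ 2
        = S ω ^ 2 + (2 * (S ω * (a n ω * η n ω)) + (a n ω * η n ω) ^ 2) := by
      intro ω
      rw [Finset.sum_range_succ]
      simp only [hSdef]; ring
    simp_rw [hpt]
    have hXs := hX.integrable_sq
    have hrest : Integrable (fun ω => 2 * (S ω * (a n ω * η n ω)) + (a n ω * η n ω) ^ 2) P :=
      (hcross_int.const_mul 2).add hXs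
    rw [integral_add hS.integrable_sq hrest,
      integral_add (hcross_int.const_mul 2) hXs, integral_const_mul, ih, Finset.sum_range_succ,
      integral_mul_sq_of_indepFun hind (ha2 n) (hη n).memLp]
    simp_rw [← mul_assoc]
    rw [hcross]; ring

end Isometry

/-! ### Linear combinations of Brownian motions -/

/-- The increment `⟨γ, B_t - B_s⟩` of a linear combination of the components of `B`. -/
def linIncrement {Ω : Type*} {l : ℕ} (B : Ω → PathSpace l) (γ : Fin l → ℝ) (s t : I) (ω : Ω) : ℝ :=
  ∑ k, γ k * (B ω t k - B ω s k)

section LinIncrement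

variable {Ω : Type*} {mΩ : MeasurableSpace Ω} {l : ℕ} {𝓕 : Filtration I mΩ} {P : Measure Ω}
  {x : Fin l → ℝ} {B : Ω → PathSpace l}

lemma IsStandardBM.measurable_increment (hB : IsStandardBM 𝓕 P x B) {s t : I} (hst : s ≤ t) :
    Measurable[𝓕 t] (fun ω => B ω t - B ω s) :=
  (hB.adapted t).sub ((hB.adapted s).mono (𝓕.mono hst) le_rfl)

lemma measurable_linForm (γ : Fin l → ℝ) : Measurable (fun y : Fin l → ℝ => ∑ k, γ k * y k) := by
  fun_prop

lemma IsStandardBM.measurable_linIncrement (hB : IsStandardBM 𝓕 P x B) (γ : Fin l → ℝ) {s t : I}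
    (hst : s ≤ t) : Measurable[𝓕 t] (linIncrement B γ s t) :=
  (measurable_linForm γ).comp (hB.measurable_increment hst)

lemma IsStandardBM.map_linIncrement (hB : IsStandardBM 𝓕 P x B) (γ : Fin l → ℝ) {s t : I}
    (hst : s ≤ t) :
    P.map (linIncrement B γ s t)
      = gaussianReal 0 (Real.toNNReal ((∑ k, γ k ^ 2) * ((t : ℝ) - s))) := by
  have h1 : linIncrement B γ s t
      = (fun y : Fin l → ℝ => ∑ k, γ k * y k) ∘ (fun ω => B ω t - B ω s) := rfl
  rw [h1, ← Measure.map_map (measurable_linForm γ)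
    ((hB.measurable_increment hst).mono (𝓕.le _) le_rfl), hB.law_increment s t hst,
    map_dotProduct_pi_gaussianReal,
    Real.toNNReal_mul (Finset.sum_nonneg fun i _ => sq_nonneg _)]

/-- Functions of a Brownian increment are independent of the past. -/
lemma IsStandardBM.indep_comp (hB : IsStandardBM 𝓕 P x B) {s t : I} (hst : s ≤ t)
    {f : (Fin l → ℝ) → ℝ} (hf : Measurable f) :
    Indep (MeasurableSpace.comap (fun ω => f (B ω t - B ω s)) inferInstance) (𝓕 s) P := by
  refine indep_of_indep_of_le_left (hB.indep_increment s t hst) ?_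
  have : (fun ω => f (B ω t - B ω s)) = f ∘ (fun ω => B ω t - B ω s) := rfl
  rw [this, ← MeasurableSpace.comap_comp]
  exact MeasurableSpace.comap_mono hf.comap_le

/-- A centred square-integrable function of a Brownian increment is a centred noise. -/
lemma IsStandardBM.isCentredNoise (hB : IsStandardBM 𝓕 P x B) {s t : I} (hst : s ≤ t)
    {f : (Fin l → ℝ) → ℝ} (hf : Measurable f) (h2 : MemLp (fun ω => f (B ω t - B ω s)) 2 P)
    (h0 : ∫ ω, f (B ω t - B ω s) ∂P = 0) :
    IsCentredNoise 𝓕 P s t (fun ω => f (B ω t - B ω s)) :=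
  ⟨hf.comp (hB.measurable_increment hst), hB.indep_comp hst hf, h2, h0⟩

end LinIncrement

/-! ### Partitions with mesh tending to zero -/

lemma mesh_lt_iff {t : I} (p : TimePartition t) {δ : ℝ≥0} (hδ : 0 < δ) :
    p.mesh < δ ↔ ∀ k < p.n, nndist (p.pt k) (p.pt (k + 1)) < δ := by
  simp [TimePartition.mesh, Finset.sup_lt_iff (bot_lt_iff_ne_bot.2 hδ.ne' : ⊥ < δ)]

lemma dist_le_mesh {t : I} (p : TimePartition t) {k : ℕ} (hk : k < p.n) :
    (p.pt (k + 1) : ℝ) - p.pt k ≤ p.mesh := by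
  have h : nndist (p.pt k) (p.pt (k + 1)) ≤ p.mesh :=
    Finset.le_sup (f := fun k => nndist (p.pt k) (p.pt (k + 1))) (Finset.mem_range.2 hk)
  have h2 : dist (p.pt k) (p.pt (k + 1)) ≤ p.mesh := by exact_mod_cast h
  rw [dist_comm, Subtype.dist_eq, Real.dist_eq] at h2
  exact (le_abs_self _).trans h2

lemma sum_increments {t : I} (p : TimePartition t) :
    ∑ k ∈ Finset.range p.n, ((p.pt (k + 1) : ℝ) - p.pt k) = t := by
  rw [Finset.sum_range_sub (fun k => (p.pt k : ℝ)), p.pt_zero, p.pt_last]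
  simp

lemma eventually_meshToZero_iff {t : I} {Q : TimePartition t → Prop} :
    (∀ᶠ p in meshToZero t, Q p) ↔ ∃ δ : ℝ≥0, 0 < δ ∧ ∀ p : TimePartition t, p.mesh < δ → Q p := by
  have h : (𝓝 (0 : ℝ≥0)).HasBasis (fun δ : ℝ≥0 => 0 < δ) (fun δ => Set.Iio δ) := nhds_bot_basis
  rw [meshToZero, (h.comap _).eventually_iff]
  simp

instance (t : I) : (meshToZero t).IsCountablyGenerated := by
  unfold meshToZero; infer_instance

/-- The `k`-th point of the uniform subdivision of `[s, t]` into `n` intervals. It is defined for all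
`k`, and equals `t` from `k = n` on. -/
noncomputable def uniformPoint (s t : I) (n k : ℕ) : I :=
  ⟨s + min ((k : ℝ) / n) 1 * (t - s), by
    have h0 : 0 ≤ min ((k : ℝ) / n) 1 := by positivity
    have h1 : min ((k : ℝ) / n) 1 ≤ 1 := min_le_right _ _
    constructor
    · nlinarith [s.2.1, t.2.1]
    · nlinarith [s.2.2, t.2.2]⟩

lemma monotone_uniformPoint {s t : I} (hst : s ≤ t) (n : ℕ) : Monotone (uniformPoint s t n) := by
  intro i j hij
  have hst' : (s : ℝ) ≤ t := hst
  refine Subtype.mk_le_mk.2 ?_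
  have : min ((i : ℝ) / n) 1 ≤ min ((j : ℝ) / n) 1 := by gcongr
  nlinarith

lemma uniformPoint_zero (s t : I) (n : ℕ) : uniformPoint s t n 0 = s :=
  Subtype.ext (by simp [uniformPoint])

lemma uniformPoint_self (s t : I) {n : ℕ} (hn : n ≠ 0) : uniformPoint s t n n = t :=
  Subtype.ext (by simp [uniformPoint, hn])

lemma uniformPoint_le {s t : I} (hst : s ≤ t) (n k : ℕ) : uniformPoint s t n k ≤ t := by
  have hst' : (s : ℝ) ≤ t := hst
  refine Subtype.mk_le_mk.2 ?_
  have : min ((k : ℝ) / n) 1 ≤ 1 := min_le_right _ _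
  nlinarith

lemma uniformPoint_succ_sub {s t : I} {n k : ℕ} (hk : k < n) :
    (uniformPoint s t n (k + 1) : ℝ) - uniformPoint s t n k = ((t : ℝ) - s) / n := by
  have hn : (0 : ℝ) < n := by exact_mod_cast (Nat.zero_le k).trans_lt hk
  have h1 : ((k + 1 : ℕ) : ℝ) / n ≤ 1 := by
    rw [div_le_one hn]; exact_mod_cast hk
  have h2 : (k : ℝ) / n ≤ 1 := by
    rw [div_le_one hn]; exact_mod_cast hk.le
  simp only [uniformPoint]
  rw [min_eq_left h1, min_eq_left h2]
  push_cast; field_simp; ring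

lemma nndist_uniformPoint_lt {s t : I} (hst : s ≤ t) {δ : ℝ≥0} (hδ : 0 < δ) {n : ℕ}
    (hn : 1 / δ < n) {k : ℕ} (hk : k < n) :
    nndist (uniformPoint s t n k) (uniformPoint s t n (k + 1)) < δ := by
  have hn0 : (0 : ℝ) < n := by exact_mod_cast (Nat.zero_le k).trans_lt hk
  have h1 : dist (uniformPoint s t n k) (uniformPoint s t n (k + 1)) = ((t : ℝ) - s) / n := by
    rw [dist_comm, Subtype.dist_eq, Real.dist_eq, uniformPoint_succ_sub hk, abs_of_nonneg]
    have : (s : ℝ) ≤ t := hst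
    exact div_nonneg (by linarith) hn0.le
  rw [← NNReal.coe_lt_coe, coe_nndist, h1, div_lt_iff₀ hn0]
  have h2 : (1 : ℝ) / δ < n := by exact_mod_cast hn
  rw [div_lt_iff₀ (by exact_mod_cast hδ)] at h2
  linarith [s.2.1, t.2.2, mul_comm (δ : ℝ) n]

/-- A partition of `[0, s]` followed by a subdivision `s = r_0 ≤ … ≤ r_m = t`. -/
def TimePartition.concat {s t : I} (p : TimePartition s) (r : ℕ → I) (m : ℕ) (hr : Monotone r)
    (h0 : r 0 = s) (hm : r m = t) : TimePartition t where
  n := p.n + m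
  pt i := if i ≤ p.n then p.pt i else r (i - p.n)
  mono := by
    intro i j hij
    simp only
    split_ifs with h1 h2 h2
    · exact p.mono hij
    · calc p.pt i ≤ p.pt p.n := p.mono h1
        _ = r 0 := by rw [p.pt_last, h0]
        _ ≤ _ := hr (Nat.zero_le _)
    · omega
    · exact hr (by omega)
  pt_zero := by simp [p.pt_zero]
  pt_last := by
    split_ifs with h
    · have : m = 0 := by omega
      subst this
      simpa [p.pt_last, h0] using hm
    · simpa using hm

section Concat

variable {s t : I} (p : TimePartition s) {r : ℕ → I} {m : ℕ} (hr : Monotone r)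
    (h0 : r 0 = s) (hm : r m = t)

lemma concat_pt_of_le {i : ℕ} (hi : i ≤ p.n) : (p.concat r m hr h0 hm).pt i = p.pt i := by
  simp [TimePartition.concat, hi]

lemma concat_pt_add (i : ℕ) : (p.concat r m hr h0 hm).pt (p.n + i) = r i := by
  rcases Nat.eq_zero_or_pos i with rfl | hi
  · simp [TimePartition.concat, p.pt_last, h0]
  · have : ¬ p.n + i ≤ p.n := by omega
    simp [TimePartition.concat, this]

lemma concat_mesh_lt {δ : ℝ≥0} (hp : p.mesh < δ)
    (hrm : ∀ k < m, nndist (r k) (r (k + 1)) < δ) : (p.concat r m hr h0 hm).mesh < δ := by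
  have hδ : 0 < δ := (zero_le).trans_lt hp
  rw [mesh_lt_iff _ hδ] at hp ⊢
  intro k hk
  by_cases h : k < p.n
  · rw [concat_pt_of_le p hr h0 hm h.le, concat_pt_of_le p hr h0 hm h]
    exact hp k h
  · obtain ⟨i, rfl⟩ := Nat.exists_eq_add_of_le (not_lt.1 h)
    rw [add_assoc, concat_pt_add, concat_pt_add]
    refine hrm i ?_
    change p.n + i < p.n + m at hk
    omega

lemma sum_concat (f : I → I → ℝ) :
    ∑ k ∈ Finset.range (p.concat r m hr h0 hm).n,
      f ((p.concat r m hr h0 hm).pt k) ((p.concat r m hr h0 hm).pt (k + 1))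
      = ∑ k ∈ Finset.range p.n, f (p.pt k) (p.pt (k + 1))
        + ∑ k ∈ Finset.range m, f (r k) (r (k + 1)) := by
  change ∑ k ∈ Finset.range (p.n + m), _ = _
  rw [Finset.sum_range_add]
  congr 1
  · refine Finset.sum_congr rfl fun k hk => ?_
    have hk' := Finset.mem_range.1 hk
    rw [concat_pt_of_le p hr h0 hm hk'.le, concat_pt_of_le p hr h0 hm hk']
  · refine Finset.sum_congr rfl fun k _ => ?_
    rw [add_assoc, concat_pt_add, concat_pt_add]

end Concat

/-- The uniform partition of `[0, t]` into `n + 1` intervals. -/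
noncomputable def uniformPartition (t : I) (n : ℕ) : TimePartition t where
  n := n + 1
  pt := uniformPoint 0 t (n + 1)
  mono := monotone_uniformPoint t.2.1 _
  pt_zero := uniformPoint_zero _ _ _
  pt_last := uniformPoint_self _ _ (by omega)

lemma tendsto_uniformPartition (t : I) : Tendsto (uniformPartition t) atTop (meshToZero t) := by
  intro S hS
  obtain ⟨δ, hδ, h⟩ := eventually_meshToZero_iff.1 hS
  obtain ⟨N, hN⟩ := exists_nat_gt (1 / δ)
  refine mem_map.2 ?_
  filter_upwards [eventually_ge_atTop N] with n hn
  refine h _ ((mesh_lt_iff _ hδ).2 fun k hk => nndist_uniformPoint_lt t.2.1 hδ ?_ hk)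
  exact hN.trans_le (by exact_mod_cast hn.trans (Nat.le_succ n))

instance (t : I) : (meshToZero t).NeBot := (tendsto_uniformPartition t).neBot

section ConvergenceInMeasure

variable {Ω : Type*} {mΩ : MeasurableSpace Ω} {P : Measure Ω}

/-- Convergence in probability along partitions, with one parameter `ε` for both the distance and
the probability. -/
lemma tendstoInMeasure_meshToZero_iff {t : I} {F : TimePartition t → Ω → ℝ} {Z : Ω → ℝ} :
    TendstoInMeasure P F (meshToZero t) Z ↔ ∀ ε : ℝ, 0 < ε → ∃ δ : ℝ≥0, 0 < δ ∧
      ∀ p : TimePartition t, p.mesh < δ →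
        P {ω | ε ≤ |F p ω - Z ω|} ≤ ENNReal.ofReal ε := by
  rw [tendstoInMeasure_iff_norm]
  simp only [Real.norm_eq_abs]
  constructor
  · intro h ε hε
    have := (h ε hε).eventually (ENNReal.tendsto_nhds_zero.1 tendsto_id _
      (ENNReal.ofReal_pos.2 hε))
    exact eventually_meshToZero_iff.1 this
  · intro h ε hε
    rw [ENNReal.tendsto_nhds_zero]
    intro η hη
    obtain ⟨c, hc, hcη⟩ : ∃ c : ℝ, 0 < c ∧ ENNReal.ofReal c ≤ η := by
      rcases eq_or_ne η ⊤ with rfl | hη'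
      · exact ⟨1, one_pos, le_top⟩
      · exact ⟨η.toReal, ENNReal.toReal_pos hη.ne' hη', ENNReal.ofReal_toReal_le⟩
    obtain ⟨δ, hδ, hp⟩ := h (min ε c) (lt_min hε hc)
    refine eventually_meshToZero_iff.2 ⟨δ, hδ, fun p hpδ => ?_⟩
    calc P {ω | ε ≤ |F p ω - Z ω|} ≤ P {ω | min ε c ≤ |F p ω - Z ω|} :=
          measure_mono fun ω hω => by
            simp only [Set.mem_ofPred_eq] at hω ⊢
            exact (min_le_left _ _).trans hω
      _ ≤ ENNReal.ofReal (min ε c) := hp p hpδ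
      _ ≤ ENNReal.ofReal c := ENNReal.ofReal_le_ofReal (min_le_right _ _)
      _ ≤ η := hcη

/-- If the Itô sums over the partitions of `[0, s]` converge in probability for each `s ≤ t`, then
they converge uniformly in `s`: the limit over `[0, t]` controls the limits over all the `[0, s]`,
since a partition of `[0, s]` can be continued by a very fine subdivision of `[s, t]`. -/
lemma exists_mesh_forall_le_measure_le {f : I → I → Ω → ℝ} {Z : I → Ω → ℝ} {t : I}
    (h : ∀ s ≤ t, TendstoInMeasure P
      (fun (p : TimePartition s) ω => ∑ k ∈ Finset.range p.n, f (p.pt k) (p.pt (k + 1)) ω)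
      (meshToZero s) (Z s)) {ε : ℝ} (hε : 0 < ε) :
    ∃ δ : ℝ≥0, 0 < δ ∧ ∀ s ≤ t, ∀ p : TimePartition s, p.mesh < δ →
      P {ω | ε ≤ |∑ k ∈ Finset.range p.n, f (p.pt k) (p.pt (k + 1)) ω - Z s ω|}
        ≤ ENNReal.ofReal ε := by
  obtain ⟨δ, hδ, hδt⟩ := tendstoInMeasure_meshToZero_iff.1 (h t le_rfl) (ε / 2) (by positivity)
  refine ⟨δ, hδ, fun s hs p hp => ?_⟩
  obtain ⟨δ₁, hδ₁, h₁⟩ := tendstoInMeasure_meshToZero_iff.1 (h s hs) (ε / 4) (by positivity)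
  obtain ⟨δ₂, hδ₂, h₂⟩ := tendstoInMeasure_meshToZero_iff.1 (h t le_rfl) (ε / 4) (by positivity)
  set δ' := min δ (min δ₁ δ₂) with hδ'
  have hδ'0 : 0 < δ' := lt_min hδ (lt_min hδ₁ hδ₂)
  obtain ⟨N, hN⟩ := exists_nat_gt (1 / δ')
  have hN1 : 1 / δ' < ((N + 1 : ℕ) : ℝ≥0) := hN.trans_le (by exact_mod_cast Nat.le_succ N)
  have hr := monotone_uniformPoint hs (N + 1)
  have hr0 := uniformPoint_zero s t (N + 1)
  have hrm := uniformPoint_self s t (n := N + 1) (by omega)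
  have hrd : ∀ k < N + 1,
      nndist (uniformPoint s t (N + 1) k) (uniformPoint s t (N + 1) (k + 1)) < δ' :=
    fun k hk => nndist_uniformPoint_lt hs hδ'0 hN1 hk
  have hu : (uniformPartition s N).mesh < δ' :=
    (mesh_lt_iff _ hδ'0).2 fun k hk => nndist_uniformPoint_lt s.2.1 hδ'0 hN1 hk
  -- `p` and a uniform partition of `[0, s]`, continued by the same fine subdivision of `[s, t]`: the
  -- two sums over `[0, t]` are close to `Z t`, and the sum over the uniform partition to `Z s`
  have hA := hδt (p.concat _ _ hr hr0 hrm) (concat_mesh_lt p hr hr0 hrm hp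
    fun k hk => (hrd k hk).trans_le (min_le_left _ _))
  have hB := h₁ (uniformPartition s N)
    (hu.trans_le ((min_le_right _ _).trans (min_le_left _ _)))
  have hC := h₂ ((uniformPartition s N).concat _ _ hr hr0 hrm) ((concat_mesh_lt _ hr hr0 hrm hu
    hrd).trans_le ((min_le_right _ _).trans (min_le_right _ _)))
  have eA : ∀ ω, _ := fun ω => sum_concat p hr hr0 hrm (fun x y => f x y ω)
  have eC : ∀ ω, _ := fun ω => sum_concat (uniformPartition s N) hr hr0 hrm (fun x y => f x y ω)
  simp only [eA] at hA
  simp only [eC] at hC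
  have hsplit : ENNReal.ofReal ε
      = ENNReal.ofReal (ε / 2) + (ENNReal.ofReal (ε / 4) + ENNReal.ofReal (ε / 4)) := by
    rw [← ENNReal.ofReal_add (by positivity) (by positivity),
      ← ENNReal.ofReal_add (by positivity) (by positivity)]
    congr 1; ring
  rw [hsplit]
  refine le_trans (measure_mono ?_) ((measure_union_le _ _).trans (add_le_add hA
    ((measure_union_le _ _).trans (add_le_add hB hC))))
  intro ω hω
  by_contra hcon
  simp only [Set.mem_union, Set.mem_ofPred_eq, not_or, not_le] at hcon hω
  obtain ⟨c1, c2, c3⟩ := hcon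
  rw [abs_lt] at c1 c2 c3
  have : |∑ k ∈ Finset.range p.n, f (p.pt k) (p.pt (k + 1)) ω - Z s ω| < ε := by
    rw [abs_lt]
    constructor <;> linarith [c1.1, c1.2, c2.1, c2.2, c3.1, c3.2]
  linarith

lemma MeasureTheory.TendstoInMeasure.add_real {ι : Type*} {u : Filter ι} {f g : ι → Ω → ℝ}
    {F G : Ω → ℝ}
    (hf : TendstoInMeasure P f u F) (hg : TendstoInMeasure P g u G) :
    TendstoInMeasure P (fun i ω => f i ω + g i ω) u (fun ω => F ω + G ω) := by
  rw [tendstoInMeasure_iff_norm] at *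
  intro ε hε
  have h := (hf (ε / 2) (by positivity)).add (hg (ε / 2) (by positivity))
  rw [add_zero] at h
  refine tendsto_of_tendsto_of_tendsto_of_le_of_le tendsto_const_nhds h (fun _ => zero_le)
    fun i => ?_
  refine le_trans (measure_mono ?_) (measure_union_le _ _)
  intro ω hω
  by_contra hcon
  simp only [Set.mem_union, Set.mem_ofPred_eq, not_or, not_le, Real.norm_eq_abs] at hcon hω
  obtain ⟨c1, c2⟩ := hcon
  rw [abs_lt] at c1 c2
  have : |f i ω + g i ω - (F ω + G ω)| < ε := by
    rw [abs_lt]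
    constructor <;> linarith [c1.1, c1.2, c2.1, c2.2]
  linarith

lemma MeasureTheory.TendstoInMeasure.sum_real {ι κ : Type*} {u : Filter ι} (s : Finset κ)
    {f : κ → ι → Ω → ℝ} {F : κ → Ω → ℝ} (hf : ∀ k ∈ s, TendstoInMeasure P (f k) u (F k)) :
    TendstoInMeasure P (fun i ω => ∑ k ∈ s, f k i ω) u (fun ω => ∑ k ∈ s, F k ω) := by
  classical
  induction s using Finset.induction_on with
  | empty =>
    rw [tendstoInMeasure_iff_norm]
    intro ε hε
    simp [hε.not_ge, tendsto_const_nhds]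
  | insert a s ha ih =>
    simp only [Finset.sum_insert ha]
    exact (hf a (by simp)).add_real (ih fun k hk => hf k (by simp [hk]))

end ConvergenceInMeasure

/-! ### A localised discrete stability estimate -/

section Stability

variable {Ω : Type*} {mΩ : MeasurableSpace Ω}

/-- The event that `M` and `E` are bounded by `R`, and `D` by `1`, up to the index `j`. -/
def localizingSet (M E D : ℕ → Ω → ℝ) (R : ℝ) (j : ℕ) : Set Ω :=
  {ω | ∀ i ≤ j, |M i ω| ≤ R ∧ |E i ω| ≤ R ∧ |D i ω| ≤ 1}

variable {M E D : ℕ → Ω → ℝ} {R : ℝ}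

lemma measurableSet_localizingSet {𝓕 : Filtration I mΩ} {s : ℕ → I} (hs : Monotone s)
    (hM : ∀ j, Measurable[𝓕 (s j)] (M j)) (hE : ∀ j, Measurable[𝓕 (s j)] (E j))
    (hD : ∀ j, Measurable[𝓕 (s j)] (D j)) (j : ℕ) :
    MeasurableSet[𝓕 (s j)] (localizingSet M E D R j) := by
  have h : localizingSet M E D R j = ⋂ i ∈ Set.Iic j,
      ({ω | |M i ω| ≤ R} ∩ ({ω | |E i ω| ≤ R} ∩ {ω | |D i ω| ≤ 1})) := by
    ext ω; simp [localizingSet]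
  rw [h]
  refine MeasurableSet.biInter (Set.to_countable _) fun i hi => ?_
  have hle := 𝓕.mono (hs (Set.mem_Iic.1 hi))
  have aux : ∀ {f : Ω → ℝ} (_ : Measurable[𝓕 (s i)] f) (c : ℝ),
      MeasurableSet[𝓕 (s j)] {ω | |f ω| ≤ c} := fun hf c =>
    hle _ (hf (measurableSet_le (by fun_prop) measurable_const : MeasurableSet {y : ℝ | |y| ≤ c}))
  exact (aux (hM i) R).inter ((aux (hE i) R).inter (aux (hD i) 1))

/-- The process started at `0` with increments `(M - E) x + E z`, frozen at the first time when `M`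
or `E` exceeds `R`, or `D` exceeds `1`. It is meant for a process `D` with these increments. -/
noncomputable def frozen (M E D x z : ℕ → Ω → ℝ) (R : ℝ) (j : ℕ) (ω : Ω) : ℝ :=
  ∑ i ∈ Finset.range j, (localizingSet M E D R i).indicator (fun ω => M i ω - E i ω) ω * x i ω
    + ∑ i ∈ Finset.range j, (localizingSet M E D R i).indicator (E i) ω * z i ω

variable {x z : ℕ → Ω → ℝ}

lemma frozen_succ (j : ℕ) (ω : Ω) :
    frozen M E D x z R (j + 1) ω = frozen M E D x z R j ω
      + (localizingSet M E D R j).indicator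
        (fun ω => (M j ω - E j ω) * x j ω + E j ω * z j ω) ω := by
  simp only [frozen, Finset.sum_range_succ]
  by_cases h : ω ∈ localizingSet M E D R j
  · simp only [Set.indicator_of_mem h]; ring
  · simp only [Set.indicator_of_notMem h]; ring

lemma frozen_eq_of_forall_lt (h0 : ∀ ω, D 0 ω = 0)
    (hstep : ∀ j ω, D (j + 1) ω = D j ω + ((M j ω - E j ω) * x j ω + E j ω * z j ω)) {j : ℕ}
    {ω : Ω} (h : ∀ i < j, ω ∈ localizingSet M E D R i) : frozen M E D x z R j ω = D j ω := by
  induction j with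
  | zero => simp [frozen, h0]
  | succ j ih =>
    rw [frozen_succ, ih fun i hi => h i (by omega), Set.indicator_of_mem (h j (by omega)), hstep]

lemma localizingSet_anti : Antitone (localizingSet M E D R) := fun _ _ hij _ hω k hk =>
  hω k (hk.trans hij)

lemma frozen_eq_of_notMem {j k : ℕ} (hjk : j ≤ k) {ω : Ω} (h : ω ∉ localizingSet M E D R j) :
    frozen M E D x z R k ω = frozen M E D x z R j ω := by
  induction k, hjk using Nat.le_induction with
  | base => rfl
  | succ k hk ih =>
    rw [frozen_succ, Set.indicator_of_notMem (fun hω => h (localizingSet_anti hk hω)), ih, add_zero]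

/-- As long as `M` and `E` are bounded by `R`, the frozen process dominates `min |D| 1`: either it
was never frozen, or it was frozen at a value of modulus more than `1`. -/
lemma min_abs_le_abs_frozen (h0 : ∀ ω, D 0 ω = 0)
    (hstep : ∀ j ω, D (j + 1) ω = D j ω + ((M j ω - E j ω) * x j ω + E j ω * z j ω)) {n : ℕ}
    {ω : Ω} (hR : ∀ j ≤ n, |M j ω| ≤ R ∧ |E j ω| ≤ R) :
    min |D n ω| 1 ≤ |frozen M E D x z R n ω| := by
  by_cases h : ∀ i < n, ω ∈ localizingSet M E D R i
  · rw [frozen_eq_of_forall_lt h0 hstep h]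
    exact min_le_left _ _
  · push Not at h
    classical
    set j := Nat.find h with hj
    obtain ⟨hjn, hjA⟩ := Nat.find_spec h
    have hlt : ∀ i < j, ω ∈ localizingSet M E D R i := by
      intro i hi
      by_contra hcon
      exact Nat.find_min h hi ⟨by omega, hcon⟩
    rw [frozen_eq_of_notMem hjn.le hjA, frozen_eq_of_forall_lt h0 hstep hlt]
    refine (min_le_right _ _).trans (le_of_lt ?_)
    by_contra hcon
    refine hjA fun i hi => ?_
    rcases hi.lt_or_eq with hi' | rfl
    · exact hlt i hi' i le_rfl
    · exact ⟨(hR _ hjn.le).1, (hR _ hjn.le).2, not_lt.1 hcon⟩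

variable {P : Measure Ω} [IsProbabilityMeasure P] {𝓕 : Filtration I mΩ} {s : ℕ → I}

/-- If `D` has increments `(M - E) x + E z`, and `D` is close to `M - E` in probability, then the
frozen process is small in `L²`, as soon as the noise `z` is of smaller order than `x`: `w` is the
variance of the terms `x j`, and `w'` that of the terms `z j`. By the discrete Itô isometry, its
second moment satisfies a Grönwall recursion. -/
lemma integral_frozen_sq_le (hs : Monotone s)
    (hM : ∀ j, Measurable[𝓕 (s j)] (M j)) (hE : ∀ j, Measurable[𝓕 (s j)] (E j))
    (hD : ∀ j, Measurable[𝓕 (s j)] (D j))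
    (hx : ∀ j, IsCentredNoise 𝓕 P (s j) (s (j + 1)) (x j))
    (hz : ∀ j, IsCentredNoise 𝓕 P (s j) (s (j + 1)) (z j))
    (h0 : ∀ ω, D 0 ω = 0)
    (hstep : ∀ j ω, D (j + 1) ω = D j ω + ((M j ω - E j ω) * x j ω + E j ω * z j ω))
    (hR : 0 ≤ R) {w w' ε : ℝ} (hw : 0 ≤ w) (hw' : 0 ≤ w') {n : ℕ}
    (hxw : ∀ j, ∫ ω, x j ω ^ 2 ∂P ≤ w) (hzw : ∀ j, ∫ ω, z j ω ^ 2 ∂P ≤ w') (hε : 0 ≤ ε)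
    (hg : ∀ j ≤ n, P {ω | ε ≤ |D j ω + E j ω - M j ω|} ≤ ENNReal.ofReal ε) :
    Integrable (fun ω => frozen M E D x z R n ω ^ 2) P ∧
    ∫ ω, frozen M E D x z R n ω ^ 2 ∂P
      ≤ n * (4 * w * (ε ^ 2 + (1 + 2 * R) ^ 2 * ε) + 2 * w' * R ^ 2) * Real.exp (n * (4 * w)) := by
  set A := localizingSet M E D R with hA
  have hAm : ∀ j, MeasurableSet[𝓕 (s j)] (A j) := measurableSet_localizingSet hs hM hE hD
  set a : ℕ → Ω → ℝ := fun j => (A j).indicator (fun ω => M j ω - E j ω) with ha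
  set b : ℕ → Ω → ℝ := fun j => (A j).indicator (E j) with hb
  have ham : ∀ j, Measurable[𝓕 (s j)] (a j) := fun j => ((hM j).sub (hE j)).indicator (hAm j)
  have hbm : ∀ j, Measurable[𝓕 (s j)] (b j) := fun j => (hE j).indicator (hAm j)
  have habd : ∀ j ω, |a j ω| ≤ 2 * R := by
    intro j ω
    by_cases h : ω ∈ A j
    · simp only [ha, Set.indicator_of_mem h]
      have := h j le_rfl
      calc |M j ω - E j ω| ≤ |M j ω| + |E j ω| := abs_sub _ _
        _ ≤ 2 * R := by linarith [this.1, this.2.1]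
    · simp only [ha, Set.indicator_of_notMem h, abs_zero]; positivity
  have hbbd : ∀ j ω, |b j ω| ≤ R := by
    intro j ω
    by_cases h : ω ∈ A j
    · simp only [hb, Set.indicator_of_mem h]
      exact (h j le_rfl).2.1
    · simpa only [hb, Set.indicator_of_notMem h, abs_zero]
  have ha2 : ∀ j, MemLp (a j) 2 P := fun j =>
    MemLp.of_bound ((ham j).mono (𝓕.le _) le_rfl).aestronglyMeasurable (2 * R)
      (ae_of_all _ fun ω => habd j ω)
  have hb2 : ∀ j, MemLp (b j) 2 P := fun j =>
    MemLp.of_bound ((hbm j).mono (𝓕.le _) le_rfl).aestronglyMeasurable R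
      (ae_of_all _ fun ω => hbbd j ω)
  have hb2' : ∀ j, ∫ ω, b j ω ^ 2 ∂P ≤ R ^ 2 := by
    intro j
    calc ∫ ω, b j ω ^ 2 ∂P ≤ ∫ _, R ^ 2 ∂P :=
          integral_mono (hb2 j).integrable_sq (integrable_const _) fun ω =>
            sq_le_sq' (by linarith [abs_le.1 (hbbd j ω)]) (abs_le.1 (hbbd j ω)).2
      _ = R ^ 2 := by simp
  set S : ℕ → Ω → ℝ := fun j ω => ∑ i ∈ Finset.range j, a i ω * x i ω with hS
  set T : ℕ → Ω → ℝ := fun j ω => ∑ i ∈ Finset.range j, b i ω * z i ω with hT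
  have hS2 : ∀ j, MemLp (S j) 2 P := memLp_sum_mul_noise hx ham ha2
  have hT2 : ∀ j, MemLp (T j) 2 P := memLp_sum_mul_noise hz hbm hb2
  have hfr : ∀ j, frozen M E D x z R j = fun ω => S j ω + T j ω := fun j => rfl
  have hF2 : ∀ j, MemLp (frozen M E D x z R j) 2 P := fun j => by
    rw [hfr]; exact (hS2 j).add (hT2 j)
  set u : ℕ → ℝ := fun j => ∑ i ∈ Finset.range j,
    2 * (w * ∫ ω, a i ω ^ 2 ∂P + w' * ∫ ω, b i ω ^ 2 ∂P) with hu
  have hFu : ∀ j, ∫ ω, frozen M E D x z R j ω ^ 2 ∂P ≤ u j := by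
    intro j
    have h1 : ∫ ω, S j ω ^ 2 ∂P ≤ ∑ i ∈ Finset.range j, w * ∫ ω, a i ω ^ 2 ∂P := by
      rw [integral_sum_mul_noise_sq hs hx ham ha2]
      refine Finset.sum_le_sum fun i _ => ?_
      rw [mul_comm]
      exact mul_le_mul_of_nonneg_right (hxw i) (integral_nonneg fun ω => sq_nonneg _)
    have h2 : ∫ ω, T j ω ^ 2 ∂P ≤ ∑ i ∈ Finset.range j, w' * ∫ ω, b i ω ^ 2 ∂P := by
      rw [integral_sum_mul_noise_sq hs hz hbm hb2]
      refine Finset.sum_le_sum fun i _ => ?_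
      rw [mul_comm]
      exact mul_le_mul_of_nonneg_right (hzw i) (integral_nonneg fun ω => sq_nonneg _)
    calc ∫ ω, frozen M E D x z R j ω ^ 2 ∂P
        ≤ ∫ ω, (2 * S j ω ^ 2 + 2 * T j ω ^ 2) ∂P := by
          refine integral_mono (hF2 j).integrable_sq
            (((hS2 j).integrable_sq.const_mul 2).add ((hT2 j).integrable_sq.const_mul 2))
            fun ω => ?_
          simp only [hfr]
          nlinarith [sq_nonneg (S j ω - T j ω)]
      _ = 2 * ∫ ω, S j ω ^ 2 ∂P + 2 * ∫ ω, T j ω ^ 2 ∂P := by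
          rw [integral_add ((hS2 j).integrable_sq.const_mul 2)
            ((hT2 j).integrable_sq.const_mul 2), integral_const_mul, integral_const_mul]
      _ ≤ u j := by
          simp only [hu, mul_add, Finset.sum_add_distrib, ← Finset.mul_sum]
          simp only [← Finset.mul_sum] at h1 h2
          linarith
  refine ⟨(hF2 n).integrable_sq, ?_⟩
  set K := (1 + 2 * R) with hK
  -- before freezing, `M - E` is `D` up to the error `ε`, except on an event of probability `ε` where
  -- it is bounded by `K`
  have ha_le : ∀ j ≤ n, ∫ ω, a j ω ^ 2 ∂P
      ≤ 2 * ∫ ω, frozen M E D x z R j ω ^ 2 ∂P + 2 * (ε ^ 2 + K ^ 2 * ε) := by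
    intro j hj
    set Bd : Set Ω := {ω | ε ≤ |D j ω + E j ω - M j ω|} with hBd
    have hm : ∀ {f : Ω → ℝ}, Measurable[𝓕 (s j)] f → Measurable f :=
      fun hf => hf.mono (𝓕.le _) le_rfl
    have hBm : MeasurableSet Bd := by
      have h1 := hm (hM j); have h2 := hm (hE j); have h3 := hm (hD j)
      exact measurableSet_le measurable_const (by fun_prop)
    have hind : Integrable (Bd.indicator fun _ : Ω => K ^ 2) P :=
      (integrable_const _).indicator hBm
    have hind' : Integrable (fun ω => 2 * (ε ^ 2 + Bd.indicator (fun _ => K ^ 2) ω)) P :=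
      ((integrable_const _).add hind).const_mul 2
    calc ∫ ω, a j ω ^ 2 ∂P
        ≤ ∫ ω, (2 * frozen M E D x z R j ω ^ 2
            + 2 * (ε ^ 2 + Bd.indicator (fun _ => K ^ 2) ω)) ∂P := by
          refine integral_mono (ha2 j).integrable_sq
            (((hF2 j).integrable_sq.const_mul 2).add hind') fun ω => ?_
          simp only
          have hind0 : 0 ≤ Bd.indicator (fun _ => K ^ 2) ω :=
            Set.indicator_nonneg (fun _ _ => sq_nonneg _) _
          by_cases h : ω ∈ A j
          · have hfD : frozen M E D x z R j ω = D j ω :=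
              frozen_eq_of_forall_lt h0 hstep fun i hi => localizingSet_anti hi.le h
            obtain ⟨b1, b2, b3⟩ := h j le_rfl
            rw [abs_le] at b1 b2 b3
            have haD : a j ω = D j ω - (D j ω + E j ω - M j ω) := by
              simp only [ha, Set.indicator_of_mem h]; ring
            have hgle : (D j ω + E j ω - M j ω) ^ 2
                ≤ ε ^ 2 + Bd.indicator (fun _ => K ^ 2) ω := by
              by_cases hB : ω ∈ Bd
              · rw [Set.indicator_of_mem hB]
                have : (D j ω + E j ω - M j ω) ^ 2 ≤ K ^ 2 :=
                  sq_le_sq' (by simp only [hK]; linarith) (by simp only [hK]; linarith)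
                nlinarith [sq_nonneg ε]
              · have hB' : |D j ω + E j ω - M j ω| < ε := not_le.1 hB
                rw [abs_lt] at hB'
                have := sq_le_sq' hB'.1.le hB'.2.le
                linarith
            rw [haD, hfD]
            nlinarith [sq_nonneg (D j ω + (D j ω + E j ω - M j ω))]
          · simp only [ha, Set.indicator_of_notMem h]
            nlinarith [sq_nonneg (frozen M E D x z R j ω), sq_nonneg ε]
      _ = 2 * ∫ ω, frozen M E D x z R j ω ^ 2 ∂P + 2 * (ε ^ 2 + K ^ 2 * P.real Bd) := by
          rw [integral_add ((hF2 j).integrable_sq.const_mul 2) hind', integral_const_mul,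
            integral_const_mul, integral_add (integrable_const _) hind,
            integral_indicator_const _ hBm]
          simp [mul_comm]
      _ ≤ _ := by
          have : P.real Bd ≤ ε := ENNReal.toReal_le_of_le_ofReal hε (hg j hj)
          gcongr
  -- `u` satisfies a Grönwall recursion up to the index `n`; it is truncated beyond `n`
  set β := 4 * w * (ε ^ 2 + K ^ 2 * ε) + 2 * w' * R ^ 2 with hβ
  have hβ0 : 0 ≤ β := by positivity
  have hgr := discrete_gronwall (u := fun j => u (min j n)) (c := fun _ => 4 * w)
    (b := fun _ => β) (n₀ := 0) (by simp [hu]) (fun j _ => ?_) (fun _ _ => by positivity)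
    (fun _ _ => hβ0) (Nat.zero_le n)
  · refine (hFu n).trans ?_
    simpa [hu] using hgr
  · have hun : 0 ≤ u (min j n) := (integral_nonneg fun ω => sq_nonneg _).trans (hFu _)
    rcases lt_or_ge j n with hjn | hjn
    · have e1 : min (j + 1) n = j + 1 := by omega
      have e2 : min j n = j := by omega
      simp only [e1, e2]
      have hstep' : u (j + 1) = u j + 2 * (w * ∫ ω, a j ω ^ 2 ∂P + w' * ∫ ω, b j ω ^ 2 ∂P) := by
        simp only [hu, Finset.sum_range_succ]
      rw [hstep']
      have q1 := mul_le_mul_of_nonneg_left ((ha_le j hjn.le).trans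
        (add_le_add_left (mul_le_mul_of_nonneg_left (hFu j) (by norm_num : (0:ℝ) ≤ 2)) _)) hw
      have q2 := mul_le_mul_of_nonneg_left (hb2' j) hw'
      simp only [hβ]
      nlinarith
    · have e1 : min (j + 1) n = n := by omega
      have e2 : min j n = n := by omega
      simp only [e1, e2] at hun ⊢
      nlinarith [mul_nonneg hw hun]

end Stability

/-! ### The stochastic exponential and uniqueness for the linear Itô equation -/

/-- The stochastic exponential `exp (⟨γ, B_t - B_0⟩ - |γ|² t / 2)`. -/
noncomputable def stochExp {Ω : Type*} {l : ℕ} (B : Ω → PathSpace l) (γ : Fin l → ℝ) (t : I)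
    (ω : Ω) : ℝ :=
  Real.exp (linIncrement B γ 0 t ω - (∑ k, γ k ^ 2) * t / 2)

section StochExp

variable {Ω : Type*} {mΩ : MeasurableSpace Ω} {l : ℕ} {𝓕 : Filtration I mΩ} {P : Measure Ω}
  {x : Fin l → ℝ} {B : Ω → PathSpace l}

lemma stochExp_pos (γ : Fin l → ℝ) (t : I) (ω : Ω) : 0 < stochExp B γ t ω := Real.exp_pos _

lemma linIncrement_add (γ : Fin l → ℝ) (r s t : I) (ω : Ω) :
    linIncrement B γ r s ω + linIncrement B γ s t ω = linIncrement B γ r t ω := by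
  simp only [linIncrement, ← Finset.sum_add_distrib, ← mul_add]
  exact Finset.sum_congr rfl fun k _ => by ring

lemma stochExp_zero (γ : Fin l → ℝ) (ω : Ω) : stochExp B γ 0 ω = 1 := by
  simp [stochExp, linIncrement]

lemma stochExp_eq_mul (γ : Fin l → ℝ) (s t : I) (ω : Ω) :
    stochExp B γ t ω = stochExp B γ s ω
      * Real.exp (linIncrement B γ s t ω - (∑ k, γ k ^ 2) * ((t : ℝ) - s) / 2) := by
  rw [stochExp, stochExp, ← Real.exp_add, ← linIncrement_add γ 0 s t]
  congr 1; ring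

lemma continuous_linIncrement (γ : Fin l → ℝ) (s : I) (ω : Ω) :
    Continuous fun t => linIncrement B γ s t ω := by
  unfold linIncrement; fun_prop

lemma continuous_stochExp (γ : Fin l → ℝ) (ω : Ω) : Continuous fun t => stochExp B γ t ω := by
  have := continuous_linIncrement (B := B) γ 0 ω
  unfold stochExp; fun_prop

lemma IsStandardBM.measurable_stochExp (hB : IsStandardBM 𝓕 P x B) (γ : Fin l → ℝ) (t : I) :
    Measurable[𝓕 t] (stochExp B γ t) :=
  Real.measurable_exp.comp ((hB.measurable_linIncrement γ t.2.1).sub_const _)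

lemma coe_toNNReal_variance (γ : Fin l → ℝ) {s t : I} (hst : s ≤ t) :
    ((Real.toNNReal ((∑ k, γ k ^ 2) * ((t : ℝ) - s)) : ℝ≥0) : ℝ)
      = (∑ k, γ k ^ 2) * ((t : ℝ) - s) :=
  Real.coe_toNNReal _ (mul_nonneg (Finset.sum_nonneg fun _ _ => sq_nonneg _)
    (sub_nonneg.2 hst))

lemma IsStandardBM.aemeasurable_linIncrement (hB : IsStandardBM 𝓕 P x B) (γ : Fin l → ℝ) {s t : I}
    (hst : s ≤ t) : AEMeasurable (linIncrement B γ s t) P :=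
  ((hB.measurable_linIncrement γ hst).mono (𝓕.le _) le_rfl).aemeasurable

lemma IsStandardBM.integral_exp_linIncrement (hB : IsStandardBM 𝓕 P x B) (γ : Fin l → ℝ)
    {s t : I} (hst : s ≤ t) :
    ∫ ω, Real.exp (linIncrement B γ s t ω) ∂P = Real.exp ((∑ k, γ k ^ 2) * ((t : ℝ) - s) / 2) := by
  have := integral_exp_mul_of_map_gaussianReal (hB.map_linIncrement γ hst) 1
  rw [coe_toNNReal_variance γ hst] at this
  simpa using this

lemma IsStandardBM.isCentredNoise_linIncrement (hB : IsStandardBM 𝓕 P x B) (γ : Fin l → ℝ)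
    {s t : I} (hst : s ≤ t) : IsCentredNoise 𝓕 P s t (linIncrement B γ s t) :=
  hB.isCentredNoise hst (measurable_linForm γ)
    (memLp_two_of_map_gaussianReal (hB.aemeasurable_linIncrement γ hst) (hB.map_linIncrement γ hst))
    (integral_of_map_gaussianReal (hB.aemeasurable_linIncrement γ hst) (hB.map_linIncrement γ hst))

lemma IsStandardBM.integral_linIncrement_sq (hB : IsStandardBM 𝓕 P x B) (γ : Fin l → ℝ)
    {s t : I} (hst : s ≤ t) :
    ∫ ω, linIncrement B γ s t ω ^ 2 ∂P = (∑ k, γ k ^ 2) * ((t : ℝ) - s) := by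
  rw [integral_sq_of_map_gaussianReal (hB.aemeasurable_linIncrement γ hst)
    (hB.map_linIncrement γ hst), coe_toNNReal_variance γ hst]

lemma IsStandardBM.memLp_exp_linIncrement (hB : IsStandardBM 𝓕 P x B) (γ : Fin l → ℝ)
    {s t : I} (hst : s ≤ t) :
    MemLp (fun ω => Real.exp (linIncrement B γ s t ω)) 2 P := by
  simpa using memLp_two_exp_mul_of_map_gaussianReal (hB.aemeasurable_linIncrement γ hst)
    (hB.map_linIncrement γ hst) 1

variable [IsProbabilityMeasure P]

/-- The difference between the Brownian increment and the relative increment of the stochastic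
exponential is a centred noise; by `integral_sub_exp_sq` its variance is of second order in
`t - s`. -/
lemma IsStandardBM.isCentredNoise_sub_exp (hB : IsStandardBM 𝓕 P x B) (γ : Fin l → ℝ)
    {s t : I} (hst : s ≤ t) :
    IsCentredNoise 𝓕 P s t (fun ω => linIncrement B γ s t ω
      - (Real.exp (linIncrement B γ s t ω - (∑ k, γ k ^ 2) * ((t : ℝ) - s) / 2) - 1)) := by
  set c := (∑ k, γ k ^ 2) * ((t : ℝ) - s) / 2 with hc
  have hlin := hB.isCentredNoise_linIncrement γ hst
  have hexp : MemLp (fun ω => Real.exp (linIncrement B γ s t ω - c)) 2 P := by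
    have h := (hB.memLp_exp_linIncrement γ hst).mul_const (Real.exp (-c))
    refine h.ae_eq (ae_of_all _ fun ω => ?_)
    simp only [← Real.exp_add, sub_eq_add_neg]
  have hint : ∫ ω, Real.exp (linIncrement B γ s t ω - c) ∂P = 1 := by
    simp_rw [sub_eq_add_neg, Real.exp_add]
    rw [integral_mul_const, hB.integral_exp_linIncrement γ hst, ← Real.exp_add]
    simp [hc]
  refine hB.isCentredNoise hst (f := fun y => (∑ k, γ k * y k)
    - (Real.exp ((∑ k, γ k * y k) - c) - 1)) (by fun_prop) ?_ ?_
  · exact hlin.memLp.sub (hexp.sub (memLp_const 1))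
  · have e1 : Integrable (fun ω => linIncrement B γ s t ω) P := hlin.memLp.integrable (by norm_num)
    have e2 := hexp.integrable (by norm_num)
    calc _ = ∫ ω, (linIncrement B γ s t ω
            - (Real.exp (linIncrement B γ s t ω - c) - 1)) ∂P := rfl
      _ = _ := by
        have e3 : Integrable (fun ω => Real.exp (linIncrement B γ s t ω - c) - 1) P :=
          e2.sub (integrable_const _)
        rw [integral_sub e1 e3, integral_sub e2 (integrable_const _),
          hint, hlin.integral_eq_zero]
        simp

lemma IsStandardBM.integral_sub_exp_sq (hB : IsStandardBM 𝓕 P x B) (γ : Fin l → ℝ)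
    {s t : I} (hst : s ≤ t) :
    ∫ ω, (linIncrement B γ s t ω
      - (Real.exp (linIncrement B γ s t ω - (∑ k, γ k ^ 2) * ((t : ℝ) - s) / 2) - 1)) ^ 2 ∂P
      = Real.exp ((∑ k, γ k ^ 2) * ((t : ℝ) - s)) - 1 - (∑ k, γ k ^ 2) * ((t : ℝ) - s) := by
  have := integral_sq_sub_exp_of_map_gaussianReal (hB.aemeasurable_linIncrement γ hst)
    (hB.map_linIncrement γ hst)
  rwa [coe_toNNReal_variance γ hst] at this

variable {M : I → Ω → ℝ} {γ : Fin l → ℝ}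

/-- The part of a partition up to one of its points. -/
def partitionUpTo (s : ℕ → I) (hs : Monotone s) (h0 : s 0 = 0) (j : ℕ) : TimePartition (s j) where
  n := j
  pt i := s (min i j)
  mono := fun _ _ h => hs (by omega)
  pt_zero := by simp [h0]
  pt_last := by simp

/-- A solution `M` of `dM = M d⟨γ, B⟩`, `M_0 = 1`, almost surely does not differ by `2δ` or more from
the stochastic exponential `E` where both are bounded: the Itô sums for `M`, started at `1`, minus
`E` form a process `D` along a partition to which `integral_frozen_sq_le` applies. -/
lemma measure_bounded_inter_le (hB : IsStandardBM 𝓕 P x B)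
    (hMa : ∀ t, Measurable[𝓕 t] (M t))
    (hM : ∀ t, TendstoInMeasure P (fun (p : TimePartition t) ω =>
      ∑ k ∈ Finset.range p.n, M (p.pt k) ω * linIncrement B γ (p.pt k) (p.pt (k + 1)) ω)
      (meshToZero t) (fun ω => M t ω - 1)) (t : I) {R δ : ℝ} (hR : 0 ≤ R) (hδ : 0 < δ)
    (hδ1 : δ ≤ 1) :
    P {ω | (∀ s, |M s ω| ≤ R ∧ |stochExp B γ s ω| ≤ R) ∧ 2 * δ ≤ |M t ω - stochExp B γ t ω|}
      = 0 := by
  set v := ∑ k, γ k ^ 2 with hv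
  have hv0 : 0 ≤ v := Finset.sum_nonneg fun i _ => sq_nonneg _
  -- the bound of `integral_frozen_sq_le` on the second moment, by Markov's inequality, plus the
  -- probability that the Itô sum is not close to its limit
  set C : ℝ := (4 * v * (1 + (1 + 2 * R) ^ 2) + 2 * v ^ 2 * R ^ 2) * Real.exp (4 * v) / δ ^ 2 + 1
    with hC
  suffices hmain : ∀ ε : ℝ, 0 < ε → ε ≤ δ →
      P {ω | (∀ s, |M s ω| ≤ R ∧ |stochExp B γ s ω| ≤ R) ∧ 2 * δ ≤ |M t ω - stochExp B γ t ω|}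
        ≤ ENNReal.ofReal (C * ε) by
    have hlim : Tendsto (fun ε : ℝ => ENNReal.ofReal (C * ε)) (𝓝[>] 0) (𝓝 0) := by
      have : Tendsto (fun ε : ℝ => C * ε) (𝓝[>] 0) (𝓝 (C * 0)) :=
        ((continuous_const_mul C).tendsto 0).mono_left nhdsWithin_le_nhds
      simpa using ENNReal.tendsto_ofReal this
    refine le_antisymm (ge_of_tendsto hlim ?_) zero_le
    filter_upwards [Ioo_mem_nhdsGT hδ] with ε hε using hmain ε hε.1 hε.2.le
  intro ε hε hεδ
  obtain ⟨η, hη, hunif⟩ := exists_mesh_forall_le_measure_le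
    (f := fun r u ω => M r ω * linIncrement B γ r u ω) (Z := fun s ω => M s ω - 1) (t := t)
    (fun s _ => hM s) hε
  obtain ⟨n, hn⟩ : ∃ n : ℕ, (1 / η : ℝ≥0) < n ∧ 1 / ε ≤ n ∧ v ≤ n ∧ 0 < n := by
    obtain ⟨n₁, h₁⟩ := exists_nat_gt (1 / η)
    obtain ⟨n₂, h₂⟩ := exists_nat_ge (1 / ε)
    obtain ⟨n₃, h₃⟩ := exists_nat_ge v
    refine ⟨n₁ + n₂ + n₃ + 1, ?_, ?_, ?_, by omega⟩
    · refine h₁.trans_le ?_; push_cast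
      rw [add_assoc, add_assoc]; exact le_self_add
    · push_cast
      have : (0 : ℝ) ≤ n₁ := by positivity
      have : (0 : ℝ) ≤ n₃ := by positivity
      linarith
    · push_cast
      have : (0 : ℝ) ≤ n₁ := by positivity
      have : (0 : ℝ) ≤ n₂ := by positivity
      linarith
  obtain ⟨hnη, hnε, hnv, hn0⟩ := hn
  have hn0' : (0 : ℝ) < n := by exact_mod_cast hn0
  set s : ℕ → I := uniformPoint 0 t n with hs_def
  have hs : Monotone s := monotone_uniformPoint t.2.1 n
  have hs0 : s 0 = 0 := uniformPoint_zero _ _ _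
  have hsn : s n = t := uniformPoint_self _ _ hn0.ne'
  have hss : ∀ j, s j ≤ s (j + 1) := fun j => hs (Nat.le_succ j)
  have hΔ0 : ∀ j, 0 ≤ (s (j + 1) : ℝ) - s j := fun j => sub_nonneg.2 (hss j)
  have hΔ : ∀ j, (s (j + 1) : ℝ) - s j ≤ 1 / n := by
    intro j
    rcases lt_or_ge j n with h | h
    · rw [uniformPoint_succ_sub h]
      gcongr
      have := t.2.2
      simpa using this
    · have h1 : s j = t := le_antisymm (uniformPoint_le t.2.1 n j) (hsn ▸ hs h)
      have h2 : s (j + 1) = t :=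
        le_antisymm (uniformPoint_le t.2.1 n (j + 1)) (hsn ▸ hs (h.trans (Nat.le_succ j)))
      rw [h1, h2]; simp
  have hvar : ∀ j, 0 ≤ v * ((s (j + 1) : ℝ) - s j) ∧ v * ((s (j + 1) : ℝ) - s j) ≤ v / n := by
    intro j
    refine ⟨mul_nonneg hv0 (hΔ0 j), ?_⟩
    have := mul_le_mul_of_nonneg_left (hΔ j) hv0
    rwa [mul_one_div] at this
  have hvn1 : v / n ≤ 1 := (div_le_one hn0').2 hnv
  set Y : ℕ → Ω → ℝ := fun j ω =>
    1 + ∑ i ∈ Finset.range j, M (s i) ω * linIncrement B γ (s i) (s (i + 1)) ω with hY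
  set D : ℕ → Ω → ℝ := fun j ω => Y j ω - stochExp B γ (s j) ω with hD
  have hEm : ∀ j, Measurable[𝓕 (s j)] (stochExp B γ (s j)) := fun j => hB.measurable_stochExp γ _
  have hYm : ∀ j, Measurable[𝓕 (s j)] (Y j) := fun j =>
    measurable_const.add (measurable_sum_mul_noise hs
      (fun j => hB.isCentredNoise_linIncrement γ (hss j)) (fun j => hMa (s j)) j)
  have hDm : ∀ j, Measurable[𝓕 (s j)] (D j) := fun j => (hYm j).sub (hEm j)
  have hD0 : ∀ ω, D 0 ω = 0 := fun ω => by simp [hD, hY, hs0, stochExp_zero]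
  have hstep : ∀ j ω, D (j + 1) ω = D j ω
      + ((M (s j) ω - stochExp B γ (s j) ω) * linIncrement B γ (s j) (s (j + 1)) ω
        + stochExp B γ (s j) ω * (linIncrement B γ (s j) (s (j + 1)) ω
          - (Real.exp (linIncrement B γ (s j) (s (j + 1)) ω
            - (∑ k, γ k ^ 2) * ((s (j + 1) : ℝ) - s j) / 2) - 1))) := by
    intro j ω
    simp only [hD, hY, Finset.sum_range_succ]
    rw [stochExp_eq_mul γ (s j) (s (j + 1)) ω]
    ring
  have hg : ∀ j ≤ n, P {ω | ε ≤ |D j ω + stochExp B γ (s j) ω - M (s j) ω|}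
      ≤ ENNReal.ofReal ε := by
    intro j hj
    have h := hunif (s j) (uniformPoint_le t.2.1 n j) (partitionUpTo s hs hs0 j)
      ((mesh_lt_iff _ hη).2 fun k hk => by
        change k < j at hk
        have e1 : min k j = k := by omega
        have e2 : min (k + 1) j = k + 1 := by omega
        simp only [partitionUpTo, e1, e2]
        exact nndist_uniformPoint_lt t.2.1 hη hnη (by omega))
    refine le_trans (le_of_eq ?_) h
    congr 1
    ext ω
    simp only [Set.mem_ofPred_eq]
    have hsum : ∑ k ∈ Finset.range (partitionUpTo s hs hs0 j).n,
        M ((partitionUpTo s hs hs0 j).pt k) ω * linIncrement B γ ((partitionUpTo s hs hs0 j).pt k)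
          ((partitionUpTo s hs hs0 j).pt (k + 1)) ω
        = ∑ i ∈ Finset.range j, M (s i) ω * linIncrement B γ (s i) (s (i + 1)) ω := by
      refine Finset.sum_congr rfl fun k hk => ?_
      change k ∈ Finset.range j at hk
      rw [Finset.mem_range] at hk
      have e1 : min k j = k := by omega
      have e2 : min (k + 1) j = k + 1 := by omega
      simp only [partitionUpTo, e1, e2]
    rw [hsum]
    simp only [hD, hY]
    rw [show 1 + ∑ i ∈ Finset.range j, M (s i) ω * linIncrement B γ (s i) (s (i + 1)) ω
        - stochExp B γ (s j) ω + stochExp B γ (s j) ω - M (s j) ω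
        = ∑ i ∈ Finset.range j, M (s i) ω * linIncrement B γ (s i) (s (i + 1)) ω
          - (M (s j) ω - 1) by ring]
  have hx := fun j => hB.isCentredNoise_linIncrement γ (hss j)
  have hz := fun j => hB.isCentredNoise_sub_exp γ (hss j)
  obtain ⟨hFL, hbound⟩ := integral_frozen_sq_le (n := n) (w := v / n) (w' := (v / n) ^ 2) hs
    (fun j => hMa (s j)) hEm hDm hx hz hD0 hstep hR (by positivity) (by positivity)
    (fun j => by rw [hB.integral_linIncrement_sq γ (hss j)]; exact (hvar j).2)
    (fun j => by
      rw [hB.integral_sub_exp_sq γ (hss j)]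
      have h1 := Real.abs_exp_sub_one_sub_id_le (x := v * ((s (j + 1) : ℝ) - s j))
        (by rw [abs_of_nonneg (hvar j).1]; exact (hvar j).2.trans hvn1)
      exact (le_abs_self _).trans (h1.trans (pow_le_pow_left₀ (hvar j).1 (hvar j).2 2)))
    hε.le hg
  set F := frozen (fun j => M (s j)) (fun j => stochExp B γ (s j)) D
    (fun j => linIncrement B γ (s j) (s (j + 1)))
    (fun j ω => linIncrement B γ (s j) (s (j + 1)) ω
          - (Real.exp (linIncrement B γ (s j) (s (j + 1)) ω
            - (∑ k, γ k ^ 2) * ((s (j + 1) : ℝ) - s j) / 2) - 1)) R n with hF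
  have hbound2 : ∫ ω, F ω ^ 2 ∂P ≤ (C - 1) * δ ^ 2 * ε := by
    refine hbound.trans ?_
    have h1 : (n : ℝ) * (4 * (v / n)) = 4 * v := by field_simp
    rw [h1]
    have h2 : (C - 1) * δ ^ 2 * ε = ((4 * v * (1 + (1 + 2 * R) ^ 2) + 2 * v ^ 2 * R ^ 2) * ε)
        * Real.exp (4 * v) := by
      simp only [hC]; field_simp; ring
    rw [h2]
    refine mul_le_mul_of_nonneg_right ?_ (Real.exp_pos _).le
    have h3 : (n : ℝ) * (4 * (v / n) * (ε ^ 2 + (1 + 2 * R) ^ 2 * ε) + 2 * (v / n) ^ 2 * R ^ 2)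
        = 4 * v * (ε ^ 2 + (1 + 2 * R) ^ 2 * ε) + 2 * v ^ 2 * R ^ 2 * (1 / n) := by
      field_simp
    rw [h3]
    have h4 : 1 / (n : ℝ) ≤ ε := by
      rw [div_le_iff₀ hn0']
      rwa [div_le_iff₀ hε, mul_comm] at hnε
    have h5 : ε ^ 2 ≤ ε := by nlinarith
    have h6 := mul_le_mul_of_nonneg_left h4 (by positivity : 0 ≤ 2 * v ^ 2 * R ^ 2)
    have h7 := mul_le_mul_of_nonneg_left h5 (by positivity : 0 ≤ 4 * v)
    nlinarith
  have hMarkov : P.real {ω | δ ^ 2 ≤ F ω ^ 2} ≤ (C - 1) * ε := by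
    have h1 := mul_meas_ge_le_integral_of_nonneg (ae_of_all P fun ω => sq_nonneg (F ω)) hFL (δ ^ 2)
    have h2 := h1.trans hbound2
    have h3 : δ ^ 2 * P.real {ω | δ ^ 2 ≤ F ω ^ 2} ≤ δ ^ 2 * ((C - 1) * ε) := by linarith
    exact le_of_mul_le_mul_left h3 (by positivity)
  have hMarkov' : P {ω | δ ^ 2 ≤ F ω ^ 2} ≤ ENNReal.ofReal ((C - 1) * ε) := by
    rw [← ENNReal.ofReal_toReal (measure_ne_top P _)]
    exact ENNReal.ofReal_le_ofReal hMarkov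
  have hC1 : 0 ≤ C - 1 := by simp only [hC, add_sub_cancel_right]; positivity
  have hsplit : ENNReal.ofReal (C * ε) = ENNReal.ofReal ((C - 1) * ε) + ENNReal.ofReal ε := by
    rw [← ENNReal.ofReal_add (by positivity) hε.le]; congr 1; ring
  rw [hsplit]
  refine le_trans (measure_mono ?_) ((measure_union_le _ _).trans
    (add_le_add hMarkov' (hg n le_rfl)))
  rintro ω ⟨hbd, hfar⟩
  by_contra hcon
  simp only [Set.mem_union, Set.mem_ofPred_eq, not_or, not_le] at hcon
  obtain ⟨c1, c2⟩ := hcon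
  have hmin := min_abs_le_abs_frozen (R := R) hD0 hstep (n := n) (ω := ω)
    fun j _ => hbd (s j)
  have hFlt : |F ω| < δ := by
    have := abs_lt_of_sq_lt_sq c1 hδ.le
    simpa using this
  have hDlt : |D n ω| < δ := by
    rcases le_total |D n ω| 1 with h | h
    · rw [min_eq_left h] at hmin; linarith
    · rw [min_eq_right h] at hmin; linarith
  rw [hsn] at c2
  have : |M t ω - stochExp B γ t ω| < 2 * δ := by
    rw [abs_lt] at hDlt c2 ⊢
    constructor <;> linarith [hDlt.1, hDlt.2, c2.1, c2.2]
  linarith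

/-- Uniqueness for the linear Itô equation `dM = M d⟨γ, B⟩`, `M_0 = 1`. -/
theorem ae_eq_stochExp (hB : IsStandardBM 𝓕 P x B)
    (hMa : ∀ t, Measurable[𝓕 t] (M t)) (hMc : ∀ ω, Continuous fun t => M t ω)
    (hM : ∀ t, TendstoInMeasure P (fun (p : TimePartition t) ω =>
      ∑ k ∈ Finset.range p.n, M (p.pt k) ω * linIncrement B γ (p.pt k) (p.pt (k + 1)) ω)
      (meshToZero t) (fun ω => M t ω - 1)) :
    ∀ᵐ ω ∂P, ∀ t, M t ω = stochExp B γ t ω := by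
  -- by compactness the paths are bounded, so the bounds `R = 1, 2, …` exhaust the space
  have hfix : ∀ t : I, ∀ᵐ ω ∂P, M t ω = stochExp B γ t ω := by
    intro t
    have h : ∀ R m : ℕ, ∀ᵐ ω ∂P, ¬ ((∀ s, |M s ω| ≤ R ∧ |stochExp B γ s ω| ≤ R)
        ∧ 2 * (1 / ((m : ℝ) + 1)) ≤ |M t ω - stochExp B γ t ω|) := fun R m => by
      have := measure_bounded_inter_le (R := R) (δ := 1 / ((m : ℝ) + 1)) hB hMa hM t
        (by positivity) (by positivity)
        ((div_le_one (by positivity)).2 (by linarith [(Nat.cast_nonneg m : (0 : ℝ) ≤ m)]))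
      rw [ae_iff]
      simpa using this
    have h' := ae_all_iff.2 fun R => ae_all_iff.2 (h R)
    filter_upwards [h'] with ω hω
    by_contra hne
    obtain ⟨a, ha⟩ := (isCompact_range (hMc ω)).isBounded.exists_norm_le
    obtain ⟨b, hb⟩ := (isCompact_range (continuous_stochExp (B := B) γ ω)).isBounded.exists_norm_le
    obtain ⟨R, hR⟩ := exists_nat_ge (max a b)
    have hpos : 0 < |M t ω - stochExp B γ t ω| := abs_pos.2 (sub_ne_zero.2 hne)
    obtain ⟨m, hm⟩ := exists_nat_one_div_lt (half_pos hpos)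
    refine hω R m ⟨fun s => ⟨?_, ?_⟩, by linarith⟩
    · exact (ha _ ⟨s, rfl⟩).trans ((le_max_left _ _).trans hR)
    · exact (hb _ ⟨s, rfl⟩).trans ((le_max_right _ _).trans hR)
  obtain ⟨S, hSc, hSd⟩ := TopologicalSpace.exists_countable_dense I
  have hS := (ae_ball_iff hSc).2 fun t _ => hfix t
  filter_upwards [hS] with ω hω
  exact congrFun (Continuous.ext_on hSd (hMc ω) (continuous_stochExp γ ω) hω)

end StochExp

section BlackScholesExplicit

variable {Ω : Type*} {mΩ : MeasurableSpace Ω} {l : ℕ} {𝓕 : Filtration I mΩ} {P : Measure Ω}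
  [IsProbabilityMeasure P] {x : Fin l → ℝ} {B : Ω → PathSpace l}

/-- The components of the Black–Scholes model are the stochastic exponentials given by the rows of
`Γ`. -/
theorem IsBlackScholesModel.ae_eq_stochExp {Γ : Matrix (Fin l) (Fin l) ℝ} {M : Ω → PathSpace l}
    (hB : IsStandardBM 𝓕 P x B) (hM : IsBlackScholesModel 𝓕 P B Γ (fun _ => 1) M) :
    ∀ᵐ ω ∂P, ∀ i t, M ω t i = stochExp B (Γ i) t ω := by
  refine ae_all_iff.2 fun i => _root_.ae_eq_stochExp (M := fun t ω => M ω t i) hB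
    (fun t => (measurable_pi_apply i).comp (hM.adapted t)) (fun ω => by fun_prop) fun t => ?_
  obtain ⟨J, hJ, hMJ⟩ := hM.integral_eq t i
  have h := MeasureTheory.TendstoInMeasure.sum_real Finset.univ fun k _ => hJ k
  refine h.congr (fun p => ae_of_all _ fun ω => ?_) ?_
  · rw [Finset.sum_comm]
    refine Finset.sum_congr rfl fun k _ => ?_
    simp only [linIncrement, Finset.mul_sum, blackScholesCoeff, Matrix.diagonal_mul]
    exact Finset.sum_congr rfl fun _ _ => by ring
  · filter_upwards [hMJ] with ω hω
    simp [hω]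

end BlackScholesExplicit

/-! ### Quadratic covariation of stochastic exponentials -/

/-- The relative increment `exp (⟨γ, B_t - B_s⟩ - |γ|² (t - s) / 2)` of the stochastic
exponential. -/
noncomputable def relStochExp {Ω : Type*} {l : ℕ} (B : Ω → PathSpace l) (γ : Fin l → ℝ) (s t : I)
    (ω : Ω) : ℝ :=
  Real.exp (linIncrement B γ s t ω - (∑ k, γ k ^ 2) * ((t : ℝ) - s) / 2)

section Moments

variable {Ω : Type*} {mΩ : MeasurableSpace Ω} {l : ℕ} {𝓕 : Filtration I mΩ} {P : Measure Ω}
  {x : Fin l → ℝ} {B : Ω → PathSpace l}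

lemma relStochExp_zero_left (γ : Fin l → ℝ) (t : I) (ω : Ω) :
    relStochExp B γ 0 t ω = stochExp B γ t ω := by
  simp [relStochExp, stochExp]

lemma IsStandardBM.measurable_relStochExp (hB : IsStandardBM 𝓕 P x B) (γ : Fin l → ℝ) {s t : I}
    (hst : s ≤ t) : Measurable[𝓕 t] (relStochExp B γ s t) :=
  Real.measurable_exp.comp ((hB.measurable_linIncrement γ hst).sub_const _)

lemma relStochExp_pow (γ : Fin l → ℝ) (s t : I) (n : ℕ) (ω : Ω) :
    relStochExp B γ s t ω ^ n
      = Real.exp (-(n * ((∑ k, γ k ^ 2) * ((t : ℝ) - s) / 2)))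
        * Real.exp (n * linIncrement B γ s t ω) := by
  rw [relStochExp, ← Real.exp_nat_mul, ← Real.exp_add]
  congr 1; ring

lemma IsStandardBM.integral_relStochExp_pow (hB : IsStandardBM 𝓕 P x B) (γ : Fin l → ℝ) {s t : I}
    (hst : s ≤ t) (n : ℕ) :
    ∫ ω, relStochExp B γ s t ω ^ n ∂P
      = Real.exp ((n * (n - 1) / 2) * ((∑ k, γ k ^ 2) * ((t : ℝ) - s))) := by
  simp_rw [relStochExp_pow]
  rw [integral_const_mul, integral_exp_mul_of_map_gaussianReal (hB.map_linIncrement γ hst),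
    coe_toNNReal_variance γ hst, ← Real.exp_add]
  congr 1; ring

lemma IsStandardBM.integrable_relStochExp_pow (hB : IsStandardBM 𝓕 P x B) (γ : Fin l → ℝ) {s t : I}
    (hst : s ≤ t) (n : ℕ) : Integrable (fun ω => relStochExp B γ s t ω ^ n) P := by
  simp_rw [relStochExp_pow]
  exact (integrable_exp_mul_of_map_gaussianReal (hB.aemeasurable_linIncrement γ hst)
    (hB.map_linIncrement γ hst) n).const_mul _

/-- The product of two relative increments is, up to a constant, a relative increment. -/
lemma relStochExp_mul_relStochExp (γ γ' : Fin l → ℝ) (s t : I) (ω : Ω) :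
    relStochExp B γ s t ω * relStochExp B γ' s t ω
      = Real.exp ((∑ k, γ k * γ' k) * ((t : ℝ) - s)) * relStochExp B (γ + γ') s t ω := by
  rw [relStochExp, relStochExp, relStochExp, ← Real.exp_add, ← Real.exp_add]
  congr 1
  have h1 : linIncrement B (γ + γ') s t ω = linIncrement B γ s t ω + linIncrement B γ' s t ω := by
    simp only [linIncrement, Pi.add_apply, add_mul, Finset.sum_add_distrib]
  have h2 : ∑ k, (γ + γ') k ^ 2 = ∑ k, γ k ^ 2 + 2 * (∑ k, γ k * γ' k) + ∑ k, γ' k ^ 2 := by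
    rw [Finset.mul_sum, ← Finset.sum_add_distrib, ← Finset.sum_add_distrib]
    exact Finset.sum_congr rfl fun k _ => by simp only [Pi.add_apply]; ring
  rw [h1, h2]; ring

lemma IsStandardBM.integral_relStochExp_mul (hB : IsStandardBM 𝓕 P x B) (γ γ' : Fin l → ℝ)
    {s t : I} (hst : s ≤ t) :
    ∫ ω, relStochExp B γ s t ω * relStochExp B γ' s t ω ∂P
      = Real.exp ((∑ k, γ k * γ' k) * ((t : ℝ) - s)) := by
  simp_rw [relStochExp_mul_relStochExp]
  have := hB.integral_relStochExp_pow (γ + γ') hst 1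
  simp only [pow_one] at this
  rw [integral_const_mul, this]
  simp

lemma IsStandardBM.integrable_relStochExp_mul (hB : IsStandardBM 𝓕 P x B) (γ γ' : Fin l → ℝ)
    {s t : I} (hst : s ≤ t) :
    Integrable (fun ω => relStochExp B γ s t ω * relStochExp B γ' s t ω) P := by
  simp_rw [relStochExp_mul_relStochExp]
  have := hB.integrable_relStochExp_pow (γ + γ') hst 1
  simp only [pow_one] at this
  exact this.const_mul _

lemma IsStandardBM.memLp_stochExp_mul (hB : IsStandardBM 𝓕 P x B) (γ γ' : Fin l → ℝ) (t : I) :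
    MemLp (fun ω => stochExp B γ t ω * stochExp B γ' t ω) 2 P := by
  simp_rw [← relStochExp_zero_left, relStochExp_mul_relStochExp]
  refine MemLp.const_mul ?_ _
  rw [memLp_two_iff_integrable_sq]
  · exact hB.integrable_relStochExp_pow _ t.2.1 2
  · simpa using (hB.integrable_relStochExp_pow (γ + γ') t.2.1 1).aestronglyMeasurable

lemma IsStandardBM.exists_integral_stochExp_mul_sq_le (hB : IsStandardBM 𝓕 P x B)
    (γ γ' : Fin l → ℝ) :
    ∃ C : ℝ, 0 ≤ C ∧ ∀ t, ∫ ω, (stochExp B γ t ω * stochExp B γ' t ω) ^ 2 ∂P ≤ C := by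
  refine ⟨Real.exp (2 * |∑ k, γ k * γ' k| + ∑ k, (γ + γ') k ^ 2), (Real.exp_pos _).le, fun t => ?_⟩
  simp_rw [← relStochExp_zero_left, relStochExp_mul_relStochExp, mul_pow]
  rw [integral_const_mul, hB.integral_relStochExp_pow _ t.2.1 2, ← Real.exp_nat_mul,
    ← Real.exp_add]
  refine Real.exp_le_exp.2 ?_
  have h0 : ((0 : I) : ℝ) = 0 := rfl
  have h1 : (∑ k, γ k * γ' k) * (t : ℝ) ≤ |∑ k, γ k * γ' k| :=
    (le_abs_self _).trans (by
      rw [abs_mul, abs_of_nonneg t.2.1]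
      exact mul_le_of_le_one_right (abs_nonneg _) t.2.2)
  have h2 : (∑ k, (γ + γ') k ^ 2) * (t : ℝ) ≤ ∑ k, (γ + γ') k ^ 2 :=
    mul_le_of_le_one_right (Finset.sum_nonneg fun _ _ => sq_nonneg _) t.2.2
  rw [h0]
  push_cast
  linarith

variable [IsProbabilityMeasure P]

/-- With `w` the variance of the logarithm, the left-hand side is the fourth moment of
`relStochExp - 1`. -/
lemma quartic_exp_le {w v : ℝ} (hw : 0 ≤ w) (hwv : w ≤ v) :
    Real.exp (6 * w) - 4 * Real.exp (3 * w) + 6 * Real.exp w - 3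
      ≤ 6 * Real.exp (6 * v) * w ^ 2 := by
  set u := Real.exp w with hu
  have h6 : Real.exp (6 * w) = u ^ 6 := by rw [hu, ← Real.exp_nat_mul]; norm_num
  have h3 : Real.exp (3 * w) = u ^ 3 := by rw [hu, ← Real.exp_nat_mul]; norm_num
  have hu1 : 1 ≤ u := Real.one_le_exp hw
  have hu2 : u - 1 ≤ w * u := by
    have h := Real.add_one_le_exp (-w)
    have h' : Real.exp (-w) * u = 1 := by rw [hu, ← Real.exp_add]; simp
    nlinarith
  have h4 : u ^ 6 - 4 * u ^ 3 + 6 * u - 3 = (u - 1) ^ 2 * (u ^ 4 + 2 * u ^ 3 + 3 * u ^ 2 - 3) := by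
    ring
  have h5 : u ^ 4 + 2 * u ^ 3 + 3 * u ^ 2 - 3 ≤ 6 * u ^ 4 := by
    have a1 : u ^ 3 ≤ u ^ 4 := pow_le_pow_right₀ hu1 (by norm_num)
    have a2 : u ^ 2 ≤ u ^ 4 := pow_le_pow_right₀ hu1 (by norm_num)
    linarith
  have h7 : (u - 1) ^ 2 ≤ (w * u) ^ 2 := pow_le_pow_left₀ (by linarith) hu2 2
  have h8 : u ^ 6 ≤ Real.exp (6 * v) := by
    rw [← h6]; exact Real.exp_le_exp.2 (by linarith)
  rw [h6, h3, h4]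
  calc (u - 1) ^ 2 * (u ^ 4 + 2 * u ^ 3 + 3 * u ^ 2 - 3) ≤ (w * u) ^ 2 * (6 * u ^ 4) := by
        refine (mul_le_mul_of_nonneg_left h5 (sq_nonneg _)).trans
          (mul_le_mul_of_nonneg_right h7 (by positivity))
    _ = 6 * u ^ 6 * w ^ 2 := by ring
    _ ≤ 6 * Real.exp (6 * v) * w ^ 2 := by gcongr

lemma IsStandardBM.integrable_relStochExp_sub_one_pow_four (hB : IsStandardBM 𝓕 P x B)
    (γ : Fin l → ℝ) {s t : I} (hst : s ≤ t) :
    Integrable (fun ω => (relStochExp B γ s t ω - 1) ^ 4) P := by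
  have h : ∀ ω, (relStochExp B γ s t ω - 1) ^ 4 = relStochExp B γ s t ω ^ 4
      + ((-4) * relStochExp B γ s t ω ^ 3 + (6 * relStochExp B γ s t ω ^ 2
        + ((-4) * relStochExp B γ s t ω ^ 1 + 1))) := fun ω => by ring
  simp_rw [h]
  have i := hB.integrable_relStochExp_pow γ hst
  have i1 := i 1; have i2 := i 2; have i3 := i 3; have i4 := i 4
  fun_prop

lemma IsStandardBM.integral_relStochExp_sub_one_pow_four_le (hB : IsStandardBM 𝓕 P x B)
    (γ : Fin l → ℝ) {s t : I} (hst : s ≤ t) :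
    ∫ ω, (relStochExp B γ s t ω - 1) ^ 4 ∂P
      ≤ 6 * Real.exp (6 * ∑ k, γ k ^ 2) * ((∑ k, γ k ^ 2) * ((t : ℝ) - s)) ^ 2 := by
  have h : ∀ ω, (relStochExp B γ s t ω - 1) ^ 4 = relStochExp B γ s t ω ^ 4
      + ((-4) * relStochExp B γ s t ω ^ 3 + (6 * relStochExp B γ s t ω ^ 2
        + ((-4) * relStochExp B γ s t ω ^ 1 + 1))) := fun ω => by ring
  have i := hB.integrable_relStochExp_pow γ hst
  have i1 := i 1; have i2 := i 2; have i3 := i 3; have i4 := i 4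
  have hv0 : 0 ≤ ∑ k, γ k ^ 2 := Finset.sum_nonneg fun _ _ => sq_nonneg _
  have hΔ : 0 ≤ (t : ℝ) - s := sub_nonneg.2 hst
  refine le_trans (le_of_eq ?_) (quartic_exp_le (mul_nonneg hv0 hΔ)
    (mul_le_of_le_one_right hv0 (by linarith [s.2.1, t.2.2])))
  simp_rw [h]
  rw [integral_add (by fun_prop) (by fun_prop), integral_add (by fun_prop) (by fun_prop),
    integral_add (by fun_prop) (by fun_prop), integral_add (by fun_prop) (by fun_prop)]
  simp only [integral_const_mul, hB.integral_relStochExp_pow γ hst]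
  norm_num
  ring

end Moments

section Riemann

/-- Riemann sums along partitions, for a continuous function on the unit interval, with the weights
`exp (g (t_{k+1} - t_k)) - 1 ≈ g (t_{k+1} - t_k)`. -/
lemma tendsto_riemannSum {a : I → ℝ} (ha : Continuous a) (g : ℝ) (t : I) :
    Tendsto (fun p : TimePartition t => ∑ k ∈ Finset.range p.n,
      a (p.pt k) * (Real.exp (g * ((p.pt (k + 1) : ℝ) - p.pt k)) - 1)) (meshToZero t)
      (𝓝 (∫ s in Set.Iic t, g * a s)) := by
  have hint : Integrable (fun s => g * a s) (volume : Measure I) :=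
    (continuous_const.mul ha).integrable_of_hasCompactSupport (HasCompactSupport.of_compactSpace _)
  have hsum : ∀ p : TimePartition t, ∫ s in Set.Iic t, g * a s
      = ∑ k ∈ Finset.range p.n, ∫ s in Set.Ioc (p.pt k) (p.pt (k + 1)), g * a s := by
    intro p
    have h0 : ∫ s in Set.Iic (0 : I), g * a s = 0 := by
      have : Set.Iic (0 : I) = {0} := by
        ext y; simp
      rw [this]
      simp
    have hk : ∀ k, ∫ s in Set.Ioc (p.pt k) (p.pt (k + 1)), g * a s
        = (∫ s in Set.Iic (p.pt (k + 1)), g * a s) - ∫ s in Set.Iic (p.pt k), g * a s := by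
      intro k
      have hle : p.pt k ≤ p.pt (k + 1) := p.mono (Nat.le_succ k)
      rw [eq_sub_iff_add_eq', ← setIntegral_union (Set.Iic_disjoint_Ioc le_rfl) measurableSet_Ioc
        hint.integrableOn hint.integrableOn, Set.Iic_union_Ioc_eq_Iic hle]
    simp_rw [hk]
    rw [Finset.sum_range_sub (fun k => ∫ s in Set.Iic (p.pt k), g * a s), p.pt_last, p.pt_zero, h0,
      sub_zero]
  obtain ⟨K, hK⟩ := (isCompact_range ha).isBounded.exists_norm_le
  have hK' : ∀ s, |a s| ≤ K := fun s => hK _ ⟨s, rfl⟩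
  have hK0 : 0 ≤ K := (abs_nonneg _).trans (hK' 0)
  rw [Metric.tendsto_nhds]
  intro ε hε
  set c := ε / (2 * (|g| + 1)) with hc
  have hc0 : 0 < c := by positivity
  obtain ⟨δ, hδ, hunif⟩ := Metric.uniformContinuous_iff.1
    (CompactSpace.uniformContinuous_of_continuous ha) c hc0
  set δ' := min δ (min (1 / (|g| + 1)) (ε / (2 * (K * g ^ 2 + 1)))) with hδ'
  have hδ'0 : 0 < δ' := by positivity
  refine eventually_meshToZero_iff.2 ⟨δ'.toNNReal, Real.toNNReal_pos.2 hδ'0, fun p hp => ?_⟩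
  have hp' : (p.mesh : ℝ) < δ' := by
    have := NNReal.coe_lt_coe.2 hp
    rwa [Real.coe_toNNReal _ hδ'0.le] at this
  have hterm : ∀ k ∈ Finset.range p.n,
      ‖a (p.pt k) * (Real.exp (g * ((p.pt (k + 1) : ℝ) - p.pt k)) - 1)
        - ∫ s in Set.Ioc (p.pt k) (p.pt (k + 1)), g * a s‖
      ≤ (K * g ^ 2 * δ' + |g| * c) * ((p.pt (k + 1) : ℝ) - p.pt k) := by
    intro k hk
    have hmesh := dist_le_mesh p (Finset.mem_range.1 hk)
    have hle : p.pt k ≤ p.pt (k + 1) := p.mono (Nat.le_succ k)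
    set Δ := (p.pt (k + 1) : ℝ) - p.pt k with hΔ
    have hΔ0 : 0 ≤ Δ := sub_nonneg.2 hle
    have hΔδ : Δ < δ' := hmesh.trans_lt hp'
    have hvol : (volume : Measure I).real (Set.Ioc (p.pt k) (p.pt (k + 1))) = Δ := by
      rw [measureReal_def, unitInterval.volume_Ioc, ENNReal.toReal_ofReal hΔ0]
    have hconst : ∫ _ in Set.Ioc (p.pt k) (p.pt (k + 1)), g * a (p.pt k) = g * a (p.pt k) * Δ := by
      rw [setIntegral_const, hvol, smul_eq_mul]; ring
    have h1 : ‖∫ s in Set.Ioc (p.pt k) (p.pt (k + 1)), (g * a s - g * a (p.pt k))‖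
        ≤ |g| * c * (volume : Measure I).real (Set.Ioc (p.pt k) (p.pt (k + 1))) := by
      refine norm_setIntegral_le_of_norm_le_const (measure_lt_top _ _) fun s hs => ?_
      rw [← mul_sub, norm_mul, Real.norm_eq_abs]
      refine mul_le_mul_of_nonneg_left ?_ (abs_nonneg _)
      rw [← dist_eq_norm]
      refine (hunif ?_).le
      rw [Subtype.dist_eq, Real.dist_eq,
        abs_of_nonneg (sub_nonneg.2 (show (p.pt k : ℝ) ≤ s from hs.1.le))]
      have : (s : ℝ) ≤ p.pt (k + 1) := hs.2
      calc (s : ℝ) - p.pt k ≤ Δ := by simp only [hΔ]; linarith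
        _ < δ' := hΔδ
        _ ≤ δ := min_le_left _ _
    rw [integral_sub hint.integrableOn (integrable_const _), hconst, hvol] at h1
    have h2 : |Real.exp (g * Δ) - 1 - g * Δ| ≤ (g * Δ) ^ 2 := by
      refine Real.abs_exp_sub_one_sub_id_le ?_
      rw [abs_mul, abs_of_nonneg hΔ0]
      have h3 : Δ ≤ 1 / (|g| + 1) :=
        hΔδ.le.trans ((min_le_right _ _).trans (min_le_left _ _))
      calc |g| * Δ ≤ |g| * (1 / (|g| + 1)) := by gcongr
        _ ≤ 1 := by
          rw [mul_one_div, div_le_one (by positivity)]; linarith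
    have h4 : ‖a (p.pt k) * (Real.exp (g * Δ) - 1 - g * Δ)‖ ≤ K * g ^ 2 * δ' * Δ := by
      rw [norm_mul, Real.norm_eq_abs, Real.norm_eq_abs]
      calc |a (p.pt k)| * |Real.exp (g * Δ) - 1 - g * Δ| ≤ K * (g * Δ) ^ 2 := by
            gcongr
            exact hK' _
        _ = K * g ^ 2 * Δ * Δ := by ring
        _ ≤ K * g ^ 2 * δ' * Δ := by gcongr
    calc ‖a (p.pt k) * (Real.exp (g * Δ) - 1)
          - ∫ s in Set.Ioc (p.pt k) (p.pt (k + 1)), g * a s‖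
        = ‖a (p.pt k) * (Real.exp (g * Δ) - 1 - g * Δ)
          - ((∫ s in Set.Ioc (p.pt k) (p.pt (k + 1)), g * a s) - g * a (p.pt k) * Δ)‖ := by
          congr 1; ring
      _ ≤ K * g ^ 2 * δ' * Δ + |g| * c * Δ := (norm_sub_le _ _).trans (add_le_add h4 h1)
      _ = _ := by ring
  rw [dist_eq_norm, hsum p, ← Finset.sum_sub_distrib]
  calc _ ≤ ∑ k ∈ Finset.range p.n, (K * g ^ 2 * δ' + |g| * c) * ((p.pt (k + 1) : ℝ) - p.pt k) :=
        norm_sum_le_of_le _ hterm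
    _ = (K * g ^ 2 * δ' + |g| * c) * t := by rw [← Finset.mul_sum, sum_increments]
    _ ≤ (K * g ^ 2 * δ' + |g| * c) * 1 := by
        refine mul_le_mul_of_nonneg_left t.2.2 (by positivity)
    _ < ε := by
        have e1 : |g| * c < ε / 2 := by
          simp only [hc]
          rw [mul_div_assoc', div_lt_div_iff₀ (by positivity) (by positivity)]
          nlinarith [abs_nonneg g]
        have e2 : K * g ^ 2 * δ' ≤ ε / 2 := by
          have : δ' ≤ ε / (2 * (K * g ^ 2 + 1)) := (min_le_right _ _).trans (min_le_right _ _)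
          have hKg : 0 ≤ K * g ^ 2 := by positivity
          calc K * g ^ 2 * δ' ≤ K * g ^ 2 * (ε / (2 * (K * g ^ 2 + 1))) := by gcongr
            _ ≤ ε / 2 := by
              rw [mul_div_assoc', div_le_div_iff₀ (by positivity) (by positivity)]
              nlinarith
        linarith

end Riemann

section Covariation

variable {Ω : Type*} {mΩ : MeasurableSpace Ω} {P : Measure Ω} [IsProbabilityMeasure P]

/-- Pointwise convergence implies convergence in probability, since the filter of partitions is
countably generated. -/
lemma tendstoInMeasure_meshToZero_of_forall_tendsto {t : I} {F : TimePartition t → Ω → ℝ}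
    {Z : Ω → ℝ} (hF : ∀ p, AEStronglyMeasurable (F p) P)
    (h : ∀ ω, Tendsto (fun p => F p ω) (meshToZero t) (𝓝 (Z ω))) :
    TendstoInMeasure P F (meshToZero t) Z := by
  intro ε hε
  refine tendsto_of_seq_tendsto fun u hu => ?_
  exact tendstoInMeasure_of_tendsto_ae (f := fun n => F (u n)) (fun n => hF _)
    (ae_of_all _ fun ω => (h ω).comp hu) ε hε

lemma tendstoInMeasure_meshToZero_of_integral_sq_le {t : I} {F : TimePartition t → Ω → ℝ} {C : ℝ}
    (hF : ∀ p, Integrable (fun ω => F p ω ^ 2) P) (h : ∀ p, ∫ ω, F p ω ^ 2 ∂P ≤ C * p.mesh) :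
    TendstoInMeasure P F (meshToZero t) (fun _ => 0) := by
  rw [tendstoInMeasure_iff_norm]
  intro ε hε
  have hlim : Tendsto (fun p : TimePartition t => ENNReal.ofReal (C * p.mesh / ε ^ 2))
      (meshToZero t) (𝓝 0) := by
    have h1 : Tendsto (fun p : TimePartition t => (p.mesh : ℝ)) (meshToZero t) (𝓝 0) := by
      exact (NNReal.continuous_coe.tendsto 0).comp
        (tendsto_comap : Tendsto TimePartition.mesh (meshToZero t) (𝓝 0))
    have h2 := ENNReal.tendsto_ofReal ((h1.const_mul C).div_const (ε ^ 2))
    simpa using h2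
  refine tendsto_of_tendsto_of_tendsto_of_le_of_le tendsto_const_nhds hlim (fun _ => zero_le)
    fun p => ?_
  have hm := (mul_meas_ge_le_integral_of_nonneg (ae_of_all P fun ω => sq_nonneg (F p ω)) (hF p)
    (ε ^ 2)).trans (h p)
  have hset : {ω | ε ≤ ‖F p ω - 0‖} = {ω | ε ^ 2 ≤ F p ω ^ 2} := by
    ext ω
    simp only [Set.mem_ofPred_eq, sub_zero, Real.norm_eq_abs]
    rw [← sq_abs (F p ω)]
    exact (pow_le_pow_iff_left₀ hε.le (abs_nonneg _) two_ne_zero).symm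
  simp only [hset]
  rw [← ENNReal.ofReal_toReal (measure_ne_top P _)]
  refine ENNReal.ofReal_le_ofReal ?_
  rw [le_div_iff₀ (by positivity), mul_comm]
  exact hm

variable {l : ℕ} {𝓕 : Filtration I mΩ} {x : Fin l → ℝ} {B : Ω → PathSpace l}

/-- The centred product of two relative increments of stochastic exponentials is a centred noise,
whose variance is of second order in `t - s`. -/
lemma IsStandardBM.isCentredNoise_covariation (hB : IsStandardBM 𝓕 P x B) (γ γ' : Fin l → ℝ)
    {s t : I} (hst : s ≤ t) :
    IsCentredNoise 𝓕 P s t (fun ω => (relStochExp B γ s t ω - 1) * (relStochExp B γ' s t ω - 1)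
        - (Real.exp ((∑ k, γ k * γ' k) * ((t : ℝ) - s)) - 1)) ∧
    ∫ ω, ((relStochExp B γ s t ω - 1) * (relStochExp B γ' s t ω - 1)
        - (Real.exp ((∑ k, γ k * γ' k) * ((t : ℝ) - s)) - 1)) ^ 2 ∂P
      ≤ (6 * Real.exp (6 * ∑ k, γ k ^ 2) * (∑ k, γ k ^ 2) ^ 2
          + 6 * Real.exp (6 * ∑ k, γ' k ^ 2) * (∑ k, γ' k ^ 2) ^ 2) * ((t : ℝ) - s) ^ 2 := by
  set m := Real.exp ((∑ k, γ k * γ' k) * ((t : ℝ) - s)) - 1 with hm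
  set a := relStochExp B γ s t with ha
  set b := relStochExp B γ' s t with hb
  have ia : Integrable a P := by simpa using hB.integrable_relStochExp_pow γ hst 1
  have ib : Integrable b P := by simpa using hB.integrable_relStochExp_pow γ' hst 1
  have iab : Integrable (fun ω => a ω * b ω) P := hB.integrable_relStochExp_mul γ γ' hst
  have ea : ∫ ω, a ω ∂P = 1 := by simpa using hB.integral_relStochExp_pow γ hst 1
  have eb : ∫ ω, b ω ∂P = 1 := by simpa using hB.integral_relStochExp_pow γ' hst 1
  have eab : ∫ ω, a ω * b ω ∂P = m + 1 := by
    rw [hB.integral_relStochExp_mul γ γ' hst, hm]; ring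
  have hexp : ∀ ω, (a ω - 1) * (b ω - 1) = a ω * b ω - a ω - b ω + 1 := fun ω => by ring
  have hprod : ∫ ω, (a ω - 1) * (b ω - 1) ∂P = m := by
    simp_rw [hexp]
    have j1 : Integrable (fun ω => a ω * b ω - a ω) P := iab.sub ia
    have j2 : Integrable (fun ω => a ω * b ω - a ω - b ω) P := j1.sub ib
    rw [integral_add j2 (integrable_const _), integral_sub j1 ib,
      integral_sub iab ia, ea, eb, eab]
    simp
  have hmeas : AEStronglyMeasurable (fun ω => (a ω - 1) * (b ω - 1)) P := by
    have := ia.aestronglyMeasurable; have := ib.aestronglyMeasurable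
    fun_prop
  have i4a := hB.integrable_relStochExp_sub_one_pow_four γ hst
  have i4b := hB.integrable_relStochExp_sub_one_pow_four γ' hst
  have hle : ∀ ω, ((a ω - 1) * (b ω - 1)) ^ 2 ≤ (a ω - 1) ^ 4 + (b ω - 1) ^ 4 := fun ω => by
    nlinarith [sq_nonneg ((a ω - 1) ^ 2 - (b ω - 1) ^ 2), sq_nonneg ((a ω - 1) ^ 2),
      sq_nonneg ((b ω - 1) ^ 2)]
  have hL2 : MemLp (fun ω => (a ω - 1) * (b ω - 1)) 2 P := by
    rw [memLp_two_iff_integrable_sq hmeas]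
    refine (i4a.add i4b).mono' (hmeas.pow 2) (ae_of_all _ fun ω => ?_)
    rw [Real.norm_of_nonneg (sq_nonneg _)]
    exact hle ω
  refine ⟨?_, ?_⟩
  · refine hB.isCentredNoise hst (f := fun y =>
      (Real.exp ((∑ k, γ k * y k) - (∑ k, γ k ^ 2) * ((t : ℝ) - s) / 2) - 1)
        * (Real.exp ((∑ k, γ' k * y k) - (∑ k, γ' k ^ 2) * ((t : ℝ) - s) / 2) - 1) - m)
      (by fun_prop) (hL2.sub (memLp_const m)) ?_
    calc _ = ∫ ω, ((a ω - 1) * (b ω - 1) - m) ∂P := rfl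
      _ = 0 := by
        rw [integral_sub (hL2.integrable (by norm_num)) (integrable_const _), hprod]
        simp
  · have e1 : ∫ ω, ((a ω - 1) * (b ω - 1) - m) ^ 2 ∂P
        ≤ ∫ ω, ((a ω - 1) * (b ω - 1)) ^ 2 ∂P := by
      have hsq : ∀ ω, ((a ω - 1) * (b ω - 1) - m) ^ 2
          = ((a ω - 1) * (b ω - 1)) ^ 2 + ((-2 * m) * ((a ω - 1) * (b ω - 1)) + m ^ 2) :=
        fun ω => by ring
      have i1 : Integrable (fun ω => (-2 * m) * ((a ω - 1) * (b ω - 1))) P :=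
        (hL2.integrable (by norm_num)).const_mul _
      have i2 : Integrable (fun ω => (-2 * m) * ((a ω - 1) * (b ω - 1)) + m ^ 2) P :=
        i1.add (integrable_const _)
      simp_rw [hsq]
      rw [integral_add hL2.integrable_sq i2, integral_add i1 (integrable_const _),
        integral_const_mul, hprod]
      simp only [integral_const, probReal_univ, smul_eq_mul]
      nlinarith [sq_nonneg m]
    have e2 : ∫ ω, ((a ω - 1) * (b ω - 1)) ^ 2 ∂P
        ≤ ∫ ω, (a ω - 1) ^ 4 ∂P + ∫ ω, (b ω - 1) ^ 4 ∂P := by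
      rw [← integral_add i4a i4b]
      exact integral_mono hL2.integrable_sq (i4a.add i4b) hle
    have e3 := hB.integral_relStochExp_sub_one_pow_four_le γ hst
    have e4 := hB.integral_relStochExp_sub_one_pow_four_le γ' hst
    refine (e1.trans e2).trans ((add_le_add e3 e4).trans (le_of_eq ?_))
    ring

/-- The quadratic covariation of two stochastic exponentials. The sums of products of increments split
into a sum of centred noises, which vanishes in the limit by the Itô isometry, and a Riemann sum. -/
lemma IsStandardBM.isQuadraticCovariation_stochExp (hB : IsStandardBM 𝓕 P x B)
    (γ γ' : Fin l → ℝ) (t : I) :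
    IsQuadraticCovariation P (stochExp B γ) (stochExp B γ') t
      (fun ω => ∫ s in Set.Iic t, (∑ k, γ k * γ' k) * (stochExp B γ s ω * stochExp B γ' s ω)) := by
  set g := ∑ k, γ k * γ' k with hg
  set K := 6 * Real.exp (6 * ∑ k, γ k ^ 2) * (∑ k, γ k ^ 2) ^ 2
          + 6 * Real.exp (6 * ∑ k, γ' k ^ 2) * (∑ k, γ' k ^ 2) ^ 2 with hK
  have hK0 : 0 ≤ K := by positivity
  obtain ⟨C, hC0, hC⟩ := hB.exists_integral_stochExp_mul_sq_le γ γ'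
  have hmeas : ∀ s, Measurable[𝓕 s] (fun ω => stochExp B γ s ω * stochExp B γ' s ω) := fun s =>
    (hB.measurable_stochExp γ s).mul (hB.measurable_stochExp γ' s)
  have h1 : TendstoInMeasure P (fun (p : TimePartition t) ω => ∑ k ∈ Finset.range p.n,
      (stochExp B γ (p.pt k) ω * stochExp B γ' (p.pt k) ω)
        * ((relStochExp B γ (p.pt k) (p.pt (k + 1)) ω - 1)
            * (relStochExp B γ' (p.pt k) (p.pt (k + 1)) ω - 1)
          - (Real.exp (g * ((p.pt (k + 1) : ℝ) - p.pt k)) - 1))) (meshToZero t) (fun _ => 0) := by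
    have hη := fun (p : TimePartition t) (k : ℕ) =>
      hB.isCentredNoise_covariation γ γ' (p.mono (Nat.le_succ k))
    refine tendstoInMeasure_meshToZero_of_integral_sq_le (C := C * K) (fun p => ?_) (fun p => ?_)
    · exact (memLp_sum_mul_noise (fun k => (hη p k).1) (fun k => hmeas _)
        (fun k => hB.memLp_stochExp_mul γ γ' _) p.n).integrable_sq
    · rw [integral_sum_mul_noise_sq p.mono (fun k => (hη p k).1) (fun k => hmeas _)
        (fun k => hB.memLp_stochExp_mul γ γ' _) p.n]
      calc _ ≤ ∑ k ∈ Finset.range p.n, C * K * p.mesh * ((p.pt (k + 1) : ℝ) - p.pt k) := by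
            refine Finset.sum_le_sum fun k hk => ?_
            have hΔ0 : 0 ≤ (p.pt (k + 1) : ℝ) - p.pt k := sub_nonneg.2 (p.mono (Nat.le_succ k))
            have hΔ := dist_le_mesh p (Finset.mem_range.1 hk)
            calc _ ≤ C * (K * ((p.pt (k + 1) : ℝ) - p.pt k) ^ 2) :=
                  mul_le_mul (hC _) (hη p k).2 (integral_nonneg fun _ => sq_nonneg _) hC0
              _ = C * K * ((p.pt (k + 1) : ℝ) - p.pt k) * ((p.pt (k + 1) : ℝ) - p.pt k) := by ring
              _ ≤ C * K * p.mesh * ((p.pt (k + 1) : ℝ) - p.pt k) := by gcongr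
        _ = C * K * p.mesh * t := by rw [← Finset.mul_sum, sum_increments]
        _ ≤ C * K * p.mesh := mul_le_of_le_one_right (by positivity) t.2.2
  have h2 : TendstoInMeasure P (fun (p : TimePartition t) ω => ∑ k ∈ Finset.range p.n,
      (stochExp B γ (p.pt k) ω * stochExp B γ' (p.pt k) ω)
        * (Real.exp (g * ((p.pt (k + 1) : ℝ) - p.pt k)) - 1)) (meshToZero t)
      (fun ω => ∫ s in Set.Iic t, g * (stochExp B γ s ω * stochExp B γ' s ω)) := by
    refine tendstoInMeasure_meshToZero_of_forall_tendsto (fun p => ?_) fun ω =>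
      tendsto_riemannSum ((continuous_stochExp γ ω).mul (continuous_stochExp γ' ω)) g t
    refine Measurable.aestronglyMeasurable (Finset.measurable_sum _ fun k _ => ?_)
    exact ((hmeas (p.pt k)).mono (𝓕.le _) le_rfl).mul_const _
  refine (h1.add_real h2).congr (fun p => ae_of_all _ fun ω => ?_) (ae_of_all _ fun ω => zero_add _)
  simp only
  rw [← Finset.sum_add_distrib]
  refine Finset.sum_congr rfl fun k _ => ?_
  have e1 := stochExp_eq_mul (B := B) γ (p.pt k) (p.pt (k + 1)) ω
  have e2 := stochExp_eq_mul (B := B) γ' (p.pt k) (p.pt (k + 1)) ω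
  rw [e1, e2]
  simp only [relStochExp]
  ring

end Covariation

/-! ### Uniqueness of the density of the quadratic covariation -/

section Density

/-- An integrable function on the unit interval is determined by its integrals over the intervals
`[0, t]`, for `t` in a dense set. -/
lemma ae_eq_zero_of_forall_setIntegral_Iic {f : I → ℝ} (hf : Integrable f) {S : Set I}
    (hS : Dense S) (h : ∀ t ∈ S, ∫ s in Set.Iic t, f s = 0) : f =ᵐ[volume] 0 := by
  have hcont : Continuous fun t : I => ∫ s in Set.Iic t, f s := by
    simp_rw [← integral_indicator measurableSet_Iic]
    refine continuous_iff_continuousAt.2 fun t => ?_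
    refine continuousAt_of_dominated (bound := fun s => ‖f s‖)
      (Eventually.of_forall fun u => hf.aestronglyMeasurable.indicator measurableSet_Iic)
      (Eventually.of_forall fun u => ae_of_all _ fun s => norm_indicator_le_norm_self _ _)
      hf.norm ?_
    have hne : ∀ᵐ s : I, s ≠ t := by simp [ae_iff]
    filter_upwards [hne] with s hs
    rcases lt_or_gt_of_ne hs with hst | hst
    · refine (continuousAt_const (y := f s)).congr ?_
      filter_upwards [lt_mem_nhds hst] with u hu
      rw [Set.indicator_of_mem (Set.mem_Iic.2 (le_of_lt hu))]
    · refine (continuousAt_const (y := (0 : ℝ))).congr ?_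
      filter_upwards [gt_mem_nhds hst] with u hu
      rw [Set.indicator_of_notMem (fun hmem => absurd (Set.mem_Iic.1 hmem) (not_le.2 hu))]
  have hall : ∀ t : I, ∫ s in Set.Iic t, f s = 0 := fun t =>
    congrFun (Continuous.ext_on hS hcont continuous_const h) t
  have huniv : ∫ s, f s = 0 := by
    have h1 := hall 1
    have : Set.Iic (1 : I) = Set.univ := by
      ext y; simp [unitInterval.le_one']
    rwa [this, setIntegral_univ] at h1
  refine hf.ae_eq_zero_of_forall_setIntegral_eq_zero fun s hs _ => ?_
  induction s, hs using MeasurableSpace.induction_on_inter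
    ((BorelSpace.measurable_eq (α := I)).trans (borel_eq_generateFrom_Iic I)) isPiSystem_Iic with
  | empty => simp
  | basic u hu =>
    obtain ⟨t, rfl⟩ := hu
    exact hall t
  | compl u hu ih =>
    have := integral_add_compl hu hf
    rw [ih (measure_lt_top _ _), huniv, zero_add] at this
    exact this
  | iUnion u hd hu ih =>
    rw [integral_iUnion hu hd hf.integrableOn]
    simp [ih _ (measure_lt_top _ _)]

variable {Ω : Type*} {mΩ : MeasurableSpace Ω} {l : ℕ} {P : Measure Ω} {M : Ω → PathSpace l}
  {G G' : I → Ω → Matrix (Fin l) (Fin l) ℝ}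

/-- The density of the quadratic covariation is unique up to null sets. -/
lemma IsQuadraticCovariationDensity.ae_eq (hG : IsQuadraticCovariationDensity P M G)
    (hG' : IsQuadraticCovariationDensity P M G') :
    ∀ᵐ ω ∂P, ∀ᵐ t : I, G t ω = G' t ω := by
  obtain ⟨S, hSc, hSd⟩ := TopologicalSpace.exists_countable_dense I
  have h1 : ∀ᵐ ω ∂P, ∀ t ∈ S, ∀ i j,
      ∫ s in Set.Iic t, G s ω i j = ∫ s in Set.Iic t, G' s ω i j :=
    (ae_ball_iff hSc).2 fun t _ => ae_all_iff.2 fun i => ae_all_iff.2 fun j =>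
      tendstoInMeasure_ae_unique (hG.covariation t i j) (hG'.covariation t i j)
  filter_upwards [h1, hG.integrable, hG'.integrable] with ω hω hi hi'
  have h2 : ∀ i j, ∀ᵐ t : I, G t ω i j = G' t ω i j := by
    intro i j
    have := ae_eq_zero_of_forall_setIntegral_Iic ((hi i j).sub (hi' i j)) hSd fun t ht => by
      simp only [Pi.sub_apply]
      rw [integral_sub (hi i j).integrableOn (hi' i j).integrableOn, hω t ht i j, sub_self]
    filter_upwards [this] with t ht
    exact sub_eq_zero.1 ht
  filter_upwards [ae_all_iff.2 fun i => ae_all_iff.2 fun j => h2 i j] with t ht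
  ext i j
  exact ht i j

end Density

section BlackScholesCovariation

variable {Ω : Type*} {mΩ : MeasurableSpace Ω} {l : ℕ} {𝓕 : Filtration I mΩ} {P : Measure Ω}
  [IsProbabilityMeasure P] {x : Fin l → ℝ} {B : Ω → PathSpace l}
  {Γ : Matrix (Fin l) (Fin l) ℝ} {M : Ω → PathSpace l}

lemma blackScholesCoeff_mul_transpose_apply (Γ : Matrix (Fin l) (Fin l) ℝ) (y : Fin l → ℝ)
    (i j : Fin l) : (blackScholesCoeff Γ y * (blackScholesCoeff Γ y).transpose) i j
      = (∑ k, Γ i k * Γ j k) * (y i * y j) := by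
  rw [Matrix.mul_apply]
  simp only [Matrix.transpose_apply, blackScholesCoeff, Matrix.diagonal_mul, Finset.sum_mul]
  exact Finset.sum_congr rfl fun k _ => by ring

/-- The quadratic covariation of the Black–Scholes model has the density `σ σᵀ`, where
`σ = diag(M) Γ`. -/
theorem IsBlackScholesModel.isQuadraticCovariationDensity
    (hB : IsStandardBM 𝓕 P x B) (hM : IsBlackScholesModel 𝓕 P B Γ (fun _ => 1) M) :
    IsQuadraticCovariationDensity P M
      (fun t ω => blackScholesCoeff Γ (M ω t) * (blackScholesCoeff Γ (M ω t)).transpose) where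
  measurable i j := by
    simp only [blackScholesCoeff_mul_transpose_apply]
    have h : ∀ i, Measurable (fun p : I × Ω => M p.2 p.1 i) := fun i =>
      measurable_uncurry_of_continuous_of_measurable (u := fun (t : I) ω => M ω t i)
        (fun ω => by fun_prop)
        fun t => (measurable_pi_apply i).comp ((hM.adapted t).mono (𝓕.le _) le_rfl)
    exact ((h i).mul (h j)).const_mul _
  integrable := by
    refine ae_of_all _ fun ω i j => ?_
    simp only [blackScholesCoeff_mul_transpose_apply]
    have : Continuous fun t : I => (∑ k, Γ i k * Γ j k) * (M ω t i * M ω t j) := by fun_prop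
    exact this.integrable_of_hasCompactSupport (HasCompactSupport.of_compactSpace _)
  covariation t i j := by
    have hE := hM.ae_eq_stochExp hB
    refine TendstoInMeasure.congr (fun p => ?_) ?_
      (hB.isQuadraticCovariation_stochExp (Γ i) (Γ j) t)
    · filter_upwards [hE] with ω hω
      simp only [hω]
    · filter_upwards [hE] with ω hω
      simp only [blackScholesCoeff_mul_transpose_apply, hω]

end BlackScholesCovariation

/-! ### Relative entropy of the image of a measure under a differentiable map -/

section KL

open InformationTheory

/-- Relative entropy is invariant under maps with a measurable left inverse. -/
lemma klDiv_map_of_leftInverse {α β : Type*} {mα : MeasurableSpace α} {mβ : MeasurableSpace β}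
    (μ ν : Measure α) [IsFiniteMeasure μ] [IsFiniteMeasure ν] {f : α → β} {g : β → α}
    (hf : Measurable f) (hg : Measurable g) (hgf : Function.LeftInverse g f) :
    klDiv (μ.map f) (ν.map f) = klDiv μ ν := by
  refine le_antisymm (klDiv_map_le μ ν hf) ?_
  have h := klDiv_map_le (μ.map f) (ν.map f) hg
  rwa [Measure.map_map hg hf, Measure.map_map hg hf, hgf.comp_eq_id, Measure.map_id,
    Measure.map_id] at h

variable {E : Type*} [NormedAddCommGroup E] [NormedSpace ℝ E] [FiniteDimensional ℝ E]
  [MeasurableSpace E] [BorelSpace E]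

/-- By Sard's lemma, the image of a probability measure under a differentiable map with singular
differentials is not absolutely continuous with respect to a measure with a density. -/
lemma klDiv_map_eq_top_of_det_fderiv_eq_zero {lam μ : Measure E} [lam.IsAddHaarMeasure]
    [IsProbabilityMeasure μ] (hμ : μ ≪ lam) {θ : E → E} {θ' : E → E →L[ℝ] E}
    (hθ : ∀ b, HasFDerivAt θ (θ' b) b) (hdet : ∀ b, (θ' b).det = 0) :
    klDiv (μ.map θ) μ = ∞ := by
  have hc : Continuous θ := continuous_iff_continuousAt.2 fun b => (hθ b).continuousAt
  refine klDiv_of_not_ac fun hac => ?_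
  have h0 : lam (θ '' Set.univ) = 0 := addHaar_image_eq_zero_of_det_fderivWithin_eq_zero lam
    (fun b _ => (hθ b).hasFDerivWithinAt) fun b _ => hdet b
  have h1 : μ.map θ (toMeasurable lam (θ '' Set.univ)) = 0 :=
    hac (hμ (by rw [measure_toMeasurable, h0]))
  rw [Measure.map_apply hc.measurable (measurableSet_toMeasurable _ _)] at h1
  have h2 : θ ⁻¹' (toMeasurable lam (θ '' Set.univ)) = Set.univ :=
    Set.eq_univ_of_forall fun b => subset_toMeasurable _ _ ⟨b, trivial, rfl⟩
  rw [h2, measure_univ] at h1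
  exact one_ne_zero h1

/-- The relative entropy of the image of a probability measure with positive density `φ` under an
injective differentiable map `θ` with invertible differentials, from the change of variables
formula. -/
lemma klDiv_map_eq_integral_log {lam μ : Measure E} [lam.IsAddHaarMeasure] [IsProbabilityMeasure μ]
    {φ : E → ℝ} (hφm : Measurable φ) (hφ : ∀ b, 0 < φ b)
    (hμ : μ = lam.withDensity fun b => ENNReal.ofReal (φ b)) {θ : E → E} {θ' : E → E →L[ℝ] E}
    (hθ : ∀ b, HasFDerivAt θ (θ' b) b) (hinj : Function.Injective θ) (hdet : ∀ b, (θ' b).det ≠ 0)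
    (hdetm : Measurable fun b => (θ' b).det)
    (hint : Integrable (fun b => Real.log (φ b) - Real.log (φ (θ b)) - Real.log |(θ' b).det|) μ) :
    klDiv (μ.map θ) μ
        = ENNReal.ofReal (∫ b, (Real.log (φ b) - Real.log (φ (θ b)) - Real.log |(θ' b).det|) ∂μ) ∧
      0 ≤ ∫ b, (Real.log (φ b) - Real.log (φ (θ b)) - Real.log |(θ' b).det|) ∂μ := by
  have hc : Continuous θ := continuous_iff_continuousAt.2 fun b => (hθ b).continuousAt
  have hemb : MeasurableEmbedding θ := hc.measurableEmbedding hinj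
  set ρ : E → ℝ := fun b => φ b / (φ (θ b) * |(θ' b).det|) with hρ
  have hρm : Measurable ρ := by
    have := hc.measurable
    have h1 : Measurable fun b => |(θ' b).det| := continuous_abs.measurable.comp hdetm
    exact hφm.div ((hφm.comp this).mul h1)
  have hρpos : ∀ b, 0 < ρ b := fun b =>
    div_pos (hφ b) (mul_pos (hφ _) (abs_pos.2 (hdet b)))
  have hρlog : ∀ b, Real.log (ρ b)
      = Real.log (φ b) - Real.log (φ (θ b)) - Real.log |(θ' b).det| := fun b => by
    rw [hρ, Real.log_div (hφ b).ne' (mul_pos (hφ _) (abs_pos.2 (hdet b))).ne',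
      Real.log_mul (hφ _).ne' (abs_pos.2 (hdet b)).ne']
    ring
  -- the density of the image measure with respect to `μ`, extended by zero outside the range
  set r : E → ℝ := Function.extend θ ρ 0 with hr
  have hrm : Measurable r := hemb.measurable_extend hρm measurable_const
  have hrθ : ∀ b, r (θ b) = ρ b := fun b => hinj.extend_apply _ _ _
  have hr0 : ∀ y, y ∉ θ '' Set.univ → r y = 0 := fun y hy => by
    rw [hr, Function.extend_apply' _ _ _ (by simpa using hy)]; rfl
  have hφE : Measurable fun b => ENNReal.ofReal (φ b) := hφm.ennreal_ofReal
  have hrE : Measurable fun b => ENNReal.ofReal (r b) := hrm.ennreal_ofReal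
  have hmap : μ.map θ = μ.withDensity fun b => ENNReal.ofReal (r b) := by
    ext s hs
    rw [Measure.map_apply hc.measurable hs, withDensity_apply _ hs, hμ,
      withDensity_apply _ (hc.measurable hs)]
    rw [setLIntegral_withDensity_eq_setLIntegral_mul _ hφE hrE hs]
    have himg : MeasurableSet (θ '' Set.univ) := by
      rw [Set.image_univ]; exact hemb.measurableSet_range
    have h1 : ∫⁻ y in s, ((fun b => ENNReal.ofReal (φ b)) * fun b => ENNReal.ofReal (r b)) y ∂lam
        = ∫⁻ y in θ '' Set.univ,
          s.indicator (fun y => ENNReal.ofReal (φ y) * ENNReal.ofReal (r y)) y ∂lam := by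
      rw [← lintegral_indicator hs, ← lintegral_indicator himg]
      refine lintegral_congr fun y => ?_
      by_cases hy : y ∈ θ '' Set.univ
      · rw [Set.indicator_of_mem hy]; rfl
      · rw [Set.indicator_of_notMem hy]
        by_cases hys : y ∈ s
        · rw [Set.indicator_of_mem hys]
          simp [hr0 y hy]
        · rw [Set.indicator_of_notMem hys]
    rw [h1, lintegral_image_eq_lintegral_abs_det_fderiv_mul lam MeasurableSet.univ
      (fun b _ => (hθ b).hasFDerivWithinAt) hinj.injOn, setLIntegral_univ,
      ← lintegral_indicator (hc.measurable hs)]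
    refine lintegral_congr fun b => ?_
    by_cases hb : θ b ∈ s
    · rw [Set.indicator_of_mem (show b ∈ θ ⁻¹' s from hb), Set.indicator_of_mem hb, hrθ,
        ← ENNReal.ofReal_mul (hφ _).le, ← ENNReal.ofReal_mul (abs_nonneg _)]
      congr 1
      have h2 := (hφ (θ b)).ne'
      have h3 := (abs_pos.2 (hdet b)).ne'
      simp only [hρ]
      field_simp
    · rw [Set.indicator_of_notMem (show b ∉ θ ⁻¹' s from hb), Set.indicator_of_notMem hb, mul_zero]
  have hac : μ.map θ ≪ μ := hmap ▸ withDensity_absolutelyContinuous _ _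
  have : IsProbabilityMeasure (μ.map θ) := Measure.isProbabilityMeasure_map hc.aemeasurable
  have hllr : llr (μ.map θ) μ =ᵐ[μ.map θ] fun y => Real.log (r y) := by
    refine hac.ae_le ?_
    have h := Measure.rnDeriv_withDensity μ hrE
    rw [← hmap] at h
    filter_upwards [h] with y hy
    rw [llr, hy]
    congr 1
    refine ENNReal.toReal_ofReal ?_
    by_cases hy' : y ∈ θ '' Set.univ
    · obtain ⟨b, -, rfl⟩ := hy'
      rw [hrθ]; exact (hρpos b).le
    · exact (hr0 y hy').ge
  have hcomp : (fun b => Real.log (φ b) - Real.log (φ (θ b)) - Real.log |(θ' b).det|)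
      = fun b => Real.log (r (θ b)) := by
    ext b; rw [hrθ, hρlog]
  have hlogm : AEStronglyMeasurable (fun y => Real.log (r y)) (μ.map θ) :=
    hrm.log.aestronglyMeasurable
  have hintr : Integrable (llr (μ.map θ) μ) (μ.map θ) := by
    rw [integrable_congr hllr, integrable_map_measure hlogm hc.aemeasurable]
    rw [hcomp] at hint
    exact hint
  have hval : ∫ y, llr (μ.map θ) μ y ∂(μ.map θ)
      = ∫ b, (Real.log (φ b) - Real.log (φ (θ b)) - Real.log |(θ' b).det|) ∂μ := by
    rw [integral_congr_ae hllr, integral_map hc.aemeasurable hlogm, hcomp]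
  have hnn := integral_llr_add_sub_measure_univ_nonneg hac hintr
  have hkl := klDiv_of_ac_of_integrable hac hintr
  simp only [probReal_univ, add_sub_cancel_right, hval] at hnn hkl
  exact ⟨hkl, hnn⟩

end KL

/-! ### Exponentials of affine maps of Gaussian vectors -/

section ExpAffine

variable {ι : Type*} [Fintype ι]

/-- The product of centred Gaussian measures has the product density. -/
lemma pi_gaussianReal_eq_withDensity {v : ℝ≥0} (hv : v ≠ 0) :
    (Measure.pi fun _ : ι => gaussianReal 0 v)
      = (volume : Measure (ι → ℝ)).withDensity
        fun b => ENNReal.ofReal (∏ i, gaussianPDFReal 0 v (b i)) := by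
  refine Measure.pi_eq fun s hs => ?_
  have hms : MeasurableSet (Set.univ.pi s) := MeasurableSet.univ_pi hs
  have hint : Integrable (fun b : ι → ℝ => ∏ i, gaussianPDFReal 0 v (b i)) :=
    Integrable.fintype_prod fun _ => integrable_gaussianPDFReal 0 v
  rw [withDensity_apply _ hms, ← ofReal_integral_eq_lintegral_ofReal hint.integrableOn
    (ae_of_all _ fun b => Finset.prod_nonneg fun i _ => gaussianPDFReal_nonneg _ _ _),
    ← integral_indicator hms]
  have h1 : (Set.univ.pi s).indicator (fun b : ι → ℝ => ∏ i, gaussianPDFReal 0 v (b i))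
      = fun b => ∏ i, (s i).indicator (gaussianPDFReal 0 v) (b i) := by
    ext b
    by_cases hb : b ∈ Set.univ.pi s
    · rw [Set.indicator_of_mem hb]
      exact Finset.prod_congr rfl fun i _ => by rw [Set.indicator_of_mem (hb i trivial)]
    · rw [Set.indicator_of_notMem hb]
      obtain ⟨i, hi⟩ : ∃ i, b i ∉ s i := by simpa [Set.mem_univ_pi] using hb
      exact (Finset.prod_eq_zero (Finset.mem_univ i) (Set.indicator_of_notMem hi _)).symm
  rw [h1, integral_fintype_prod_volume_eq_prod
    (f := fun (i : ι) (y : ℝ) => (s i).indicator (gaussianPDFReal 0 v) y),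
    ENNReal.ofReal_prod_of_nonneg fun i _ => integral_nonneg fun y =>
      Set.indicator_nonneg (fun _ _ => gaussianPDFReal_nonneg _ _ _) _]
  refine Finset.prod_congr rfl fun i _ => ?_
  rw [gaussianReal_apply_eq_integral 0 hv, integral_indicator (hs i)]

lemma log_prod_gaussianPDFReal {v : ℝ≥0} (hv : v ≠ 0) (b : ι → ℝ) :
    Real.log (∏ i, gaussianPDFReal 0 v (b i))
      = ∑ _i : ι, Real.log ((√(2 * Real.pi * v))⁻¹) - (∑ i, b i ^ 2) / (2 * v) := by
  have hv' : (0 : ℝ) < v := by positivity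
  rw [Real.log_prod fun i _ => (gaussianPDFReal_pos 0 v _ hv).ne', Finset.sum_div,
    ← Finset.sum_sub_distrib]
  refine Finset.sum_congr rfl fun i _ => ?_
  rw [gaussianPDFReal, Real.log_mul (by positivity) (Real.exp_pos _).ne', Real.log_exp]
  simp only [sub_zero]
  ring

/-- The map `b ↦ S (exp (A b - κ) - 1)`, the exponential being taken coordinatewise. -/
noncomputable def expAffine (S A : Matrix ι ι ℝ) (κ : ι → ℝ) (b : ι → ℝ) : ι → ℝ :=
  S.mulVec fun i => Real.exp (A.mulVec b i - κ i) - 1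

variable {S A : Matrix ι ι ℝ} {κ : ι → ℝ} [DecidableEq ι]

lemma hasFDerivAt_expAffine (b : ι → ℝ) :
    HasFDerivAt (expAffine S A κ) (LinearMap.toContinuousLinearMap (Matrix.toLin'
      (S * Matrix.diagonal (fun i => Real.exp (A.mulVec b i - κ i)) * A))) b := by
  have hA : HasFDerivAt (fun b => A.mulVec b)
      (LinearMap.toContinuousLinearMap (Matrix.toLin' A)) b :=
    (LinearMap.toContinuousLinearMap (Matrix.toLin' A)).hasFDerivAt
  have hexp : HasFDerivAt (fun b i => Real.exp (A.mulVec b i - κ i) - 1)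
      (ContinuousLinearMap.pi fun i => Real.exp (A.mulVec b i - κ i) •
        ((ContinuousLinearMap.proj i).comp
          (LinearMap.toContinuousLinearMap (Matrix.toLin' A)))) b := by
    refine hasFDerivAt_pi.2 fun i => ?_
    exact (((hasFDerivAt_pi'.1 hA i).sub_const (κ i)).exp).sub_const 1
  have hS := (LinearMap.toContinuousLinearMap (Matrix.toLin' S)).hasFDerivAt.comp b hexp
  refine hS.congr_fderiv ?_
  ext c i
  simp only [ContinuousLinearMap.comp_apply, LinearMap.coe_toContinuousLinearMap',
    Matrix.toLin'_apply, ← Matrix.mulVec_mulVec]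
  congr 2
  ext j
  simp [Matrix.mulVec_diagonal]

lemma det_fderiv_expAffine (b : ι → ℝ) :
    (LinearMap.toContinuousLinearMap (Matrix.toLin'
      (S * Matrix.diagonal (fun i => Real.exp (A.mulVec b i - κ i)) * A))).det
      = S.det * (∏ i, Real.exp (A.mulVec b i - κ i)) * A.det := by
  rw [ContinuousLinearMap.det, LinearMap.coe_toContinuousLinearMap, LinearMap.det_toLin',
    Matrix.det_mul, Matrix.det_mul, Matrix.det_diagonal]

lemma expAffine_injective (hS : S.det ≠ 0) (hA : A.det ≠ 0) :
    Function.Injective (expAffine S A κ) := by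
  intro b c h
  have h1 := Matrix.mulVec_injective_of_isUnit ((Matrix.isUnit_iff_isUnit_det S).2 hS.isUnit) h
  refine Matrix.mulVec_injective_of_isUnit ((Matrix.isUnit_iff_isUnit_det A).2 hA.isUnit) ?_
  ext i
  have h2 := congrFun h1 i
  simp only [sub_left_inj, Real.exp_eq_exp] at h2
  exact h2

open InformationTheory

/-- If `A` is singular, the differentials of `expAffine S A κ` are singular. -/
lemma klDiv_map_expAffine_eq_top {v : ℝ≥0} (hv : v ≠ 0) (hA : A.det = 0) :
    klDiv ((Measure.pi fun _ : ι => gaussianReal 0 v).map (expAffine S A κ))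
      (Measure.pi fun _ : ι => gaussianReal 0 v) = ∞ := by
  refine klDiv_map_eq_top_of_det_fderiv_eq_zero (lam := volume) ?_ hasFDerivAt_expAffine
    fun b => by rw [det_fderiv_expAffine, hA, mul_zero]
  rw [pi_gaussianReal_eq_withDensity hv]
  exact withDensity_absolutelyContinuous _ _

/-- The differential of `expAffine S A κ` at `b` has determinant `det A · exp (∑ᵢ (A b - κ)ᵢ)` when
`det S = 1`, and the Gaussian density has logarithm `- |b|² / (2 v)` up to a constant. -/
lemma klDiv_map_expAffine {v : ℝ≥0} (hv : v ≠ 0) (hS : S.det = 1) (hA : A.det ≠ 0)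
    (hint : Integrable (fun b : ι → ℝ => (∑ i, expAffine S A κ b i ^ 2 - ∑ i, b i ^ 2) / (2 * v)
      - ∑ i, (A.mulVec b i - κ i) - Real.log |A.det|) (Measure.pi fun _ : ι => gaussianReal 0 v)) :
    klDiv ((Measure.pi fun _ : ι => gaussianReal 0 v).map (expAffine S A κ))
        (Measure.pi fun _ : ι => gaussianReal 0 v)
      = ENNReal.ofReal (∫ b : ι → ℝ, ((∑ i, expAffine S A κ b i ^ 2 - ∑ i, b i ^ 2) / (2 * v)
          - ∑ i, (A.mulVec b i - κ i) - Real.log |A.det|)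
          ∂(Measure.pi fun _ : ι => gaussianReal 0 v)) ∧
    0 ≤ ∫ b : ι → ℝ, ((∑ i, expAffine S A κ b i ^ 2 - ∑ i, b i ^ 2) / (2 * v)
          - ∑ i, (A.mulVec b i - κ i) - Real.log |A.det|)
          ∂(Measure.pi fun _ : ι => gaussianReal 0 v) := by
  have hφm : Measurable fun b : ι → ℝ => ∏ i, gaussianPDFReal 0 v (b i) :=
    Finset.measurable_prod _ fun i _ => (measurable_gaussianPDFReal 0 v).comp (measurable_pi_apply i)
  have hφ : ∀ b : ι → ℝ, 0 < ∏ i, gaussianPDFReal 0 v (b i) := fun b =>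
    Finset.prod_pos fun i _ => gaussianPDFReal_pos 0 v _ hv
  have hexp : ∀ b : ι → ℝ, 0 < ∏ i, Real.exp (A.mulVec b i - κ i) := fun b =>
    Finset.prod_pos fun i _ => Real.exp_pos _
  have hfun : ∀ b : ι → ℝ, Real.log (∏ i, gaussianPDFReal 0 v (b i))
      - Real.log (∏ i, gaussianPDFReal 0 v (expAffine S A κ b i))
      - Real.log |(LinearMap.toContinuousLinearMap (Matrix.toLin'
      (S * Matrix.diagonal (fun i => Real.exp (A.mulVec b i - κ i)) * A))).det|
      = (∑ i, expAffine S A κ b i ^ 2 - ∑ i, b i ^ 2) / (2 * v)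
      - ∑ i, (A.mulVec b i - κ i) - Real.log |A.det| := by
    intro b
    rw [det_fderiv_expAffine, hS, one_mul, abs_mul, abs_of_pos (hexp b),
      Real.log_mul (hexp b).ne' (abs_pos.2 hA).ne', Real.log_prod fun i _ => (Real.exp_pos _).ne',
      log_prod_gaussianPDFReal hv, log_prod_gaussianPDFReal hv]
    simp only [Real.log_exp]
    ring
  have h := klDiv_map_eq_integral_log (lam := (volume : Measure (ι → ℝ)))
    (μ := Measure.pi fun _ : ι => gaussianReal 0 v) hφm hφ (pi_gaussianReal_eq_withDensity hv)
    (hasFDerivAt_expAffine (S := S) (A := A) (κ := κ))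
    (expAffine_injective (by rw [hS]; exact one_ne_zero) hA)
    (fun b => by
      rw [det_fderiv_expAffine, hS, one_mul]
      exact mul_ne_zero (hexp b).ne' hA)
    (by
      simp_rw [det_fderiv_expAffine]
      have h1 : ∀ i, Measurable fun b : ι → ℝ => A.mulVec b i := fun i => by
        have : Continuous fun b : ι → ℝ => A.mulVec b i := by fun_prop
        exact this.measurable
      fun_prop)
    (by simp_rw [hfun]; exact hint)
  simp_rw [hfun] at h
  exact h

end ExpAffine

/-! ### Brownian increments and paths sampled on a grid -/

section Increments

lemma gridTime_eq_uniformPoint {n : ℕ} (hn : n ≠ 0) (k : Fin (n + 1)) :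
    gridTime n k = uniformPoint 0 1 n k := by
  have hn' : (0 : ℝ) < n := by positivity
  have h : (k : ℝ) / n ≤ 1 := by
    rw [div_le_one hn']
    exact_mod_cast Nat.lt_succ_iff.1 k.isLt
  refine Subtype.ext ?_
  simp only [gridTime, uniformPoint, min_eq_left h]
  simp

lemma coe_uniformPoint_unit {n k : ℕ} (hk : k ≤ n) (hn : n ≠ 0) :
    (uniformPoint 0 1 n k : ℝ) = k / n := by
  have hn' : (0 : ℝ) < n := by positivity
  have h : (k : ℝ) / n ≤ 1 := by
    rw [div_le_one hn']
    exact_mod_cast hk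
  simp only [uniformPoint, min_eq_left h]
  simp

/-- The vector of the increments of the components of a path over the intervals
`[k / n, (k + 1) / n]`. -/
noncomputable def incrementVector {l : ℕ} (n : ℕ) (ω : PathSpace l) (p : Fin n × Fin l) : ℝ :=
  ω (uniformPoint 0 1 n (p.1 + 1)) p.2 - ω (uniformPoint 0 1 n p.1) p.2

variable {Ω : Type*} {mΩ : MeasurableSpace Ω} {l : ℕ} {𝓕 : Filtration I mΩ} {P : Measure Ω}
  {x : Fin l → ℝ} {B : Ω → PathSpace l}

lemma measurable_incrementVector (n : ℕ) {X : Ω → PathSpace l}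
    (h : ∀ t, Measurable fun ω => X ω t) :
    Measurable fun ω => incrementVector n (X ω) :=
  measurable_pi_lambda _ fun p => ((measurable_pi_apply p.2).comp (h _)).sub
    ((measurable_pi_apply p.2).comp (h _))

/-- Successive Brownian increments are jointly independent. -/
lemma IsStandardBM.measure_iInter_increments [IsProbabilityMeasure P] (hB : IsStandardBM 𝓕 P x B)
    {s : ℕ → I} (hs : Monotone s) {U : ℕ → Set (Fin l → ℝ)} (hU : ∀ k, MeasurableSet (U k))
    (m : ℕ) :
    P {ω | ∀ k < m, B ω (s (k + 1)) - B ω (s k) ∈ U k}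
        = ∏ k ∈ Finset.range m, P {ω | B ω (s (k + 1)) - B ω (s k) ∈ U k} ∧
      MeasurableSet[𝓕 (s m)] {ω | ∀ k < m, B ω (s (k + 1)) - B ω (s k) ∈ U k} := by
  induction m with
  | zero => simp
  | succ m ih =>
    have hset : {ω | ∀ k < m + 1, B ω (s (k + 1)) - B ω (s k) ∈ U k}
        = {ω | B ω (s (m + 1)) - B ω (s m) ∈ U m}
          ∩ {ω | ∀ k < m, B ω (s (k + 1)) - B ω (s k) ∈ U k} := by
      ext ω
      simp only [Set.mem_ofPred_eq, Set.mem_inter_iff]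
      refine ⟨fun h => ⟨h m (by omega), fun k hk => h k (by omega)⟩, fun h k hk => ?_⟩
      rcases Nat.lt_succ_iff_lt_or_eq.1 hk with hk | rfl
      · exact h.2 k hk
      · exact h.1
    have hle : s m ≤ s (m + 1) := hs (Nat.le_succ m)
    rw [hset]
    refine ⟨?_, ?_⟩
    · have h := (Indep_iff _ _ _).1 (hB.indep_increment _ _ hle) _ _ ⟨U m, hU m, rfl⟩ ih.2
      rw [Finset.prod_range_succ, mul_comm, ← ih.1]
      exact h
    · exact MeasurableSet.inter (hB.measurable_increment hle (hU m)) (𝓕.mono hle _ ih.2)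

/-- The increments of Brownian motion over a uniform grid are independent Gaussians. -/
lemma IsStandardBM.map_incrementVector [IsProbabilityMeasure P] (hB : IsStandardBM 𝓕 P x B)
    (n : ℕ) :
    P.map (fun ω => incrementVector n (B ω))
      = Measure.pi fun _ : Fin n × Fin l => gaussianReal 0 ((n : ℝ≥0)⁻¹) := by
  have hBm : ∀ t, Measurable fun ω => B ω t := fun t => (hB.adapted t).mono (𝓕.le t) le_rfl
  refine (Measure.pi_eq fun u hu => ?_).symm
  rw [Measure.map_apply (measurable_incrementVector n hBm) (MeasurableSet.univ_pi hu)]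
  set U : ℕ → Set (Fin l → ℝ) := fun k =>
    if h : k < n then Set.univ.pi fun i => u (⟨k, h⟩, i) else Set.univ with hUdef
  have hU : ∀ k, MeasurableSet (U k) := by
    intro k
    simp only [hUdef]
    split_ifs
    · exact MeasurableSet.univ_pi fun i => hu _
    · exact MeasurableSet.univ
  have hmono := monotone_uniformPoint (s := 0) (t := 1) unitInterval.le_one' n
  have hset : (fun ω => incrementVector n (B ω)) ⁻¹' (Set.univ.pi u)
      = {ω | ∀ k < n, B ω (uniformPoint 0 1 n (k + 1)) - B ω (uniformPoint 0 1 n k) ∈ U k} := by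
    ext ω
    simp only [Set.mem_preimage, Set.mem_univ_pi, Set.mem_ofPred_eq, incrementVector]
    constructor
    · intro h k hk
      simp only [hUdef, hk, dite_true, Set.mem_univ_pi]
      exact fun i => h (⟨k, hk⟩, i)
    · rintro h ⟨k, i⟩
      have := h k k.isLt
      simp only [hUdef, k.isLt, dite_true, Set.mem_univ_pi] at this
      exact this i
  rw [hset, (hB.measure_iInter_increments hmono hU n).1, Fintype.prod_prod_type,
    ← Fin.prod_univ_eq_prod_range]
  refine Finset.prod_congr rfl fun k _ => ?_
  have hle : uniformPoint 0 1 n (k : ℕ) ≤ uniformPoint 0 1 n (k + 1 : ℕ) := hmono (Nat.le_succ _)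
  have h1 : P {ω | B ω (uniformPoint 0 1 n (k + 1 : ℕ)) - B ω (uniformPoint 0 1 n (k : ℕ)) ∈ U k}
      = P.map (fun ω => B ω (uniformPoint 0 1 n (k + 1 : ℕ)) - B ω (uniformPoint 0 1 n (k : ℕ)))
        (U k) := by
    rw [Measure.map_apply ((hB.measurable_increment hle).mono (𝓕.le _) le_rfl) (hU k)]
    rfl
  have h2 : Real.toNNReal ((uniformPoint 0 1 n (k + 1 : ℕ) : ℝ) - uniformPoint 0 1 n (k : ℕ))
      = (n : ℝ≥0)⁻¹ := by
    rw [uniformPoint_succ_sub k.isLt]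
    refine NNReal.eq ?_
    rw [Real.coe_toNNReal _ (by simp)]
    simp
  rw [h1, hB.law_increment _ _ hle, h2]
  simp only [hUdef, k.isLt, dite_true]
  rw [Measure.pi_pi]

end Increments

section Grid

variable {n l : ℕ}

/-- The path values on the grid, started at `1`, with given increments. -/
def gridOfIncrements (b : Fin n × Fin l → ℝ) (k : Fin (n + 1)) (i : Fin l) : ℝ :=
  1 + ∑ j : Fin n, if (j : ℕ) < k then b (j, i) else 0

/-- The increments of the path values on a grid. -/
def incrementsOfGrid (w : Fin (n + 1) → Fin l → ℝ) (p : Fin n × Fin l) : ℝ :=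
  w p.1.succ p.2 - w p.1.castSucc p.2

lemma measurable_gridOfIncrements : Measurable (gridOfIncrements (n := n) (l := l)) := by
  refine measurable_pi_lambda _ fun k => measurable_pi_lambda _ fun i => ?_
  refine measurable_const.add (Finset.measurable_sum _ fun j _ => ?_)
  split_ifs
  · exact measurable_pi_apply _
  · exact measurable_const

lemma measurable_incrementsOfGrid : Measurable (incrementsOfGrid (n := n) (l := l)) := by
  refine measurable_pi_lambda _ fun p => ?_
  unfold incrementsOfGrid
  fun_prop

lemma leftInverse_incrementsOfGrid :
    Function.LeftInverse (incrementsOfGrid (n := n) (l := l)) gridOfIncrements := by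
  rintro b
  ext ⟨k, i⟩
  simp only [incrementsOfGrid, gridOfIncrements, add_sub_add_left_eq_sub, Fin.val_succ,
    Fin.val_castSucc, ← Finset.sum_sub_distrib]
  rw [Finset.sum_eq_single k]
  · simp
  · intro j _ hj
    have hj' : (j : ℕ) ≠ k := fun h => hj (Fin.ext h)
    by_cases h : (j : ℕ) < k
    · simp [h, Nat.lt_succ_of_lt h]
    · have : ¬ (j : ℕ) < k + 1 := by omega
      simp [h, this]
  · simp

/-- Summing over the indices below `k` in `Fin n`. -/
lemma sum_fin_ite_lt (f : ℕ → ℝ) {k : ℕ} (hk : k ≤ n) :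
    ∑ j : Fin n, (if (j : ℕ) < k then f j else 0) = ∑ j ∈ Finset.range k, f j := by
  rw [Fin.sum_univ_eq_sum_range (fun j => if j < k then f j else 0) n, ← Finset.sum_filter]
  refine Finset.sum_congr ?_ fun _ _ => rfl
  ext j
  simp only [Finset.mem_filter, Finset.mem_range]
  omega

lemma gridSample_eq_gridOfIncrements (hn : n ≠ 0) {ω : PathSpace l} (h0 : ω 0 = fun _ => 1) :
    gridSample n ω = gridOfIncrements (incrementVector n ω) := by
  ext k i
  simp only [gridSample, gridOfIncrements, incrementVector]
  rw [sum_fin_ite_lt (fun j => ω (uniformPoint 0 1 n (j + 1)) i - ω (uniformPoint 0 1 n j) i)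
    (Nat.lt_succ_iff.1 k.isLt), Finset.sum_range_sub (fun j => ω (uniformPoint 0 1 n j) i),
    uniformPoint_zero, h0, gridTime_eq_uniformPoint hn]
  ring

/-- The lower triangular matrix of ones, which turns increments into values. -/
def lowerOnes (n : ℕ) : Matrix (Fin n) (Fin n) ℝ := Matrix.of fun i j => if j ≤ i then 1 else 0

lemma det_lowerOnes (n : ℕ) : (lowerOnes n).det = 1 := by
  rw [Matrix.det_of_isLowerTriangular]
  · simp [lowerOnes]
  · intro i j hij
    have : ¬ j ≤ i := not_le.2 hij
    simp [lowerOnes, this]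

open Kronecker

lemma kronecker_mulVec_apply (Γ : Matrix (Fin l) (Fin l) ℝ) (b : Fin n × Fin l → ℝ) (k : Fin n)
    (i : Fin l) : (lowerOnes n ⊗ₖ Γ).mulVec b (k, i)
      = ∑ j : Fin n, if (j : ℕ) < (k : ℕ) + 1 then ∑ p, Γ i p * b (j, p) else 0 := by
  simp only [Matrix.mulVec, dotProduct, Fintype.sum_prod_type, Matrix.kroneckerMap_apply, lowerOnes,
    Matrix.of_apply]
  refine Finset.sum_congr rfl fun j _ => ?_
  by_cases h : j ≤ k
  · have h' : (j : ℕ) < (k : ℕ) + 1 := Nat.lt_succ_iff.2 h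
    simp [h, h']
  · have h' : ¬ (j : ℕ) < (k : ℕ) + 1 := fun hc => h (Nat.lt_succ_iff.1 hc)
    simp [h, h']

/-- The logarithmic drift `|Γ_i|² (k + 1) / (2 n)` of the Black–Scholes model. -/
noncomputable def logDrift (n : ℕ) (Γ : Matrix (Fin l) (Fin l) ℝ) (p : Fin n × Fin l) : ℝ :=
  (∑ k, Γ p.2 k ^ 2) * (((p.1 : ℕ) : ℝ) + 1) / (2 * n)

/-- The increments of the Black–Scholes model as a function of the increments of the driving
Brownian motion: these are summed and multiplied by `Γ` (the matrix `lowerOnes n ⊗ₖ Γ`), which yields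
the logarithms of the values up to the drift, and the differences of the values are taken (the
inverse of `lowerOnes n ⊗ₖ 1`). -/
noncomputable def blackScholesIncrements (n : ℕ) (Γ : Matrix (Fin l) (Fin l) ℝ) :
    (Fin n × Fin l → ℝ) → Fin n × Fin l → ℝ :=
  expAffine (lowerOnes n ⊗ₖ (1 : Matrix (Fin l) (Fin l) ℝ))⁻¹ (lowerOnes n ⊗ₖ Γ) (logDrift n Γ)

lemma det_lowerOnes_kronecker (Γ : Matrix (Fin l) (Fin l) ℝ) :
    (lowerOnes n ⊗ₖ Γ).det = Γ.det ^ n := by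
  rw [Matrix.det_kronecker, det_lowerOnes]
  simp

lemma det_inv_lowerOnes_kronecker_one :
    ((lowerOnes n ⊗ₖ (1 : Matrix (Fin l) (Fin l) ℝ))⁻¹).det = 1 := by
  rw [Matrix.det_nonsing_inv, det_lowerOnes_kronecker]
  simp

lemma gridOfIncrements_blackScholesIncrements_succ (Γ : Matrix (Fin l) (Fin l) ℝ)
    (b : Fin n × Fin l → ℝ) (k : Fin n) (i : Fin l) :
    gridOfIncrements (blackScholesIncrements n Γ b) k.succ i
      = Real.exp ((lowerOnes n ⊗ₖ Γ).mulVec b (k, i) - logDrift n Γ (k, i)) := by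
  have h1 := kronecker_mulVec_apply (1 : Matrix (Fin l) (Fin l) ℝ) (blackScholesIncrements n Γ b) k i
  have h2 : (lowerOnes n ⊗ₖ (1 : Matrix (Fin l) (Fin l) ℝ)).mulVec (blackScholesIncrements n Γ b)
      = fun p => Real.exp ((lowerOnes n ⊗ₖ Γ).mulVec b p - logDrift n Γ p) - 1 := by
    rw [blackScholesIncrements, expAffine, Matrix.mulVec_mulVec, Matrix.mul_nonsing_inv,
      Matrix.one_mulVec]
    rw [det_lowerOnes_kronecker]
    simp
  rw [h2] at h1
  have h3 : ∀ j : Fin n, ∑ p, (1 : Matrix (Fin l) (Fin l) ℝ) i p * blackScholesIncrements n Γ b (j, p)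
      = blackScholesIncrements n Γ b (j, i) := fun j => by
    simp [Matrix.one_apply]
  simp only [h3] at h1
  simp only [gridOfIncrements, Fin.val_succ]
  rw [← h1]; ring

variable {Ω : Type*} {mΩ : MeasurableSpace Ω} {B M : Ω → PathSpace l}
  {Γ : Matrix (Fin l) (Fin l) ℝ}

lemma mulVec_incrementVector (ω : Ω) (k : Fin n) (i : Fin l) :
    (lowerOnes n ⊗ₖ Γ).mulVec (incrementVector n (B ω)) (k, i)
      = linIncrement B (Γ i) 0 (uniformPoint 0 1 n (k + 1)) ω := by
  rw [kronecker_mulVec_apply]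
  have h := sum_fin_ite_lt (n := n) (k := (k : ℕ) + 1)
    (fun j => linIncrement B (Γ i) (uniformPoint 0 1 n j) (uniformPoint 0 1 n (j + 1)) ω) k.isLt
  have h2 : ∀ m, ∑ j ∈ Finset.range m,
      linIncrement B (Γ i) (uniformPoint 0 1 n j) (uniformPoint 0 1 n (j + 1)) ω
      = linIncrement B (Γ i) 0 (uniformPoint 0 1 n m) ω := by
    intro m
    induction m with
    | zero => simp [uniformPoint_zero, linIncrement]
    | succ m ih => rw [Finset.sum_range_succ, ih, linIncrement_add]
  rw [h2] at h
  exact h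

lemma gridSample_eq_gridOfIncrements_blackScholesIncrements (hn : n ≠ 0) {ω : Ω}
    (h : ∀ i t, M ω t i = stochExp B (Γ i) t ω) :
    gridSample n (M ω)
      = gridOfIncrements (blackScholesIncrements n Γ (incrementVector n (B ω))) := by
  ext k i
  rw [gridSample, h, gridTime_eq_uniformPoint hn]
  induction k using Fin.cases with
  | zero => simp [uniformPoint_zero, stochExp_zero, gridOfIncrements]
  | succ k =>
    rw [gridOfIncrements_blackScholesIncrements_succ, mulVec_incrementVector, stochExp, Fin.val_succ,
      logDrift, coe_uniformPoint_unit k.isLt hn]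
    congr 1
    push_cast
    ring

lemma blackScholesIncrements_incrementVector (hn : n ≠ 0) {ω : Ω}
    (h : ∀ i t, M ω t i = stochExp B (Γ i) t ω) (k : Fin n) (i : Fin l) :
    blackScholesIncrements n Γ (incrementVector n (B ω)) (k, i)
      = stochExp B (Γ i) (uniformPoint 0 1 n (k + 1)) ω
        - stochExp B (Γ i) (uniformPoint 0 1 n k) ω := by
  rw [← leftInverse_incrementsOfGrid (blackScholesIncrements n Γ (incrementVector n (B ω))),
    ← gridSample_eq_gridOfIncrements_blackScholesIncrements hn h]
  simp only [incrementsOfGrid, gridSample, gridTime_eq_uniformPoint hn, h, Fin.val_succ,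
    Fin.val_castSucc]

end Grid

/-! ### The entropy on a grid -/

section GridEntropy

variable {Ω : Type*} {mΩ : MeasurableSpace Ω} {P : Measure Ω} [IsProbabilityMeasure P] {l : ℕ}
  {𝓕 : Filtration I mΩ} {x : Fin l → ℝ} {B M : Ω → PathSpace l} {Γ : Matrix (Fin l) (Fin l) ℝ}

lemma measurable_gridSample (n : ℕ) {X : Ω → PathSpace l} (h : ∀ t, Measurable fun ω => X ω t) :
    Measurable fun ω => gridSample n (X ω) :=
  measurable_pi_lambda _ fun _ => h _

lemma measurable_pathSpace {X : Ω → PathSpace l} (h : ∀ t, Measurable fun ω => X ω t) :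
    Measurable X := by
  refine Measurable.of_le_map (iSup_le fun t => ?_)
  rw [MeasurableSpace.comap_le_iff_le_map]
  exact h t

lemma measurable_eval_pathSpace (t : I) : Measurable fun ω : PathSpace l => ω t :=
  Measurable.of_comap_le (le_iSup (fun t : I =>
    MeasurableSpace.comap (fun ω : PathSpace l => ω t) inferInstance) t)

lemma measurable_expAffine {ι : Type*} [Fintype ι] (S A : Matrix ι ι ℝ) (κ : ι → ℝ) :
    Measurable (expAffine S A κ) := by
  have : Continuous (expAffine S A κ) := by
    unfold expAffine
    fun_prop
  exact this.measurable

variable {Ω' : Type*} {mΩ' : MeasurableSpace Ω'} {P' : Measure Ω'} [IsProbabilityMeasure P']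
  {𝓖 : Filtration I mΩ'} {W : Ω' → PathSpace l}

/-- The entropy on a grid is the relative entropy between the law of the increments of the
Black–Scholes model and the law of the Brownian increments. -/
lemma gridEntropy_eq_klDiv (hB : IsStandardBM 𝓕 P x B)
    (hMm : ∀ t, Measurable fun ω => M ω t)
    (hM : ∀ᵐ ω ∂P, ∀ i t, M ω t i = stochExp B (Γ i) t ω)
    (hW : IsStandardBM 𝓖 P' (fun _ => 1) W) {n : ℕ} (hn : n ≠ 0) :
    gridEntropy n (P.map M) (P'.map W)
      = InformationTheory.klDiv
        ((Measure.pi fun _ : Fin n × Fin l => gaussianReal 0 ((n : ℝ≥0)⁻¹)).map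
          (blackScholesIncrements n Γ))
        (Measure.pi fun _ : Fin n × Fin l => gaussianReal 0 ((n : ℝ≥0)⁻¹)) := by
  have hBm : ∀ t, Measurable fun ω => B ω t := fun t => (hB.adapted t).mono (𝓕.le t) le_rfl
  have hWm : ∀ t, Measurable fun ω => W ω t := fun t => (hW.adapted t).mono (𝓖.le t) le_rfl
  have hgm : Measurable (gridSample n : PathSpace l → _) :=
    measurable_gridSample n measurable_eval_pathSpace
  have hθ : Measurable (blackScholesIncrements n Γ) := measurable_expAffine _ _ _
  have hQ : (P.map M).map (gridSample n)
      = (((Measure.pi fun _ : Fin n × Fin l => gaussianReal 0 ((n : ℝ≥0)⁻¹)).map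
          (blackScholesIncrements n Γ))).map gridOfIncrements := by
    rw [Measure.map_map hgm (measurable_pathSpace hMm), ← hB.map_incrementVector n,
      Measure.map_map hθ (measurable_incrementVector n hBm),
      Measure.map_map measurable_gridOfIncrements (hθ.comp (measurable_incrementVector n hBm))]
    refine Measure.map_congr ?_
    filter_upwards [hM] with ω hω
    exact gridSample_eq_gridOfIncrements_blackScholesIncrements hn hω
  have hR : (P'.map W).map (gridSample n)
      = (Measure.pi fun _ : Fin n × Fin l => gaussianReal 0 ((n : ℝ≥0)⁻¹)).map
          gridOfIncrements := by
    rw [Measure.map_map hgm (measurable_pathSpace hWm), ← hW.map_incrementVector n,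
      Measure.map_map measurable_gridOfIncrements (measurable_incrementVector n hWm)]
    refine Measure.map_congr ?_
    filter_upwards [hW.start] with ω hω
    exact gridSample_eq_gridOfIncrements hn hω
  have : IsProbabilityMeasure ((Measure.pi fun _ : Fin n × Fin l =>
      gaussianReal 0 ((n : ℝ≥0)⁻¹)).map (blackScholesIncrements n Γ)) :=
    Measure.isProbabilityMeasure_map hθ.aemeasurable
  rw [gridEntropy, hQ, hR, klDiv_map_of_leftInverse _ _ measurable_gridOfIncrements
    measurable_incrementsOfGrid leftInverse_incrementsOfGrid]

/-- The entropy on a grid when `Γ` is singular. -/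
lemma gridEntropy_eq_top (hB : IsStandardBM 𝓕 P x B)
    (hMm : ∀ t, Measurable fun ω => M ω t)
    (hM : ∀ᵐ ω ∂P, ∀ i t, M ω t i = stochExp B (Γ i) t ω)
    (hW : IsStandardBM 𝓖 P' (fun _ => 1) W) {n : ℕ} (hn : n ≠ 0) (hΓ : Γ.det = 0) :
    gridEntropy n (P.map M) (P'.map W) = ∞ := by
  rw [gridEntropy_eq_klDiv hB hMm hM hW hn]
  exact klDiv_map_expAffine_eq_top (by simpa using hn)
    (by rw [det_lowerOnes_kronecker, hΓ, zero_pow hn])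

/-- Second moments of the increments of a stochastic exponential, which telescope along a grid. -/
lemma IsStandardBM.integrable_stochExp_sub_sq (hB : IsStandardBM 𝓕 P x B) (γ : Fin l → ℝ) {s t : I}
    (hst : s ≤ t) :
    Integrable (fun ω => (stochExp B γ t ω - stochExp B γ s ω) ^ 2) P ∧
    ∫ ω, (stochExp B γ t ω - stochExp B γ s ω) ^ 2 ∂P
      = Real.exp ((∑ k, γ k ^ 2) * t) - Real.exp ((∑ k, γ k ^ 2) * s) := by
  have i1 := hB.integrable_relStochExp_pow γ hst 1
  have i2 := hB.integrable_relStochExp_pow γ hst 2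
  have e1 := hB.integral_relStochExp_pow γ hst 1
  have e2 := hB.integral_relStochExp_pow γ hst 2
  have s2 := hB.integrable_relStochExp_pow γ (show (0 : I) ≤ s from s.2.1) 2
  have es2 := hB.integral_relStochExp_pow γ (show (0 : I) ≤ s from s.2.1) 2
  simp only [relStochExp_zero_left] at s2 es2
  have hsm : Measurable (stochExp B γ s) := (hB.measurable_stochExp γ s).mono (𝓕.le _) le_rfl
  have hS : MemLp (stochExp B γ s) 2 P :=
    (memLp_two_iff_integrable_sq hsm.aestronglyMeasurable).2 s2
  have hsq : ∀ ω, (relStochExp B γ s t ω - 1) ^ 2 = relStochExp B γ s t ω ^ 2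
      + ((-2) * relStochExp B γ s t ω ^ 1 + 1) := fun ω => by ring
  have hm : Measurable (relStochExp B γ s t) :=
    (hB.measurable_relStochExp γ hst).mono (𝓕.le _) le_rfl
  have hR : MemLp (fun ω => relStochExp B γ s t ω - 1) 2 P := by
    rw [memLp_two_iff_integrable_sq (hm.sub_const _).aestronglyMeasurable]
    simp_rw [hsq]
    exact i2.add ((i1.const_mul _).add (integrable_const _))
  have hRv : ∫ ω, (relStochExp B γ s t ω - 1) ^ 2 ∂P
      = Real.exp ((∑ k, γ k ^ 2) * ((t : ℝ) - s)) - 1 := by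
    simp_rw [hsq]
    have j1 : Integrable (fun ω => (-2) * relStochExp B γ s t ω ^ 1 + 1) P :=
      (i1.const_mul _).add (integrable_const _)
    rw [integral_add i2 j1, integral_add (i1.const_mul _) (integrable_const _),
      integral_const_mul, e1, e2]
    norm_num
    ring
  have hind : IndepFun (stochExp B γ s) (fun ω => relStochExp B γ s t ω - 1) P :=
    indepFun_of_indep_comap (hB.measurable_stochExp γ s) (hB.indep_comp hst
      (f := fun y => Real.exp ((∑ k, γ k * y k) - (∑ k, γ k ^ 2) * ((t : ℝ) - s) / 2) - 1)
      (by fun_prop))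
  have hpt : ∀ ω, (stochExp B γ t ω - stochExp B γ s ω) ^ 2
      = (stochExp B γ s ω * (relStochExp B γ s t ω - 1)) ^ 2 := fun ω => by
    rw [stochExp_eq_mul γ s t ω, relStochExp]; ring
  simp_rw [hpt]
  refine ⟨(memLp_two_mul_of_indepFun hind hS hR).integrable_sq, ?_⟩
  rw [integral_mul_sq_of_indepFun hind hS hR, hRv, es2, mul_sub, mul_one, ← Real.exp_add]
  have h0 : ((0 : I) : ℝ) = 0 := rfl
  rw [h0]
  congr 1
  · congr 1; push_cast; ring
  · congr 1; push_cast; ring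

/-- The logarithm of the density of the increments of the Black–Scholes model is integrable, and its
integral is explicit. -/
lemma integral_log_density (hB : IsStandardBM 𝓕 P x B)
    (hM : ∀ᵐ ω ∂P, ∀ i t, M ω t i = stochExp B (Γ i) t ω) {n : ℕ} (hn : n ≠ 0) :
    Integrable (fun ω =>
      (∑ p, blackScholesIncrements n Γ (incrementVector n (B ω)) p ^ 2
        - ∑ p, incrementVector n (B ω) p ^ 2) / (2 * ((n : ℝ≥0)⁻¹ : ℝ≥0))
      - ∑ p, ((Matrix.kronecker (lowerOnes n) Γ).mulVec (incrementVector n (B ω)) p - logDrift n Γ p)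
      - Real.log |(Matrix.kronecker (lowerOnes n) Γ).det|) P ∧
    ∫ ω, ((∑ p, blackScholesIncrements n Γ (incrementVector n (B ω)) p ^ 2
        - ∑ p, incrementVector n (B ω) p ^ 2) / (2 * ((n : ℝ≥0)⁻¹ : ℝ≥0))
      - ∑ p, ((Matrix.kronecker (lowerOnes n) Γ).mulVec (incrementVector n (B ω)) p - logDrift n Γ p)
      - Real.log |(Matrix.kronecker (lowerOnes n) Γ).det|) ∂P
    = n / 2 * (∑ i, (Real.exp (∑ k, Γ i k ^ 2) - 1) - l) + (n + 1) / 4 * ∑ i, ∑ k, Γ i k ^ 2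
      - n * Real.log |Γ.det| := by
  have hn' : (0 : ℝ) < n := by positivity
  have hmono := monotone_uniformPoint (s := 0) (t := 1) unitInterval.le_one' n
  have hss : ∀ k, uniformPoint 0 1 n k ≤ uniformPoint 0 1 n (k + 1) := fun k => hmono (Nat.le_succ k)
  -- the squared increments of the model
  have hX : Integrable (fun ω => ∑ p, blackScholesIncrements n Γ (incrementVector n (B ω)) p ^ 2) P ∧
      ∫ ω, ∑ p, blackScholesIncrements n Γ (incrementVector n (B ω)) p ^ 2 ∂P
        = ∑ i, (Real.exp (∑ k, Γ i k ^ 2) - 1) := by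
    have hae : (fun ω => ∑ p, blackScholesIncrements n Γ (incrementVector n (B ω)) p ^ 2) =ᵐ[P]
        fun ω => ∑ p : Fin n × Fin l, (stochExp B (Γ p.2) (uniformPoint 0 1 n (p.1 + 1)) ω
          - stochExp B (Γ p.2) (uniformPoint 0 1 n p.1) ω) ^ 2 := by
      filter_upwards [hM] with ω hω
      exact Finset.sum_congr rfl fun p _ => by
        rw [← blackScholesIncrements_incrementVector hn hω]
    have hi : ∀ p : Fin n × Fin l, _ := fun p =>
      hB.integrable_stochExp_sub_sq (Γ p.2) (hss p.1)
    refine ⟨(integrable_congr hae).2 (integrable_finsetSum _ fun p _ => (hi p).1), ?_⟩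
    rw [integral_congr_ae hae, integral_finsetSum _ fun p _ => (hi p).1]
    simp_rw [fun p => (hi p).2]
    rw [Fintype.sum_prod_type_right]
    refine Finset.sum_congr rfl fun i _ => ?_
    simp only
    rw [Fin.sum_univ_eq_sum_range (fun k : ℕ =>
      Real.exp ((∑ k, Γ i k ^ 2) * (uniformPoint 0 1 n (k + 1) : ℝ))
        - Real.exp ((∑ k, Γ i k ^ 2) * (uniformPoint 0 1 n k : ℝ))) n,
      Finset.sum_range_sub (fun k : ℕ => Real.exp ((∑ k, Γ i k ^ 2) * (uniformPoint 0 1 n k : ℝ))),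
      uniformPoint_zero, uniformPoint_self _ _ hn]
    simp
  -- the squared Brownian increments
  have hY : Integrable (fun ω => ∑ p, incrementVector n (B ω) p ^ 2) P ∧
      ∫ ω, ∑ p, incrementVector n (B ω) p ^ 2 ∂P = l := by
    have hlin : ∀ p : Fin n × Fin l, ∀ ω, incrementVector n (B ω) p
        = linIncrement B (Pi.single p.2 1) (uniformPoint 0 1 n p.1)
          (uniformPoint 0 1 n (p.1 + 1)) ω := by
      intro p ω
      simp [incrementVector, linIncrement, Pi.single_apply]
    simp_rw [hlin]
    have hi : ∀ p : Fin n × Fin l, _ := fun p =>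
      (hB.isCentredNoise_linIncrement (Pi.single p.2 1) (hss p.1)).memLp.integrable_sq
    refine ⟨integrable_finsetSum _ fun p _ => hi p, ?_⟩
    rw [integral_finsetSum _ fun p _ => hi p]
    have hv : ∀ p : Fin n × Fin l, ∑ k, (Pi.single p.2 1 : Fin l → ℝ) k ^ 2 = 1 := fun p => by
      simp [Pi.single_apply]
    simp_rw [fun p : Fin n × Fin l => hB.integral_linIncrement_sq (Pi.single p.2 1) (hss p.1), hv,
      one_mul, fun p : Fin n × Fin l => uniformPoint_succ_sub (s := 0) (t := 1) p.1.isLt]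
    simp
    field_simp
  -- the logarithm of the Jacobian, without the determinant
  have hZ : Integrable (fun ω => ∑ p, ((Matrix.kronecker (lowerOnes n) Γ).mulVec
        (incrementVector n (B ω)) p - logDrift n Γ p)) P ∧
      ∫ ω, ∑ p, ((Matrix.kronecker (lowerOnes n) Γ).mulVec
        (incrementVector n (B ω)) p - logDrift n Γ p) ∂P
        = - ((n + 1) / 4 * ∑ i, ∑ k, Γ i k ^ 2) := by
    have hlin : ∀ p : Fin n × Fin l, ∀ ω, (Matrix.kronecker (lowerOnes n) Γ).mulVec
        (incrementVector n (B ω)) p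
        = linIncrement B (Γ p.2) 0 (uniformPoint 0 1 n (p.1 + 1)) ω := fun p ω =>
      mulVec_incrementVector ω p.1 p.2
    simp_rw [hlin]
    have hi : ∀ p : Fin n × Fin l, IsCentredNoise 𝓕 P 0 (uniformPoint 0 1 n (p.1 + 1))
      (linIncrement B (Γ p.2) 0 (uniformPoint 0 1 n (p.1 + 1))) := fun p =>
      hB.isCentredNoise_linIncrement (Γ p.2) unitInterval.nonneg'
    have hi' : ∀ p : Fin n × Fin l, Integrable
        (fun ω => linIncrement B (Γ p.2) 0 (uniformPoint 0 1 n (p.1 + 1)) ω) P := fun p =>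
      (hi p).memLp.integrable (by norm_num)
    have hi'' : ∀ p : Fin n × Fin l, Integrable
        (fun ω => linIncrement B (Γ p.2) 0 (uniformPoint 0 1 n (p.1 + 1)) ω - logDrift n Γ p) P :=
      fun p => (hi' p).sub (integrable_const _)
    refine ⟨integrable_finsetSum _ fun p _ => hi'' p, ?_⟩
    rw [integral_finsetSum _ fun p _ => hi'' p]
    have hval : ∀ p : Fin n × Fin l, ∫ ω, (linIncrement B (Γ p.2) 0 (uniformPoint 0 1 n (p.1 + 1)) ω
        - logDrift n Γ p) ∂P = - logDrift n Γ p := fun p => by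
      rw [integral_sub (hi' p) (integrable_const _), (hi p).integral_eq_zero]
      simp
    simp_rw [hval]
    rw [Fintype.sum_prod_type_right, Finset.mul_sum, ← Finset.sum_neg_distrib]
    refine Finset.sum_congr rfl fun i _ => ?_
    simp only [logDrift, Finset.sum_neg_distrib]
    rw [← Finset.sum_div, ← Finset.mul_sum,
      Fin.sum_univ_eq_sum_range (fun k : ℕ => (k : ℝ) + 1) n]
    have hsum : ∑ k ∈ Finset.range n, ((k : ℝ) + 1) = n * (n + 1) / 2 := by
      clear * -
      induction n with
      | zero => simp
      | succ m ih => rw [Finset.sum_range_succ, ih]; push_cast; ring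
    rw [hsum]
    field_simp
    ring
  have hdet : Real.log |(Matrix.kronecker (lowerOnes n) Γ).det| = n * Real.log |Γ.det| := by
    have h : (Matrix.kronecker (lowerOnes n) Γ).det = Γ.det ^ n := det_lowerOnes_kronecker Γ
    rw [h, abs_pow, Real.log_pow]
  have i0 : Integrable (fun ω => ∑ p, blackScholesIncrements n Γ (incrementVector n (B ω)) p ^ 2
      - ∑ p, incrementVector n (B ω) p ^ 2) P := hX.1.sub hY.1
  have i1 : Integrable (fun ω => (∑ p, blackScholesIncrements n Γ (incrementVector n (B ω)) p ^ 2
      - ∑ p, incrementVector n (B ω) p ^ 2) / (2 * ((n : ℝ≥0)⁻¹ : ℝ≥0))) P := i0.div_const _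
  have i2 : Integrable (fun ω => (∑ p, blackScholesIncrements n Γ (incrementVector n (B ω)) p ^ 2
      - ∑ p, incrementVector n (B ω) p ^ 2) / (2 * ((n : ℝ≥0)⁻¹ : ℝ≥0))
      - ∑ p, ((Matrix.kronecker (lowerOnes n) Γ).mulVec (incrementVector n (B ω)) p
        - logDrift n Γ p)) P :=
    i1.sub hZ.1
  refine ⟨i2.sub (integrable_const _), ?_⟩
  rw [integral_sub i2 (integrable_const _), integral_sub i1 hZ.1, integral_div,
    integral_sub hX.1 hY.1, hX.2, hY.2, hZ.2, hdet]
  simp only [integral_const, probReal_univ, smul_eq_mul, one_mul, NNReal.coe_inv, NNReal.coe_natCast]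
  field_simp
  ring

/-- The entropy on the grid of mesh `1 / n` when `Γ` is invertible. Nonnegativity is stated as well,
since `ENNReal.ofReal` truncates. -/
lemma gridEntropy_eq_ofReal (hB : IsStandardBM 𝓕 P x B)
    (hMm : ∀ t, Measurable fun ω => M ω t)
    (hM : ∀ᵐ ω ∂P, ∀ i t, M ω t i = stochExp B (Γ i) t ω)
    (hW : IsStandardBM 𝓖 P' (fun _ => 1) W) {n : ℕ} (hn : n ≠ 0) (hΓ : Γ.det ≠ 0) :
    gridEntropy n (P.map M) (P'.map W)
        = ENNReal.ofReal (n / 2 * (∑ i, (Real.exp (∑ k, Γ i k ^ 2) - 1) - l)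
          + (n + 1) / 4 * ∑ i, ∑ k, Γ i k ^ 2 - n * Real.log |Γ.det|) ∧
      0 ≤ n / 2 * (∑ i, (Real.exp (∑ k, Γ i k ^ 2) - 1) - l)
          + (n + 1) / 4 * ∑ i, ∑ k, Γ i k ^ 2 - n * Real.log |Γ.det| := by
  have hBm : ∀ t, Measurable fun ω => B ω t := fun t => (hB.adapted t).mono (𝓕.le t) le_rfl
  have hΔ := measurable_incrementVector n hBm
  obtain ⟨h1, h2⟩ := integral_log_density (n := n) hB hM hn
  set F : (Fin n × Fin l → ℝ) → ℝ := fun b =>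
    (∑ p, blackScholesIncrements n Γ b p ^ 2 - ∑ p, b p ^ 2) / (2 * ((n : ℝ≥0)⁻¹ : ℝ≥0))
      - ∑ p, ((Matrix.kronecker (lowerOnes n) Γ).mulVec b p - logDrift n Γ p)
      - Real.log |(Matrix.kronecker (lowerOnes n) Γ).det| with hF
  have hFm : Measurable F := by
    have hθ : Measurable (blackScholesIncrements n Γ) := measurable_expAffine _ _ _
    have hA : Measurable fun b : Fin n × Fin l → ℝ => (Matrix.kronecker (lowerOnes n) Γ).mulVec b := by
      have : Continuous fun b : Fin n × Fin l → ℝ =>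
        (Matrix.kronecker (lowerOnes n) Γ).mulVec b := by fun_prop
      exact this.measurable
    have hθ' : ∀ p, Measurable fun b => blackScholesIncrements n Γ b p := fun p =>
      (measurable_pi_apply p).comp hθ
    have hA' : ∀ p, Measurable fun b : Fin n × Fin l → ℝ =>
      (Matrix.kronecker (lowerOnes n) Γ).mulVec b p := fun p => (measurable_pi_apply p).comp hA
    fun_prop
  have hlaw := hB.map_incrementVector n
  have hint : Integrable F (Measure.pi fun _ : Fin n × Fin l => gaussianReal 0 ((n : ℝ≥0)⁻¹)) := by
    rw [← hlaw, integrable_map_measure hFm.aestronglyMeasurable hΔ.aemeasurable]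
    exact h1
  have hval : ∫ b, F b ∂(Measure.pi fun _ : Fin n × Fin l => gaussianReal 0 ((n : ℝ≥0)⁻¹))
      = n / 2 * (∑ i, (Real.exp (∑ k, Γ i k ^ 2) - 1) - l)
          + (n + 1) / 4 * ∑ i, ∑ k, Γ i k ^ 2 - n * Real.log |Γ.det| := by
    rw [← hlaw, integral_map hΔ.aemeasurable hFm.aestronglyMeasurable]
    exact h2
  have hdet : (Matrix.kronecker (lowerOnes n) Γ).det = Γ.det ^ n := det_lowerOnes_kronecker Γ
  have h := klDiv_map_expAffine (v := (n : ℝ≥0)⁻¹) (by simpa using hn)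
    (det_inv_lowerOnes_kronecker_one (n := n) (l := l))
    (A := Matrix.kronecker (lowerOnes n) Γ) (κ := logDrift n Γ)
    (by rw [hdet]; exact pow_ne_zero n hΓ) hint
  rw [gridEntropy_eq_klDiv hB hMm hM hW hn]
  rw [← hval]
  exact h

end GridEntropy

/-! ### The specific relative entropy of the Black–Scholes model -/

section SpecificEntropy

/-- The specific relative entropy of the Black–Scholes model with an invertible parameter `Γ`. -/
noncomputable def blackScholesEntropy {l : ℕ} (Γ : Matrix (Fin l) (Fin l) ℝ) : ℝ :=
  1 / 2 * (∑ i, (Real.exp (∑ k, Γ i k ^ 2) - 1) - l) + 1 / 4 * ∑ i, ∑ k, Γ i k ^ 2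
    - Real.log |Γ.det|

lemma trace_mul_transpose {l : ℕ} (Γ : Matrix (Fin l) (Fin l) ℝ) :
    (Γ * Γ.transpose).trace = ∑ i, ∑ k, Γ i k ^ 2 := by
  simp [Matrix.trace, Matrix.mul_apply, pow_two]

lemma logDet_mul_transpose_of_det_eq_zero {l : ℕ} {A : Matrix (Fin l) (Fin l) ℝ} (h : A.det = 0) :
    logDet (A * A.transpose) = ⊥ := by
  simp [logDet, h]

lemma logDet_mul_transpose_of_det_ne_zero {l : ℕ} {A : Matrix (Fin l) (Fin l) ℝ} (h : A.det ≠ 0) :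
    logDet (A * A.transpose) = ((2 * Real.log |A.det| : ℝ) : EReal) := by
  have hd : (A * A.transpose).det = |A.det| ^ 2 := by
    rw [Matrix.det_mul, Matrix.det_transpose, sq_abs, pow_two]
  have h0 : 0 < |A.det| := abs_pos.2 h
  rw [logDet, hd, ENNReal.log_ofReal_of_pos (by positivity), Real.log_pow]
  norm_num

variable {Ω : Type*} {mΩ : MeasurableSpace Ω} {l : ℕ} {𝓕 : Filtration I mΩ} {P : Measure Ω}
  [IsProbabilityMeasure P] {x : Fin l → ℝ} {B M : Ω → PathSpace l} {Γ : Matrix (Fin l) (Fin l) ℝ}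
  {Ω' : Type*} {mΩ' : MeasurableSpace Ω'} {P' : Measure Ω'} [IsProbabilityMeasure P']
  {𝓖 : Filtration I mΩ'} {W : Ω' → PathSpace l}

lemma specificEntropy_eq_top (hB : IsStandardBM 𝓕 P x B) (hMm : ∀ t, Measurable fun ω => M ω t)
    (hM : ∀ᵐ ω ∂P, ∀ i t, M ω t i = stochExp B (Γ i) t ω)
    (hW : IsStandardBM 𝓖 P' (fun _ => 1) W) (hΓ : Γ.det = 0) :
    specificEntropy (P.map M) (P'.map W) = ∞ := by
  have h : ∀ n : ℕ, gridEntropy (2 ^ n) (P.map M) (P'.map W) / (2 : ℝ≥0∞) ^ n = ∞ := fun n => by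
    rw [gridEntropy_eq_top hB hMm hM hW (by positivity) hΓ]
    exact ENNReal.top_div_of_ne_top (by finiteness)
  simp [specificEntropy, h]

/-- The entropy on the grid of mesh `2⁻ⁿ`, divided by `2ⁿ`, exceeds its limit by a multiple of
`2⁻ⁿ`. -/
lemma specificEntropy_eq_ofReal (hB : IsStandardBM 𝓕 P x B) (hMm : ∀ t, Measurable fun ω => M ω t)
    (hM : ∀ᵐ ω ∂P, ∀ i t, M ω t i = stochExp B (Γ i) t ω)
    (hW : IsStandardBM 𝓖 P' (fun _ => 1) W) (hΓ : Γ.det ≠ 0) :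
    specificEntropy (P.map M) (P'.map W) = ENNReal.ofReal (blackScholesEntropy Γ) ∧
      0 ≤ blackScholesEntropy Γ := by
  set c : ℝ := 1 / 4 * ∑ i, ∑ k, Γ i k ^ 2 with hc
  have hval : ∀ n : ℕ, ((2 ^ n : ℕ) / 2 * (∑ i, (Real.exp (∑ k, Γ i k ^ 2) - 1) - l)
        + ((2 ^ n : ℕ) + 1) / 4 * ∑ i, ∑ k, Γ i k ^ 2 - (2 ^ n : ℕ) * Real.log |Γ.det|) / 2 ^ n
      = blackScholesEntropy Γ + c * (1 / 2) ^ n := fun n => by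
    rw [blackScholesEntropy, hc, div_pow, one_pow]
    push_cast
    field_simp
    ring
  have hlim : Tendsto (fun n : ℕ => blackScholesEntropy Γ + c * (1 / 2 : ℝ) ^ n) atTop
      (𝓝 (blackScholesEntropy Γ)) := by
    have := (tendsto_pow_atTop_nhds_zero_of_lt_one (r := (1 / 2 : ℝ)) (by norm_num)
      (by norm_num)).const_mul c
    simpa using this.const_add (blackScholesEntropy Γ)
  have hg : ∀ n : ℕ, _ := fun n : ℕ =>
    gridEntropy_eq_ofReal (n := 2 ^ n) hB hMm hM hW (by positivity) hΓ
  have hterm : ∀ n : ℕ, gridEntropy (2 ^ n) (P.map M) (P'.map W) / (2 : ℝ≥0∞) ^ n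
      = ENNReal.ofReal (blackScholesEntropy Γ + c * (1 / 2 : ℝ) ^ n) := fun n => by
    have h2 : (2 : ℝ≥0∞) ^ n = ENNReal.ofReal (2 ^ n) := by
      rw [ENNReal.ofReal_pow (by norm_num)]
      norm_num
    rw [(hg n).1, h2, ← ENNReal.ofReal_div_of_pos (by positivity), hval]
  refine ⟨?_, ge_of_tendsto' hlim fun n => ?_⟩
  · simp_rw [specificEntropy, hterm]
    exact (ENNReal.tendsto_ofReal hlim).liminf_eq
  · rw [← hval]
    exact div_nonneg (hg n).2 (by positivity)

end SpecificEntropy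

/-! ### The lower bound in Gantert's inequality -/

section Gantert

lemma gantertBound_congr {l : ℕ} {Ω : Type*} {mΩ : MeasurableSpace Ω} {P : Measure Ω}
    {G G' : I → Ω → Matrix (Fin l) (Fin l) ℝ}
    (h : ∀ᵐ ω ∂P, ∀ᵐ t, G t ω = G' t ω) : gantertBound P G = gantertBound P G' := by
  refine lintegral_congr_ae ?_
  filter_upwards [h] with ω hω
  refine lintegral_congr_ae ?_
  filter_upwards [hω] with t ht
  rw [ht]

/-- `tr A - l - log det A` is the sum of `λ - 1 - log λ` over the eigenvalues `λ` of `A`. -/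
lemma Matrix.PosDef.log_det_le {l : ℕ} {A : Matrix (Fin l) (Fin l) ℝ} (hA : A.PosDef) :
    Real.log A.det ≤ A.trace - l := by
  have h := hA.isHermitian.trace_eq_sum_eigenvalues
  have hd := hA.isHermitian.det_eq_prod_eigenvalues
  simp only [RCLike.ofReal_real_eq_id, id] at h hd
  rw [h, hd, Real.log_prod (fun i _ => (hA.eigenvalues_pos i).ne')]
  calc ∑ i, Real.log (hA.isHermitian.eigenvalues i)
      ≤ ∑ i, (hA.isHermitian.eigenvalues i - 1) :=
        Finset.sum_le_sum fun i _ => Real.log_le_sub_one_of_pos (hA.eigenvalues_pos i)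
    _ = _ := by simp

/-- The real value of `F_l(A Aᵀ)` for `A = diag(y) Γ`, with positive `y` and invertible `Γ`. -/
noncomputable def gantertIntegrand {l : ℕ} (Γ : Matrix (Fin l) (Fin l) ℝ) (y : Fin l → ℝ) : ℝ :=
  1 / 2 * (∑ i, (∑ k, Γ i k ^ 2) * y i ^ 2 - l) - ∑ i, Real.log (y i) - Real.log |Γ.det|

variable {l : ℕ} {Γ : Matrix (Fin l) (Fin l) ℝ}

lemma det_blackScholesCoeff (y : Fin l → ℝ) : (blackScholesCoeff Γ y).det = (∏ i, y i) * Γ.det := by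
  simp [blackScholesCoeff]

lemma trace_blackScholesCoeff_mul_transpose (y : Fin l → ℝ) :
    (blackScholesCoeff Γ y * (blackScholesCoeff Γ y).transpose).trace
      = ∑ i, (∑ k, Γ i k ^ 2) * y i ^ 2 := by
  simp only [trace_mul_transpose, blackScholesCoeff, Matrix.diagonal_mul, mul_pow, Finset.sum_mul]
  exact Finset.sum_congr rfl fun i _ => Finset.sum_congr rfl fun k _ => mul_comm _ _

lemma gantertF_blackScholesCoeff_of_det_eq_zero (hΓ : Γ.det = 0) (y : Fin l → ℝ) :
    gantertF (blackScholesCoeff Γ y * (blackScholesCoeff Γ y).transpose) = ⊤ := by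
  rw [gantertF, logDet_mul_transpose_of_det_eq_zero (by rw [det_blackScholesCoeff, hΓ, mul_zero]),
    EReal.coe_sub_bot, EReal.coe_mul_top_of_pos (by norm_num)]

lemma log_abs_det_blackScholesCoeff (hΓ : Γ.det ≠ 0) {y : Fin l → ℝ} (hy : ∀ i, 0 < y i) :
    Real.log |(blackScholesCoeff Γ y).det| = ∑ i, Real.log (y i) + Real.log |Γ.det| := by
  have hp : 0 < ∏ i, y i := Finset.prod_pos fun i _ => hy i
  rw [det_blackScholesCoeff, abs_mul, abs_of_pos hp, Real.log_mul hp.ne' (abs_ne_zero.2 hΓ),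
    Real.log_prod fun i _ => (hy i).ne']

lemma gantertF_blackScholesCoeff (hΓ : Γ.det ≠ 0) {y : Fin l → ℝ} (hy : ∀ i, 0 < y i) :
    gantertF (blackScholesCoeff Γ y * (blackScholesCoeff Γ y).transpose)
      = (gantertIntegrand Γ y : EReal) := by
  have hp : 0 < ∏ i, y i := Finset.prod_pos fun i _ => hy i
  rw [gantertF, logDet_mul_transpose_of_det_ne_zero
    (by rw [det_blackScholesCoeff]; exact mul_ne_zero hp.ne' hΓ),
    log_abs_det_blackScholesCoeff hΓ hy, trace_blackScholesCoeff_mul_transpose, ← EReal.coe_sub,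
    ← EReal.coe_mul, gantertIntegrand]
  congr 1
  ring

/-- `A Aᵀ` is positive definite, so that its eigenvalues satisfy `log λ ≤ λ - 1`. -/
lemma gantertIntegrand_nonneg (hΓ : Γ.det ≠ 0) {y : Fin l → ℝ} (hy : ∀ i, 0 < y i) :
    0 ≤ gantertIntegrand Γ y := by
  have hp : 0 < ∏ i, y i := Finset.prod_pos fun i _ => hy i
  set A := blackScholesCoeff Γ y with hA
  have hdet : A.det ≠ 0 := by
    rw [hA, det_blackScholesCoeff]
    exact mul_ne_zero hp.ne' hΓ
  have hpos : (A * A.transpose).PosDef := by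
    have h := Matrix.PosDef.mul_conjTranspose_self A (Matrix.vecMul_injective_of_isUnit
      ((Matrix.isUnit_iff_isUnit_det A).2 hdet.isUnit))
    rwa [Matrix.conjTranspose_eq_transpose_of_trivial] at h
  have h := hpos.log_det_le
  rw [trace_blackScholesCoeff_mul_transpose, Matrix.det_mul, Matrix.det_transpose, ← abs_mul_abs_self,
    Real.log_mul (abs_ne_zero.2 hdet) (abs_ne_zero.2 hdet),
    log_abs_det_blackScholesCoeff hΓ hy] at h
  rw [gantertIntegrand]
  linarith

variable {Ω : Type*} {mΩ : MeasurableSpace Ω} {𝓕 : Filtration I mΩ} {P : Measure Ω}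
  [IsProbabilityMeasure P] {x : Fin l → ℝ} {B M : Ω → PathSpace l}

/-- The expectation of `F_l` along the Black–Scholes model at a fixed time. -/
lemma integral_gantertIntegrand (hB : IsStandardBM 𝓕 P x B)
    (hM : ∀ᵐ ω ∂P, ∀ i t, M ω t i = stochExp B (Γ i) t ω) (t : I) :
    Integrable (fun ω => gantertIntegrand Γ (M ω t)) P ∧
      ∫ ω, gantertIntegrand Γ (M ω t) ∂P
        = 1 / 2 * (∑ i, (∑ k, Γ i k ^ 2) * Real.exp ((∑ k, Γ i k ^ 2) * t) - l)
          + (∑ i, (∑ k, Γ i k ^ 2)) * t / 2 - Real.log |Γ.det| := by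
  have h0 : (0 : I) ≤ t := t.2.1
  have hae : (fun ω => gantertIntegrand Γ (M ω t)) =ᵐ[P] fun ω =>
      1 / 2 * (∑ i, (∑ k, Γ i k ^ 2) * stochExp B (Γ i) t ω ^ 2 - l)
        - ∑ i, (linIncrement B (Γ i) 0 t ω - (∑ k, Γ i k ^ 2) * t / 2) - Real.log |Γ.det| := by
    filter_upwards [hM] with ω hω
    simp only [gantertIntegrand, hω]
    simp only [stochExp, Real.log_exp]
  have s2 : ∀ i, Integrable (fun ω => stochExp B (Γ i) t ω ^ 2) P := fun i => by
    simpa only [relStochExp_zero_left] using hB.integrable_relStochExp_pow (Γ i) h0 2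
  have es2 : ∀ i, ∫ ω, stochExp B (Γ i) t ω ^ 2 ∂P = Real.exp ((∑ k, Γ i k ^ 2) * t) := fun i => by
    have h := hB.integral_relStochExp_pow (Γ i) h0 2
    simp only [relStochExp_zero_left] at h
    rw [h]
    norm_num
  have hL := fun i => hB.isCentredNoise_linIncrement (Γ i) h0
  have hLi : ∀ i, Integrable (fun ω => linIncrement B (Γ i) 0 t ω) P := fun i =>
    (hL i).memLp.integrable (by norm_num)
  have hLi' : ∀ i, Integrable (fun ω => linIncrement B (Γ i) 0 t ω - (∑ k, Γ i k ^ 2) * t / 2) P :=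
    fun i => (hLi i).sub (integrable_const _)
  have hS : Integrable (fun ω => ∑ i, (∑ k, Γ i k ^ 2) * stochExp B (Γ i) t ω ^ 2) P :=
    integrable_finsetSum _ fun i _ => (s2 i).const_mul _
  have hS' : Integrable (fun ω => ∑ i, (∑ k, Γ i k ^ 2) * stochExp B (Γ i) t ω ^ 2 - (l : ℝ)) P :=
    hS.sub (integrable_const _)
  have hS'' : Integrable (fun ω =>
      1 / 2 * (∑ i, (∑ k, Γ i k ^ 2) * stochExp B (Γ i) t ω ^ 2 - (l : ℝ))) P := hS'.const_mul _
  have hT : Integrable (fun ω =>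
      ∑ i, (linIncrement B (Γ i) 0 t ω - (∑ k, Γ i k ^ 2) * t / 2)) P :=
    integrable_finsetSum _ fun i _ => hLi' i
  have hST : Integrable (fun ω =>
      1 / 2 * (∑ i, (∑ k, Γ i k ^ 2) * stochExp B (Γ i) t ω ^ 2 - (l : ℝ))
        - ∑ i, (linIncrement B (Γ i) 0 t ω - (∑ k, Γ i k ^ 2) * t / 2)) P := hS''.sub hT
  have hval : ∀ i, ∫ ω, (linIncrement B (Γ i) 0 t ω - (∑ k, Γ i k ^ 2) * t / 2) ∂P
      = - ((∑ k, Γ i k ^ 2) * t / 2) := fun i => by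
    rw [integral_sub (hLi i) (integrable_const _), (hL i).integral_eq_zero]
    simp
  refine ⟨(integrable_congr hae).2 (hST.sub (integrable_const _)), ?_⟩
  rw [integral_congr_ae hae, integral_sub hST (integrable_const _), integral_sub hS'' hT,
    integral_const_mul, integral_sub hS (integrable_const _),
    integral_finsetSum _ fun i _ => (s2 i).const_mul _, integral_finsetSum _ fun i _ => hLi' i]
  simp only [integral_const_mul, es2, hval, integral_const, probReal_univ, smul_eq_mul, one_mul,
    Finset.sum_neg_distrib]
  rw [← Finset.sum_div, ← Finset.sum_mul, sub_neg_eq_add]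

lemma integral_unitInterval (f : ℝ → ℝ) : ∫ t : I, f t = ∫ t in (0 : ℝ)..1, f t := by
  rw [intervalIntegral.integral_of_le zero_le_one, ← integral_Icc_eq_integral_Ioc]
  exact integral_subtype_comap measurableSet_Icc f

lemma integral_integral_gantertIntegrand (Γ : Matrix (Fin l) (Fin l) ℝ) :
    ∫ t : I, (1 / 2 * (∑ i, (∑ k, Γ i k ^ 2) * Real.exp ((∑ k, Γ i k ^ 2) * t) - l)
          + (∑ i, (∑ k, Γ i k ^ 2)) * t / 2 - Real.log |Γ.det|) = blackScholesEntropy Γ := by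
  rw [integral_unitInterval fun t : ℝ =>
    1 / 2 * (∑ i, (∑ k, Γ i k ^ 2) * Real.exp ((∑ k, Γ i k ^ 2) * t) - l)
          + (∑ i, (∑ k, Γ i k ^ 2)) * t / 2 - Real.log |Γ.det|]
  rw [intervalIntegral.integral_eq_sub_of_hasDerivAt
    (f := fun t : ℝ => 1 / 2 * (∑ i, Real.exp ((∑ k, Γ i k ^ 2) * t) - l * t)
      + (∑ i, (∑ k, Γ i k ^ 2)) * t ^ 2 / 4 - Real.log |Γ.det| * t)]
  · simp only [blackScholesEntropy, mul_one, mul_zero, Real.exp_zero, Finset.sum_sub_distrib]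
    ring
  · intro t _
    have hid := hasDerivAt_id' t
    have hexp : HasDerivAt (fun t : ℝ => ∑ i, Real.exp ((∑ k, Γ i k ^ 2) * t))
        (∑ i, (∑ k, Γ i k ^ 2) * Real.exp ((∑ k, Γ i k ^ 2) * t)) t := by
      refine HasDerivAt.fun_sum fun i _ => ?_
      have h := (hid.const_mul (∑ k, Γ i k ^ 2)).exp
      rw [mul_one, mul_comm] at h
      exact h
    have h := (((hexp.sub (hid.const_mul (l : ℝ))).const_mul (1 / 2)).add
      (((hasDerivAt_pow 2 t).const_mul (∑ i, (∑ k, Γ i k ^ 2))).div_const 4)).sub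
      (hid.const_mul (Real.log |Γ.det|))
    refine h.congr_deriv ?_
    norm_num
    ring
  · exact Continuous.intervalIntegrable (by fun_prop) _ _

/-- Along the Black–Scholes model, the lower bound in Gantert's inequality equals the closed form of
the specific relative entropy. -/
lemma gantertBound_eq_ofReal (hB : IsStandardBM 𝓕 P x B) (hMm : ∀ t, Measurable fun ω => M ω t)
    (hM : ∀ᵐ ω ∂P, ∀ i t, M ω t i = stochExp B (Γ i) t ω) (hΓ : Γ.det ≠ 0) :
    gantertBound P
        (fun t ω => blackScholesCoeff Γ (M ω t) * (blackScholesCoeff Γ (M ω t)).transpose)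
      = ENNReal.ofReal (blackScholesEntropy Γ) := by
  have hpos : ∀ᵐ ω ∂P, ∀ t i, 0 < M ω t i := by
    filter_upwards [hM] with ω hω t i
    rw [hω]
    exact stochExp_pos _ _ _
  have hm : Measurable fun p : Ω × I => gantertIntegrand Γ (M p.1 p.2) := by
    have h : ∀ i, Measurable (fun p : Ω × I => M p.1 p.2 i) := fun i =>
      (measurable_uncurry_of_continuous_of_measurable (u := fun (t : I) ω => M ω t i)
        (fun ω => by fun_prop) fun t => (measurable_pi_apply i).comp (hMm t)).comp measurable_swap
    unfold gantertIntegrand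
    fun_prop
  have hfix : ∀ t : I, ∫⁻ ω, ENNReal.ofReal (gantertIntegrand Γ (M ω t)) ∂P
      = ENNReal.ofReal (∫ ω, gantertIntegrand Γ (M ω t) ∂P) := fun t => by
    refine (ofReal_integral_eq_lintegral_ofReal (integral_gantertIntegrand hB hM t).1 ?_).symm
    filter_upwards [hpos] with ω hω using gantertIntegrand_nonneg hΓ (hω t)
  calc gantertBound P
        (fun t ω => blackScholesCoeff Γ (M ω t) * (blackScholesCoeff Γ (M ω t)).transpose)
      = ∫⁻ ω, (∫⁻ t : I, ENNReal.ofReal (gantertIntegrand Γ (M ω t))) ∂P := by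
        refine lintegral_congr_ae ?_
        filter_upwards [hpos] with ω hω
        refine lintegral_congr fun t => ?_
        rw [gantertF_blackScholesCoeff hΓ (hω t), EReal.toENNReal_of_ne_top (by simp)]
        simp
    _ = ∫⁻ t : I, ∫⁻ ω, ENNReal.ofReal (gantertIntegrand Γ (M ω t)) ∂P :=
        lintegral_lintegral_swap (ENNReal.measurable_ofReal.comp hm).aemeasurable
    _ = ∫⁻ t : I, ENNReal.ofReal (∫ ω, gantertIntegrand Γ (M ω t) ∂P) := by simp_rw [hfix]
    _ = ENNReal.ofReal (∫ t : I, ∫ ω, gantertIntegrand Γ (M ω t) ∂P) := by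
        refine (ofReal_integral_eq_lintegral_ofReal ?_ (ae_of_all _ fun t => ?_)).symm
        · simp_rw [fun t => (integral_gantertIntegrand hB hM t).2]
          have hc : Continuous fun t : I =>
              1 / 2 * (∑ i, (∑ k, Γ i k ^ 2) * Real.exp ((∑ k, Γ i k ^ 2) * t) - l)
                + (∑ i, (∑ k, Γ i k ^ 2)) * t / 2 - Real.log |Γ.det| := by fun_prop
          exact hc.integrable_of_hasCompactSupport (HasCompactSupport.of_compactSpace _)
        · refine integral_nonneg_of_ae ?_
          filter_upwards [hpos] with ω hω using gantertIntegrand_nonneg hΓ (hω t)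
    _ = ENNReal.ofReal (blackScholesEntropy Γ) := by
        simp_rw [fun t => (integral_gantertIntegrand hB hM t).2,
          integral_integral_gantertIntegrand]

lemma gantertBound_eq_top (hΓ : Γ.det = 0) :
    gantertBound P
      (fun t ω => blackScholesCoeff Γ (M ω t) * (blackScholesCoeff Γ (M ω t)).transpose) = ∞ := by
  simp [gantertBound, gantertF_blackScholesCoeff_of_det_eq_zero hΓ]

end Gantert

theorem lemma1p3 {l : ℕ} (Γ : Matrix (Fin l) (Fin l) ℝ)
    {Ω : Type*} {mΩ : MeasurableSpace Ω} (P : Measure Ω) [IsProbabilityMeasure P]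
    (𝓕 : Filtration I mΩ) (B : Ω → PathSpace l) (hB : IsStandardBM 𝓕 P 0 B)
    (M : Ω → PathSpace l) (hM : IsBlackScholesModel 𝓕 P B Γ (fun _ => 1) M)
    {Ω' : Type*} {mΩ' : MeasurableSpace Ω'} (P' : Measure Ω') [IsProbabilityMeasure P']
    (𝓖 : Filtration I mΩ') (W : Ω' → PathSpace l) (hW : IsStandardBM 𝓖 P' (fun _ => 1) W) :
    -- the closed form, with `log 0 = -∞`
    (specificEntropy (P.map M) (P'.map W) : EReal)
        = ((1 / 2 : ℝ) : EReal) *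
          (((∑ i, (Real.exp (∑ k, Γ i k ^ 2) - 1) - (l : ℝ)
              + 1 / 2 * (Γ * Γ.transpose).trace : ℝ) : EReal)
            - logDet (Γ * Γ.transpose)) ∧
    -- equality in Gantert's inequality: `M` has an absolutely continuous quadratic covariation
    -- with density `σ σᵀ`, `σ = diag(M) Γ`, and for (any version of) the density of the quadratic
    -- covariation the lower bound is attained
    IsQuadraticCovariationDensity P M
        (fun t ω => blackScholesCoeff Γ (M ω t) * (blackScholesCoeff Γ (M ω t)).transpose) ∧
    ∀ G : I → Ω → Matrix (Fin l) (Fin l) ℝ, IsQuadraticCovariationDensity P M G →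
      specificEntropy (P.map M) (P'.map W) = gantertBound P G := by
  have hMm : ∀ t, Measurable fun ω => M ω t := fun t => (hM.adapted t).mono (𝓕.le t) le_rfl
  have hE := hM.ae_eq_stochExp hB
  have hcov := hM.isQuadraticCovariationDensity hB
  refine ⟨?_, hcov, fun G hG => ?_⟩
  · by_cases hΓ : Γ.det = 0
    · rw [specificEntropy_eq_top hB hMm hE hW hΓ, logDet_mul_transpose_of_det_eq_zero hΓ,
        EReal.coe_sub_bot, EReal.coe_mul_top_of_pos (by norm_num), EReal.coe_ennreal_top]
    · obtain ⟨h, h0⟩ := specificEntropy_eq_ofReal hB hMm hE hW hΓ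
      rw [h, logDet_mul_transpose_of_det_ne_zero hΓ, EReal.coe_ennreal_ofReal, max_eq_left h0,
        ← EReal.coe_sub, ← EReal.coe_mul, trace_mul_transpose, blackScholesEntropy]
      congr 1
      ring
  · rw [gantertBound_congr (hG.ae_eq hcov)]
    by_cases hΓ : Γ.det = 0
    · rw [specificEntropy_eq_top hB hMm hE hW hΓ, gantertBound_eq_top hΓ]
    · rw [(specificEntropy_eq_ofReal hB hMm hE hW hΓ).1, gantertBound_eq_ofReal hB hMm hE hΓ]
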